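/- Let $\mathbf M$ be a complete and cocomplete closed symmetric monoidal category. An orthogonality relation $\perp$ on a small category $\mathbf C$ is a symmetric relation on pairs of morphisms with common target which is stable under post-composition, $f_1\perp f_2\Rightarrow gf_1\perp gf_2$, and pre-composition, $f_1\perp f_2\Rightarrow f_1h_1\perp f_2h_2$. For $\overline{\mathbf C}=(\mathbf C,\perp)$ let $\mathcal O_{\overline{\mathbf C}}$ be the coloured operad whose colours are the objects of $\mathbf C$ and whose operations from $(c_1,\dots,c_n)$ to $t$ are the classes $[\sigma,\underline f]$ of pairs of a permutation $\sigma\in\Sigma_n$ and a family $\underline f=(f_i:c_i\to t)_{i=1}^n$, where $(\sigma,\underline f)\sim(\sigma',\underline f')$ if and only if $\underline f=\underline f'$ and the sequence $(f_{\sigma^{-1}(1)},\dots,f_{\sigma^{-1}(n)})$ can be turned into $(f_{\sigma'^{-1}(1)},\dots,f_{\sigma'^{-1}(n)})$, as orderings of the indices, by finitely many transpositions of adjacent orthogonal morphisms. The symmetric groups act by $[\sigma,\underline f]\cdot\sigma'=[\sigma\sigma',\underline f\sigma']$, the unit is $[e,\mathrm{id}_t]$, and composition is given by composing morphisms and by $\sigma(\sigma_1,\dots,\sigma_m)=\sigma\langle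 k_{\sigma^{-1}(1)},\dots,k_{\sigma^{-1}(m)}\rangle\,(\sigma_1\oplus\cdots\oplus\sigma_m)$ (a block permutation times a block sum) on permutations. Let $\mathbf{Alg}(\mathcal O_{\overline{\mathbf C}})$ be the category of algebras over $\mathcal O_{\overline{\mathbf C}}$ in $\mathbf M$ (equivalently, over the $\mathbf M$-valued operad obtained by the change of base $S\mapsto\coprod_S I$, where $I$ is the monoidal unit). A functor $F:\mathbf C\to\mathbf D$ that preserves orthogonal pairs induces an operad morphism $[\sigma,\underline f]\mapsto[\sigma,F(\underline f)]$ and hence a pullback functor $\mathcal O_F^*:\mathbf{Alg}(\mathcal O_{\overline{\mathbf D}})\to\mathbf{Alg}(\mathcal O_{\overline{\mathbf C}})$. **Proposition.** Let $\overline{\mathbf C}=(\mathbf C,\perp)$ be a small orthogonal category, let $W\subseteq\mathrm{Mor}\,\mathbf C$ be any subset, and let $L:\mathbf C\to\mathbf C[W^{-1}]$ be a localization of $\mathbf C$ at $W$, with $\mathbf C[W^{-1}]$ small. Equip $\mathbf C[W^{-1}]$ with the pushforward orthogonality relation $$L_*(\perp)=\{(g\,L(f_1)\,h_1,\;g\,L(f_2)\,h_2)\;:\;f_1\perp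 f_2,\ g,h_1,h_2\in\mathrm{Mor}\,\mathbf C[W^{-1}]\}$$ (over all composable $g,h_1,h_2$), and write $\overline{\mathbf C[W^{-1}]}=(\mathbf C[W^{-1}],L_*(\perp))$. Then $\mathcal O_L^*:\mathbf{Alg}(\mathcal O_{\overline{\mathbf C[W^{-1}]}})\to\mathbf{Alg}(\mathcal O_{\overline{\mathbf C}})$ has a left adjoint ${\mathcal O_L}_!$ and is fully faithful; that is, the adjunction ${\mathcal O_L}_!\dashv\mathcal O_L^*$ exhibits $\mathbf{Alg}(\mathcal O_{\overline{\mathbf C[W^{-1}]}})$ as a full reflective subcategory of $\mathbf{Alg}(\mathcal O_{\overline{\mathbf C}})$. In particular, for every such adjunction the counit ${\mathcal O_L}_!\,\mathcal O_L^*\to\mathrm{id}$ is a natural isomorphism. -/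

import Mathlib

open CategoryTheory MonoidalCategory Limits

universe v u w

namespace AQFT

/-! ### Orthogonal categories -/

/-- An orthogonality relation on a category: a symmetric relation on pairs of morphisms with common
target, stable under post-composition and under (independent) pre-composition. -/
structure OrthogonalityRelation (C : Type u) [Category.{v} C] where
  /-- `perp f₁ f₂` is `f₁ ⊥ f₂`. -/
  perp : ∀ {c₁ c₂ c : C}, (c₁ ⟶ c) → (c₂ ⟶ c) → Prop
  symm : ∀ {c₁ c₂ c : C} {f₁ : c₁ ⟶ c} {f₂ : c₂ ⟶ c}, perp f₁ f₂ → perp f₂ f₁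
  postcomp : ∀ {c₁ c₂ c d : C} {f₁ : c₁ ⟶ c} {f₂ : c₂ ⟶ c} (g : c ⟶ d),
    perp f₁ f₂ → perp (f₁ ≫ g) (f₂ ≫ g)
  precomp : ∀ {b₁ b₂ c₁ c₂ c : C} {f₁ : c₁ ⟶ c} {f₂ : c₂ ⟶ c} (h₁ : b₁ ⟶ c₁) (h₂ : b₂ ⟶ c₂),
    perp f₁ f₂ → perp (h₁ ≫ f₁) (h₂ ≫ f₂)

/-- A functor is orthogonal if it preserves orthogonal pairs. -/
def IsOrthogonal {C : Type u} [Category.{v} C] {D : Type u} [Category.{v} D]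
    (P : OrthogonalityRelation C) (Q : OrthogonalityRelation D) (F : C ⥤ D) : Prop :=
  ∀ ⦃c₁ c₂ c : C⦄ (f₁ : c₁ ⟶ c) (f₂ : c₂ ⟶ c), P.perp f₁ f₂ → Q.perp (F.map f₁) (F.map f₂)

/-- The pushforward `F_*(⊥)` of an orthogonality relation along a functor `F`: all pairs
`(g F(f₁) h₁, g F(f₂) h₂)` with `f₁ ⊥ f₂`. -/
def OrthogonalityRelation.pushforward {C : Type u} [Category.{v} C] {D : Type u} [Category.{v} D]
    (P : OrthogonalityRelation C) (F : C ⥤ D) : OrthogonalityRelation D where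
  perp {d₁ d₂ d} k₁ k₂ := ∃ (c₁ c₂ c : C) (f₁ : c₁ ⟶ c) (f₂ : c₂ ⟶ c)
    (g : F.obj c ⟶ d) (h₁ : d₁ ⟶ F.obj c₁) (h₂ : d₂ ⟶ F.obj c₂),
    P.perp f₁ f₂ ∧ k₁ = h₁ ≫ F.map f₁ ≫ g ∧ k₂ = h₂ ≫ F.map f₂ ≫ g
  symm := by
    rintro d₁ d₂ d k₁ k₂ ⟨c₁, c₂, c, f₁, f₂, g, h₁, h₂, h, rfl, rfl⟩
    exact ⟨c₂, c₁, c, f₂, f₁, g, h₂, h₁, P.symm h, rfl, rfl⟩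
  postcomp := by
    rintro d₁ d₂ d d' k₁ k₂ g' ⟨c₁, c₂, c, f₁, f₂, g, h₁, h₂, h, rfl, rfl⟩
    exact ⟨c₁, c₂, c, f₁, f₂, g ≫ g', h₁, h₂, h, by simp, by simp⟩
  precomp := by
    rintro b₁ b₂ d₁ d₂ d k₁ k₂ h₁' h₂' ⟨c₁, c₂, c, f₁, f₂, g, h₁, h₂, h, rfl, rfl⟩
    exact ⟨c₁, c₂, c, f₁, f₂, g, h₁' ≫ h₁, h₂' ≫ h₂, h, by simp, by simp⟩

theorem OrthogonalityRelation.isOrthogonal_pushforward {C : Type u} [Category.{v} C]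
    {D : Type u} [Category.{v} D] (P : OrthogonalityRelation C) (F : C ⥤ D) :
    IsOrthogonal P (P.pushforward F) F := by
  intro c₁ c₂ c f₁ f₂ h
  exact ⟨c₁, c₂, c, f₁, f₂, 𝟙 _, 𝟙 _, 𝟙 _, h, by simp, by simp⟩

/-! ### Coloured operads in sets

Operations are indexed by finite sets of inputs: a profile is a map `c : ι → 𝔠` from a finite set
of inputs to the colours, and the symmetric group actions are the actions of bijections between
input sets. A profile `(c₁, …, cₙ)` is the case `ι = Fin n`, where the bijections `Fin n ≃ Fin n`
act by right permutations, and concatenation of profiles is the disjoint union of input sets. -/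

/-- A `𝔠`-coloured (symmetric) operad with values in sets. -/
structure ColoredOperad (𝔠 : Type u) where
  /-- The set of operations with inputs of colours `c i` and output of colour `t`. -/
  Op : ∀ {ι : Type} [Finite ι], (ι → 𝔠) → 𝔠 → Type w
  /-- The right action of a bijection of the inputs. -/
  map : ∀ {ι κ : Type} [Finite ι] [Finite κ] (e : κ ≃ ι) {c : ι → 𝔠} {t : 𝔠},
    Op c t → Op (fun k => c (e k)) t
  /-- The identity operation. -/
  unit : ∀ t : 𝔠, Op (fun _ : Unit => t) t
  /-- The composition `γ(o; (p i)ᵢ)`. -/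
  comp : ∀ {ι : Type} [Finite ι] {κ : ι → Type} [∀ i, Finite (κ i)] {c : ι → 𝔠} {t : 𝔠}
    {b : ∀ i, κ i → 𝔠}, Op c t → (∀ i, Op (b i) (c i)) → Op (fun x : Σ i, κ i => b x.1 x.2) t
  map_refl : ∀ {ι : Type} [Finite ι] {c : ι → 𝔠} {t : 𝔠} (o : Op c t), map (Equiv.refl ι) o = o
  map_trans : ∀ {ι κ μ : Type} [Finite ι] [Finite κ] [Finite μ] (e' : μ ≃ κ) (e : κ ≃ ι)
    {c : ι → 𝔠} {t : 𝔠} (o : Op c t), map (e'.trans e) o = map e' (map e o)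
  /-- Equivariance in the outer operation. -/
  comp_map_left : ∀ {ι ι' : Type} [Finite ι] [Finite ι'] (e : ι' ≃ ι) {κ : ι → Type}
    [∀ i, Finite (κ i)] {c : ι → 𝔠} {t : 𝔠} {b : ∀ i, κ i → 𝔠} (o : Op c t)
    (p : ∀ i, Op (b i) (c i)),
    comp (map e o) (fun j => p (e j)) = map (Equiv.sigmaCongrLeft e) (comp o p)
  /-- Equivariance in the inner operations. -/
  comp_map_right : ∀ {ι : Type} [Finite ι] {κ κ' : ι → Type} [∀ i, Finite (κ i)]
    [∀ i, Finite (κ' i)] (e : ∀ i, κ' i ≃ κ i) {c : ι → 𝔠} {t : 𝔠} {b : ∀ i, κ i → 𝔠}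
    (o : Op c t) (p : ∀ i, Op (b i) (c i)),
    comp o (fun i => map (e i) (p i)) = map (Equiv.sigmaCongrRight e) (comp o p)
  comp_assoc : ∀ {ι : Type} [Finite ι] {κ : ι → Type} [∀ i, Finite (κ i)]
    {μ : ∀ i, κ i → Type} [∀ i j, Finite (μ i j)] {a : ι → 𝔠} {t : 𝔠} {b : ∀ i, κ i → 𝔠}
    {c : ∀ i j, μ i j → 𝔠} (o : Op a t) (p : ∀ i, Op (b i) (a i))
    (q : ∀ i j, Op (c i j) (b i j)),
    comp (κ := fun x : Σ i, κ i => μ x.1 x.2) (comp o p) (fun x => q x.1 x.2) =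
      map (Equiv.sigmaAssoc μ) (comp o (fun i => comp (p i) (q i)))
  unit_comp : ∀ {ι : Type} [Finite ι] {c : ι → 𝔠} {t : 𝔠} (o : Op c t),
    comp (unit t) (fun _ => o) = map (Equiv.uniqueSigma fun _ : Unit => ι) o
  comp_unit : ∀ {ι : Type} [Finite ι] {c : ι → 𝔠} {t : 𝔠} (o : Op c t),
    comp o (fun i => unit (c i)) = map (Equiv.sigmaPUnit ι) o

/-- A morphism `(f, φ) : (𝔠, O) → (𝔡, P)` of coloured operads with varying colours. -/
structure OperadHom {𝔠 𝔡 : Type u} (O : ColoredOperad.{u, w} 𝔠) (P : ColoredOperad.{u, w} 𝔡) where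
  onColor : 𝔠 → 𝔡
  onOp : ∀ {ι : Type} [Finite ι] {c : ι → 𝔠} {t : 𝔠},
    O.Op c t → P.Op (fun i => onColor (c i)) (onColor t)
  onOp_map : ∀ {ι κ : Type} [Finite ι] [Finite κ] (e : κ ≃ ι) {c : ι → 𝔠} {t : 𝔠} (o : O.Op c t),
    onOp (O.map e o) = P.map e (onOp o)
  onOp_unit : ∀ t : 𝔠, onOp (O.unit t) = P.unit (onColor t)
  onOp_comp : ∀ {ι : Type} [Finite ι] {κ : ι → Type} [∀ i, Finite (κ i)] {c : ι → 𝔠} {t : 𝔠}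
    {b : ∀ i, κ i → 𝔠} (o : O.Op c t) (p : ∀ i, O.Op (b i) (c i)),
    onOp (O.comp o p) = P.comp (onOp o) (fun i => onOp (p i))

/-! ### Orderings of finite sets -/

/-- A linear ordering of a finite set, as the list of its elements. For `ι = Fin n` these are the
elements of the symmetric group: a permutation `σ` is the list `σ⁻¹(1), …, σ⁻¹(n)`. -/
@[ext]
structure Arrangement (ι : Type) where
  list : List ι
  nodup : list.Nodup
  complete : ∀ i, i ∈ list

namespace Arrangement

/-- Transport along a bijection. -/
def map {ι κ : Type} (e : κ ≃ ι) (l : Arrangement κ) : Arrangement ι where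
  list := l.list.map e
  nodup := l.nodup.map e.injective
  complete i := List.mem_map.2 ⟨e.symm i, l.complete _, e.apply_symm_apply i⟩

/-- The only ordering of a one-element set. -/
def unit : Arrangement Unit where
  list := [()]
  nodup := List.nodup_singleton _
  complete _ := List.mem_singleton.2 rfl

/-- The lexicographic ordering of a disjoint union. For `ι = Fin m`, `κ i = Fin (k i)` this is the
composite `σ(σ₁, …, σₘ)` of a block permutation and a block sum permutation. -/
def sigma {ι : Type} {κ : ι → Type} (l : Arrangement ι) (ls : ∀ i, Arrangement (κ i)) :
    Arrangement (Σ i, κ i) where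
  list := l.list.flatMap fun i => (ls i).list.map (Sigma.mk i)
  nodup := by
    rw [List.nodup_flatMap]
    refine ⟨fun i _ => (ls i).nodup.map sigma_mk_injective, l.nodup.imp ?_⟩
    intro i j hij x hx hy
    obtain ⟨a, _, rfl⟩ := List.mem_map.1 hx
    obtain ⟨b, _, hb⟩ := List.mem_map.1 hy
    exact hij (congrArg Sigma.fst hb).symm
  complete x := List.mem_flatMap.2
    ⟨x.1, l.complete _, List.mem_map.2 ⟨x.2, (ls x.1).complete _, rfl⟩⟩

end Arrangement

/-! ### The coloured operad of an orthogonal category -/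

section Operad

variable {C : Type u} [Category.{v} C]

/-- The operations of the auxiliary operad `O_C` which ignores orthogonality: orderings of the
inputs together with a morphism `c i ⟶ t` for every input. -/
abbrev PreOp {ι : Type} (c : ι → C) (t : C) : Type v :=
  Arrangement ι × (∀ i, c i ⟶ t)

/-- `l'` arises from `l` by transposing two adjacent entries `i`, `j` with `f i ⊥ f j`. -/
def AdjSwap (P : OrthogonalityRelation C) {ι : Type} {c : ι → C} {t : C} (f : ∀ i, c i ⟶ t)
    (l l' : List ι) : Prop :=
  ∃ (x y : List ι) (i j : ι), l = x ++ i :: j :: y ∧ l' = x ++ j :: i :: y ∧ P.perp (f i) (f j)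

/-- `l'` arises from `l` by a finite sequence of transpositions of adjacent orthogonal pairs. -/
abbrev Swaps (P : OrthogonalityRelation C) {ι : Type} {c : ι → C} {t : C} (f : ∀ i, c i ⟶ t) :
    List ι → List ι → Prop :=
  Relation.ReflTransGen (AdjSwap P f)

section Swaps

variable {P : OrthogonalityRelation C} {ι : Type} {c : ι → C} {t : C} {f : ∀ i, c i ⟶ t}

theorem AdjSwap.symm {l l' : List ι} : AdjSwap P f l l' → AdjSwap P f l' l := by
  rintro ⟨x, y, i, j, rfl, rfl, h⟩
  exact ⟨x, y, j, i, rfl, rfl, P.symm h⟩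

theorem Swaps.symm {l l' : List ι} (h : Swaps P f l l') : Swaps P f l' l := by
  induction h with
  | refl => exact .refl
  | tail _ h ih => exact .head h.symm ih

theorem Swaps.append_left (x : List ι) {l l' : List ι} (h : Swaps P f l l') :
    Swaps P f (x ++ l) (x ++ l') := by
  refine Relation.ReflTransGen.lift (fun l => x ++ l) ?_ _ _ h
  rintro _ _ ⟨y, z, i, j, rfl, rfl, h⟩
  exact ⟨x ++ y, z, i, j, by simp, by simp, h⟩

theorem Swaps.append_right (x : List ι) {l l' : List ι} (h : Swaps P f l l') :
    Swaps P f (l ++ x) (l' ++ x) := by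
  refine Relation.ReflTransGen.lift (fun l => l ++ x) ?_ _ _ h
  rintro _ _ ⟨y, z, i, j, rfl, rfl, h⟩
  exact ⟨y, z ++ x, i, j, by simp, by simp, h⟩

theorem Swaps.append {k k' l l' : List ι} (h : Swaps P f k k') (h' : Swaps P f l l') :
    Swaps P f (k ++ l) (k' ++ l') :=
  (h.append_right l).trans (h'.append_left k')

theorem Swaps.cons_block (i : ι) (l : List ι) (h : ∀ j ∈ l, P.perp (f i) (f j)) :
    Swaps P f (i :: l) (l ++ [i]) := by
  induction l with
  | nil => exact .refl
  | cons j l ih =>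
    refine .head (b := j :: i :: l) ⟨[], l, i, j, rfl, rfl, h j (by simp)⟩ ?_
    exact (ih fun k hk => h k (by simp [hk])).append_left [j]

theorem Swaps.block (k l : List ι) (h : ∀ i ∈ k, ∀ j ∈ l, P.perp (f i) (f j)) :
    Swaps P f (k ++ l) (l ++ k) := by
  induction k with
  | nil => simpa using Relation.ReflTransGen.refl
  | cons i k ih =>
    have h1 : Swaps P f (i :: (k ++ l)) (i :: (l ++ k)) :=
      (ih fun i' hi' => h i' (by simp [hi'])).append_left [i]
    have h2 := (Swaps.cons_block i l (h i (by simp))).append_right k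
    simpa using h1.trans h2

/-- A map of index sets which preserves orthogonality maps swaps to swaps. -/
theorem Swaps.map {κ : Type} {d : κ → C} {s : C} {g : ∀ k, d k ⟶ s} (φ : ι → κ)
    (hφ : ∀ i j, P.perp (f i) (f j) → P.perp (g (φ i)) (g (φ j))) {l l' : List ι}
    (h : Swaps P f l l') : Swaps P g (l.map φ) (l'.map φ) := by
  refine Relation.ReflTransGen.lift (List.map φ) ?_ _ _ h
  rintro _ _ ⟨x, y, i, j, rfl, rfl, h⟩
  exact ⟨x.map φ, y.map φ, φ i, φ j, by simp, by simp, hφ i j h⟩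

end Swaps

/-- The equivalence relation `∼_⊥`: equal families of morphisms, and orderings related by
transpositions of adjacent orthogonal pairs. -/
def perpSetoid (P : OrthogonalityRelation C) {ι : Type} (c : ι → C) (t : C) :
    Setoid (PreOp c t) where
  r x y := x.2 = y.2 ∧ Swaps P x.2 x.1.list y.1.list
  iseqv :=
    { refl := fun _ => ⟨rfl, .refl⟩
      symm := by
        rintro ⟨l, f⟩ ⟨l', f'⟩ ⟨h, h'⟩
        obtain rfl : f = f' := h
        exact ⟨rfl, h'.symm⟩
      trans := by
        rintro ⟨l, f⟩ ⟨l', f'⟩ ⟨l'', f''⟩ ⟨h, h'⟩ ⟨k, k'⟩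
        obtain rfl : f = f' := h
        obtain rfl : f = f'' := k
        exact ⟨rfl, h'.trans k'⟩ }

namespace PreOp

/-- The right action of bijections of the inputs. -/
def map {ι κ : Type} (e : κ ≃ ι) {c : ι → C} {t : C} (o : PreOp c t) :
    PreOp (fun k => c (e k)) t :=
  (o.1.map e.symm, fun k => o.2 (e k))

/-- The identity operation. -/
def unit (t : C) : PreOp (fun _ : Unit => t) t :=
  (Arrangement.unit, fun _ => 𝟙 t)

/-- The composition of operations. -/
def comp {ι : Type} {κ : ι → Type} {c : ι → C} {t : C} {b : ∀ i, κ i → C} (o : PreOp c t)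
    (p : ∀ i, PreOp (b i) (c i)) : PreOp (fun x : Σ i, κ i => b x.1 x.2) t :=
  (o.1.sigma fun i => (p i).1, fun x => (p x.1).2 x.2 ≫ o.2 x.1)

theorem map_rel (P : OrthogonalityRelation C) {ι κ : Type} (e : κ ≃ ι) {c : ι → C} {t : C}
    {o o' : PreOp c t} (h : perpSetoid P c t o o') :
    perpSetoid P (fun k => c (e k)) t (o.map e) (o'.map e) := by
  obtain ⟨l, f⟩ := o
  obtain ⟨l', f'⟩ := o'
  obtain ⟨h, h'⟩ := h
  obtain rfl : f = f' := h
  refine ⟨rfl, ?_⟩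
  refine Swaps.map (P := P) (f := f) (g := fun k => f (e k)) e.symm ?_ h'
  intro i j hij
  have key : ∀ i' j', i' = i → j' = j → P.perp (f i') (f j') := by
    rintro _ _ rfl rfl
    exact hij
  exact key _ _ (e.apply_symm_apply i) (e.apply_symm_apply j)

theorem comp_rel (P : OrthogonalityRelation C) {ι : Type} {κ : ι → Type} {c : ι → C} {t : C}
    {b : ∀ i, κ i → C} {o o' : PreOp c t} {p p' : ∀ i, PreOp (b i) (c i)}
    (ho : perpSetoid P c t o o') (hp : ∀ i, perpSetoid P (b i) (c i) (p i) (p' i)) :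
    perpSetoid P _ t (o.comp p) (o'.comp p') := by
  obtain ⟨l, f⟩ := o
  obtain ⟨l', f'⟩ := o'
  obtain ⟨h, hl⟩ := ho
  obtain rfl : f = f' := h
  have hp2 : (fun i => (p i).2) = fun i => (p' i).2 := funext fun i => (hp i).1
  refine ⟨?_, ?_⟩
  · funext x
    exact congrArg (fun g : ∀ i, ∀ j, b i j ⟶ c i => g x.1 x.2 ≫ f x.1) hp2
  · have h1 : ∀ k : List ι, Swaps P (comp (l, f) p).2
        (k.flatMap fun i => (p i).1.list.map (Sigma.mk i))
        (k.flatMap fun i => (p' i).1.list.map (Sigma.mk i)) := by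
      intro k
      induction k with
      | nil => exact .refl
      | cons i k ih =>
        simp only [List.flatMap_cons]
        refine Swaps.append (Swaps.map (Sigma.mk i) ?_ (hp i).2) ih
        intro j j' hj
        exact P.postcomp (f i) hj
    have h2 : ∀ k k' : List ι, Swaps P f k k' → Swaps P (comp (l, f) p).2
        (k.flatMap fun i => (p' i).1.list.map (Sigma.mk i))
        (k'.flatMap fun i => (p' i).1.list.map (Sigma.mk i)) := by
      intro k k' hk
      induction hk with
      | refl => exact .refl
      | tail _ hs ih =>
        refine ih.trans ?_
        obtain ⟨x, y, i, j, rfl, rfl, hij⟩ := hs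
        simp only [List.flatMap_append, List.flatMap_cons]
        refine Swaps.append_left _ ?_
        rw [← List.append_assoc, ← List.append_assoc]
        refine Swaps.append_right _ (Swaps.block _ _ ?_)
        intro z hz z' hz'
        obtain ⟨z, _, rfl⟩ := List.mem_map.1 hz
        obtain ⟨z', _, rfl⟩ := List.mem_map.1 hz'
        exact P.precomp _ _ hij
    exact (h1 l.list).trans (h2 _ _ hl)

end PreOp

/-- The set of operations `O_{(C,⊥)}(c; t)`: the quotient of `O_C(c; t)` by `∼_⊥`. -/
def QOp (P : OrthogonalityRelation C) {ι : Type} (c : ι → C) (t : C) : Type v :=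
  Quotient (perpSetoid P c t)

namespace QOp

variable {P : OrthogonalityRelation C}

/-- The class `[σ, f]` of an operation. -/
def mk (P : OrthogonalityRelation C) {ι : Type} {c : ι → C} {t : C} (o : PreOp c t) : QOp P c t :=
  Quotient.mk _ o

theorem exists_rep {ι : Type} {c : ι → C} {t : C} (o : QOp P c t) : ∃ o', mk P o' = o :=
  Quotient.exists_rep o

/-- The action of bijections on classes. -/
def map {ι κ : Type} (e : κ ≃ ι) {c : ι → C} {t : C} : QOp P c t → QOp P (fun k => c (e k)) t :=
  Quotient.map' (s₁ := perpSetoid P c t) (s₂ := perpSetoid P _ t) (PreOp.map e)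
    fun _ _ h => PreOp.map_rel P e h

/-- The composition of classes, computed on representatives (see `comp_mk`). -/
noncomputable def comp {ι : Type} {κ : ι → Type} {c : ι → C} {t : C} {b : ∀ i, κ i → C}
    (o : QOp P c t) (p : ∀ i, QOp P (b i) (c i)) : QOp P (fun x : Σ i, κ i => b x.1 x.2) t :=
  mk P (PreOp.comp (Quotient.out o) fun i => Quotient.out (p i))

@[simp]
theorem map_mk {ι κ : Type} (e : κ ≃ ι) {c : ι → C} {t : C} (o : PreOp c t) :
    map e (mk P o) = mk P (o.map e) :=
  rfl

@[simp]
theorem comp_mk {ι : Type} {κ : ι → Type} {c : ι → C} {t : C} {b : ∀ i, κ i → C}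
    (o : PreOp c t) (p : ∀ i, PreOp (b i) (c i)) :
    comp (mk P o) (fun i => mk P (p i)) = mk P (o.comp p) :=
  Quotient.sound (PreOp.comp_rel P (Quotient.mk_out (s := perpSetoid P c t) o)
    fun i => Quotient.mk_out (s := perpSetoid P (b i) (c i)) (p i))

theorem exists_reps {ι : Type} {κ : ι → Type} {c : ι → C} {b : ∀ i, κ i → C}
    (p : ∀ i, QOp P (b i) (c i)) : ∃ p' : ∀ i, PreOp (b i) (c i), p = fun i => mk P (p' i) := by
  choose p' hp' using fun i => exists_rep (p i)
  exact ⟨p', funext fun i => (hp' i).symm⟩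

end QOp

/-- The coloured operad `O_{(C,⊥)}` of an orthogonal category; its colours are the objects. -/
noncomputable def qftOperad (P : OrthogonalityRelation C) : ColoredOperad.{u, v} C where
  Op c t := QOp P c t
  map e _ _ o := QOp.map e o
  unit t := QOp.mk P (PreOp.unit t)
  comp o p := QOp.comp o p
  map_refl o := by
    obtain ⟨o, rfl⟩ := QOp.exists_rep o
    refine congrArg (QOp.mk P) (Prod.ext (Arrangement.ext ?_) rfl)
    simp [PreOp.map, Arrangement.map]
  map_trans e' e _ _ o := by
    obtain ⟨o, rfl⟩ := QOp.exists_rep o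
    refine congrArg (QOp.mk P) (Prod.ext (Arrangement.ext ?_) rfl)
    simp [PreOp.map, Arrangement.map]
  comp_map_left := by
    intro ι ι' _ _ e κ _ c t b o p
    obtain ⟨o, rfl⟩ := QOp.exists_rep o
    obtain ⟨p, rfl⟩ := QOp.exists_reps p
    have h₁ := QOp.comp_mk (P := P) (o.map e) (fun j => p (e j))
    have h₂ := congrArg (QOp.map (Equiv.sigmaCongrLeft e)) (QOp.comp_mk (P := P) o p)
    refine h₁.trans (Eq.trans ?_ h₂.symm)
    refine congrArg (QOp.mk P) (Prod.ext (Arrangement.ext ?_) rfl)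
    refine List.map_injective_iff.2 (Equiv.sigmaCongrLeft e).injective ?_
    have h₃ : ∀ i, List.map (Equiv.sigmaCongrLeft e)
        ((p (e (e.symm i))).1.list.map (Sigma.mk (e.symm i))) =
          (p i).1.list.map (Sigma.mk i) := by
      intro i
      rw [List.map_map]
      exact congrArg (fun i => (p i).1.list.map (Sigma.mk i)) (e.apply_symm_apply i)
    simp only [PreOp.map, PreOp.comp, Arrangement.map, Arrangement.sigma, List.map_flatMap,
      List.flatMap_map, h₃]
    simp [Function.comp_def]
  comp_map_right := by
    intro ι _ κ κ' _ _ e c t b o p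
    obtain ⟨o, rfl⟩ := QOp.exists_rep o
    obtain ⟨p, rfl⟩ := QOp.exists_reps p
    simp only [QOp.map_mk, QOp.comp_mk]
    refine congrArg (QOp.mk P) (Prod.ext (Arrangement.ext ?_) rfl)
    simp only [PreOp.map, PreOp.comp, Arrangement.map, Arrangement.sigma, List.map_flatMap,
      List.map_map]
    rfl
  comp_assoc := by
    intro ι _ κ _ μ _ a t b c o p q
    obtain ⟨o, rfl⟩ := QOp.exists_rep o
    obtain ⟨p, rfl⟩ := QOp.exists_reps p
    choose q' hq' using fun i j => QOp.exists_rep (q i j)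
    obtain rfl : q = fun i j => QOp.mk P (q' i j) := by
      funext i j
      exact (hq' i j).symm
    simp only [QOp.comp_mk]
    refine congrArg (QOp.mk P) (Prod.ext (Arrangement.ext ?_) ?_)
    · simp only [PreOp.map, PreOp.comp, Arrangement.map, Arrangement.sigma, List.map_flatMap,
        List.flatMap_map, List.flatMap_assoc, List.map_map]
      rfl
    · funext x
      exact (Category.assoc _ _ _).symm
  unit_comp := by
    intro ι _ c t o
    obtain ⟨o, rfl⟩ := QOp.exists_rep o
    rw [QOp.comp_mk (P := P) (PreOp.unit t) (fun _ => o), QOp.map_mk]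
    refine congrArg (QOp.mk P) (Prod.ext (Arrangement.ext ?_) ?_)
    · simp [PreOp.map, PreOp.unit, PreOp.comp, Arrangement.map, Arrangement.sigma,
        Arrangement.unit]
    · funext x
      simp only [PreOp.map, PreOp.unit, PreOp.comp, Category.comp_id]
      rfl
  comp_unit := by
    intro ι _ c t o
    obtain ⟨o, rfl⟩ := QOp.exists_rep o
    rw [QOp.comp_mk (P := P) o (fun i => PreOp.unit (c i)), QOp.map_mk]
    refine congrArg (QOp.mk P) (Prod.ext (Arrangement.ext ?_) ?_)
    · simp only [PreOp.map, PreOp.unit, PreOp.comp, Arrangement.map, Arrangement.sigma,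
        Arrangement.unit, List.map_cons, List.map_nil]
      exact List.flatMap_pure_eq_map (fun i => (⟨i, ()⟩ : Σ _ : ι, Unit)) o.1.list
    · funext x
      simp only [PreOp.map, PreOp.unit, PreOp.comp, Category.id_comp]
      rfl

/-- The operad morphism `O_F` induced by an orthogonal functor: `[σ, f] ↦ [σ, F(f)]`. -/
noncomputable def qftOperadMap {D : Type u} [Category.{v} D] {P : OrthogonalityRelation C}
    {Q : OrthogonalityRelation D} (F : C ⥤ D) (hF : IsOrthogonal P Q F) :
    OperadHom (qftOperad P) (qftOperad Q) where
  onColor := F.obj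
  onOp {ι _ c t} := Quotient.map' (s₁ := perpSetoid P c t)
    (s₂ := perpSetoid Q (fun i => F.obj (c i)) (F.obj t))
    (fun o => (o.1, fun i => F.map (o.2 i))) (by
      rintro ⟨l, f⟩ ⟨l', f'⟩ ⟨h, h'⟩
      obtain rfl : f = f' := h
      refine ⟨rfl, Relation.ReflTransGen.mono ?_ _ _ h'⟩
      rintro _ _ ⟨x, y, i, j, rfl, rfl, hij⟩
      exact ⟨x, y, i, j, rfl, rfl, hF _ _ hij⟩)
  onOp_map e _ _ o := by
    obtain ⟨o, rfl⟩ := QOp.exists_rep o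
    rfl
  onOp_unit t := congrArg (QOp.mk Q) (Prod.ext rfl (funext fun _ => F.map_id t))
  onOp_comp := by
    intro ι _ κ _ c t b o p
    obtain ⟨o, rfl⟩ := QOp.exists_rep o
    obtain ⟨p, rfl⟩ := QOp.exists_reps p
    have h := QOp.comp_mk (P := Q) (c := fun i => F.obj (c i)) (b := fun i j => F.obj (b i j))
      (o.1, fun i => F.map (o.2 i)) (fun i => ((p i).1, fun j => F.map ((p i).2 j)))
    refine Eq.trans ?_ h.symm
    change Quotient.map' _ _ (QOp.comp (QOp.mk P o) fun i => QOp.mk P (p i)) = _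
    rw [QOp.comp_mk]
    refine congrArg (QOp.mk Q) (Prod.ext rfl (funext fun x => ?_))
    simp [PreOp.comp]

end Operad

/-! ### Tensor products along lists -/

section Tensor

variable {M : Type u} [Category.{v} M] [MonoidalCategory M]

/-- The tensor product `X i₁ ⊗ (X i₂ ⊗ (⋯ ⊗ 𝟙))` along a list `[i₁, i₂, …]` of indices. -/
def tensorList {ι : Type} (X : ι → M) : List ι → M
  | [] => 𝟙_ M
  | i :: l => X i ⊗ tensorList X l

/-- A family of morphisms induces a morphism of tensor products. -/
def tensorListMap {ι : Type} {X Y : ι → M} (f : ∀ i, X i ⟶ Y i) :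
    ∀ l : List ι, tensorList X l ⟶ tensorList Y l
  | [] => 𝟙 _
  | i :: l => f i ⊗ₘ tensorListMap f l

theorem tensorListMap_id {ι : Type} (X : ι → M) (l : List ι) :
    tensorListMap (fun i => 𝟙 (X i)) l = 𝟙 _ := by
  induction l with
  | nil => rfl
  | cons i l ih => simp [tensorListMap, ih, tensorList]

theorem tensorListMap_comp {ι : Type} {X Y Z : ι → M} (f : ∀ i, X i ⟶ Y i) (g : ∀ i, Y i ⟶ Z i)
    (l : List ι) :
    tensorListMap (fun i => f i ≫ g i) l = tensorListMap f l ≫ tensorListMap g l := by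
  induction l with
  | nil => exact (Category.comp_id _).symm
  | cons i l ih =>
    simp only [tensorListMap, ih]
    exact (tensorHom_comp_tensorHom _ _ _ _).symm

/-- Relabelling of the indices; every component is an identity. -/
def tensorListRelabel {ι κ : Type} (X : ι → M) (e : κ → ι) :
    ∀ l : List κ, tensorList X (l.map e) ⟶ tensorList (fun k => X (e k)) l
  | [] => 𝟙 _
  | k :: l => X (e k) ◁ tensorListRelabel X e l

/-- The canonical morphism from the tensor product along a concatenation. -/
def tensorListSplit {ι : Type} (X : ι → M) :
    ∀ l l' : List ι, tensorList X (l ++ l') ⟶ tensorList X l ⊗ tensorList X l'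
  | [], _ => (λ_ _).inv
  | i :: l, l' => X i ◁ tensorListSplit X l l' ≫ (α_ _ _ _).inv

/-- For lists `ls i` and morphisms `φ i` out of the tensor product of `Y i` along `ls i`, the
morphism from the tensor product along the concatenation of the `ls i`, for `i` in `l`, which
regroups the factors into blocks and applies `φ i` to the block of `i`. -/
def tensorListBlocks {ι : Type} {κ : ι → Type} (Y : ∀ i, κ i → M) (Z : ι → M)
    (ls : ∀ i, List (κ i)) (φ : ∀ i, tensorList (Y i) (ls i) ⟶ Z i) :
    ∀ l : List ι, tensorList (fun x : Σ i, κ i => Y x.1 x.2)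
      (l.flatMap fun i => (ls i).map (Sigma.mk i)) ⟶ tensorList Z l
  | [] => 𝟙 _
  | i :: l => tensorListSplit _ ((ls i).map (Sigma.mk i))
        (l.flatMap fun i => (ls i).map (Sigma.mk i)) ≫
      ((tensorListRelabel (fun x : Σ i, κ i => Y x.1 x.2) (Sigma.mk i) (ls i) ≫ φ i) ⊗ₘ
        tensorListBlocks Y Z ls φ l)

/-- The symmetry exchanging the two adjacent factors `i`, `j`. -/
def tensorListSwap [BraidedCategory M] {ι : Type} (X : ι → M) (i j : ι) (y : List ι) :
    ∀ x : List ι, tensorList X (x ++ i :: j :: y) ⟶ tensorList X (x ++ j :: i :: y)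
  | [] => (α_ _ _ _).inv ≫ (β_ (X i) (X j)).hom ▷ tensorList X y ≫ (α_ _ _ _).hom
  | k :: x => X k ◁ tensorListSwap X i j y x

end Tensor

/-! ### Algebras over coloured operads -/

section Algebra

variable (M : Type u) [Category.{v} M] [MonoidalCategory M] [SymmetricCategory M]

/-- An algebra in the symmetric monoidal category `M` over a set-valued coloured operad `O`, that
is, over its image under the change of base `S ↦ ∐_S 𝟙`: objects `A t` of `M` for all colours `t`
and, for every operation `o`, a structure morphism from the tensor product of the `A (c i)` to
`A t`. As the inputs of `o` form an unordered set, there is one structure morphism for every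
ordering of them; they determine each other by `act_swap`. -/
structure OperadAlgebra {𝔠 : Type v} (O : ColoredOperad.{v, v} 𝔠) where
  obj : 𝔠 → M
  act : ∀ {ι : Type} [Finite ι] {c : ι → 𝔠} {t : 𝔠} (_ : O.Op c t) (l : Arrangement ι),
    tensorList (fun i => obj (c i)) l.list ⟶ obj t
  /-- Equivariance: compatibility with the symmetries of `M`. It suffices to have this for the
  transpositions of adjacent factors, as they generate all permutations. -/
  act_swap : ∀ {ι : Type} [Finite ι] {c : ι → 𝔠} {t : 𝔠} (o : O.Op c t) (x y : List ι) (i j : ι)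
    (h : (x ++ i :: j :: y).Nodup) (h' : ∀ k, k ∈ x ++ i :: j :: y)
    (k : (x ++ j :: i :: y).Nodup) (k' : ∀ k, k ∈ x ++ j :: i :: y),
    tensorListSwap (fun i => obj (c i)) i j y x ≫ act o ⟨_, k, k'⟩ = act o ⟨_, h, h'⟩
  /-- Equivariance: compatibility with the action of bijections on operations. -/
  act_map : ∀ {ι κ : Type} [Finite ι] [Finite κ] (e : κ ≃ ι) {c : ι → 𝔠} {t : 𝔠} (o : O.Op c t)
    (l : Arrangement κ),
    tensorListRelabel (fun i => obj (c i)) e l.list ≫ act (O.map e o) l = act o (l.map e)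
  act_unit : ∀ t : 𝔠, act (O.unit t) Arrangement.unit = (ρ_ (obj t)).hom
  act_comp : ∀ {ι : Type} [Finite ι] {κ : ι → Type} [∀ i, Finite (κ i)] {c : ι → 𝔠} {t : 𝔠}
    {b : ∀ i, κ i → 𝔠} (o : O.Op c t) (p : ∀ i, O.Op (b i) (c i)) (l : Arrangement ι)
    (ls : ∀ i, Arrangement (κ i)),
    act (O.comp o p) (l.sigma ls) =
      tensorListBlocks (fun i j => obj (b i j)) (fun i => obj (c i)) (fun i => (ls i).list)
        (fun i => act (p i) (ls i)) l.list ≫ act o l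

variable {M}

namespace OperadAlgebra

/-- A morphism of algebras: a family of morphisms compatible with the structure morphisms. -/
@[ext]
structure Hom {𝔠 : Type v} {O : ColoredOperad.{v, v} 𝔠} (A B : OperadAlgebra M O) where
  app : ∀ t : 𝔠, A.obj t ⟶ B.obj t
  act_app : ∀ {ι : Type} [Finite ι] {c : ι → 𝔠} {t : 𝔠} (o : O.Op c t) (l : Arrangement ι),
    A.act o l ≫ app t = tensorListMap (fun i => app (c i)) l.list ≫ B.act o l

instance {𝔠 : Type v} (O : ColoredOperad.{v, v} 𝔠) : Category (OperadAlgebra M O) where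
  Hom A B := Hom A B
  id A := ⟨fun _ => 𝟙 _, fun o l => by simp [tensorListMap_id]⟩
  comp f g := ⟨fun t => f.app t ≫ g.app t, fun o l => by
    rw [tensorListMap_comp, Category.assoc, ← g.act_app, ← Category.assoc, f.act_app,
      Category.assoc]⟩
  id_comp f := Hom.ext (funext fun t => Category.id_comp (f.app t))
  comp_id f := Hom.ext (funext fun t => Category.comp_id (f.app t))
  assoc f g h := Hom.ext (funext fun t => Category.assoc (f.app t) (g.app t) (h.app t))

/-- The pullback functor `(f, φ)^* : Alg(P) → Alg(O)` of a morphism of coloured operads. -/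
def pullback {𝔠 𝔡 : Type v} {O : ColoredOperad.{v, v} 𝔠} {P : ColoredOperad.{v, v} 𝔡}
    (φ : OperadHom O P) : OperadAlgebra M P ⥤ OperadAlgebra M O where
  obj B :=
    { obj := fun t => B.obj (φ.onColor t)
      act := fun o l => B.act (φ.onOp o) l
      act_swap := fun o x y i j h h' k k' => B.act_swap (φ.onOp o) x y i j h h' k k'
      act_map := fun e _ _ o l => by
        rw [φ.onOp_map]
        exact B.act_map e (φ.onOp o) l
      act_unit := fun t => by
        rw [φ.onOp_unit]
        exact B.act_unit (φ.onColor t)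
      act_comp := fun o p l ls => by
        rw [φ.onOp_comp]
        exact B.act_comp (φ.onOp o) (fun i => φ.onOp (p i)) l ls }
  map f := ⟨fun t => f.app (φ.onColor t), fun o l => f.act_app (φ.onOp o) l⟩
  map_id _ := rfl
  map_comp _ _ := rfl

end OperadAlgebra

/-- The functor `O_F^*` between categories of algebras over the operads of orthogonal categories,
induced by an orthogonal functor `F`. -/
noncomputable def qftPullback {C : Type v} [SmallCategory C] {D : Type v} [SmallCategory D]
    {P : OrthogonalityRelation C} {Q : OrthogonalityRelation D} (F : C ⥤ D)
    (hF : IsOrthogonal P Q F) :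
    OperadAlgebra M (qftOperad Q) ⥤ OperadAlgebra M (qftOperad P) :=
  OperadAlgebra.pullback (qftOperadMap F hF)

end Algebra

end AQFT

-- An algebra over the operad of `(C, ⊥)` is the same thing as a functor from `C` to monoid objects
-- of `M` which sends orthogonal pairs to commuting pairs of morphisms, and `O_L^*` is then
-- precomposition with `L`. The binary, nullary and unary operations give multiplications, units and
-- functoriality (`toMon`). Every other operation is an iterated composite of these, so its
-- structure morphism is an ordered product (`preAct_eq_prodList`, `act_eq`), and a morphism of
-- algebras is a natural family of monoid morphisms (`homOfNatural`). Conversely, `algebraOfMon`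
-- builds an algebra from such a functor. Orderings of inputs are compared by coherence: a composite
-- of adjacent transpositions of tensor factors with distinct labels depends only on its source and
-- target lists (`IsPermHom.unique`).
--
-- Full faithfulness. Precomposition with a localization is fully faithful on functors to `M`. The
-- transformation of `M`-valued functors obtained this way consists of monoid morphisms, because `L`
-- is essentially surjective and isomorphisms of the base act by monoid morphisms.
--
-- Left adjoint. For an algebra `A` and an object `d`, let `B d` be the monoid object generated by
-- one copy of `A c` for every `g : L c ⟶ d`, with the relations that these copies map in by monoid
-- morphisms, naturally in `(c, g)`, and that copies indexed by orthogonal morphisms commute. Its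
-- universal property makes `B` a functor, commutation can be tested on generators, and the
-- resulting algebra is initial among the algebras `E` with a morphism `A ⟶ O_L^* E`. Presented
-- monoid objects exist because the tensor product of a closed category preserves colimits in each
-- variable: the free monoid is the coproduct of tensor powers, and quotients are coequalizers of
-- two-sided ideal multiples (`exists_presentation`).
--
-- The counit is then invertible, as for every adjunction with fully faithful right adjoint.

attribute [reducible] AQFT.tensorList

namespace AQFT

/-! ### Permutations of tensor factors -/

section Permutations

variable {M : Type u} [Category.{v} M] [MonoidalCategory M] [SymmetricCategory M]

/-- The symmetry of the first two factors of a triple tensor product. -/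
def swapFront (A B Z : M) : A ⊗ B ⊗ Z ⟶ B ⊗ A ⊗ Z :=
  (α_ _ _ _).inv ≫ (β_ A B).hom ▷ Z ≫ (α_ _ _ _).hom

@[simp]
theorem swapFront_swapFront (A B Z : M) : swapFront A B Z ≫ swapFront B A Z = 𝟙 _ := by
  simp [swapFront, ← comp_whiskerRight_assoc]

theorem swapFront_naturality {A A' B B' Z Z' : M} (f : A ⟶ A') (g : B ⟶ B') (h : Z ⟶ Z') :
    (f ⊗ₘ (g ⊗ₘ h)) ≫ swapFront A' B' Z' = swapFront A B Z ≫ (g ⊗ₘ (f ⊗ₘ h)) := by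
  simp only [swapFront, Category.assoc, associator_inv_naturality_assoc,
    ← associator_naturality]
  simp only [← tensorHom_id, tensorHom_comp_tensorHom_assoc, BraidedCategory.braiding_naturality,
    Category.comp_id, Category.id_comp]

theorem swapFront_naturality_right {A B Z Z' : M} (h : Z ⟶ Z') :
    A ◁ B ◁ h ≫ swapFront A B Z' = swapFront A B Z ≫ B ◁ A ◁ h := by
  simpa using swapFront_naturality (𝟙 A) (𝟙 B) h

theorem swapFront_tensor_right (A B B' Z : M) :
    swapFront A (B ⊗ B') Z = A ◁ (α_ B B' Z).hom ≫ swapFront A B (B' ⊗ Z) ≫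
      B ◁ swapFront A B' Z ≫ (α_ B B' (A ⊗ Z)).inv := by
  simp only [swapFront, BraidedCategory.braiding_tensor_right_hom]
  monoidal

theorem swapFront_tensor_left (A A' B Z : M) :
    swapFront (A ⊗ A') B Z = (α_ A A' (B ⊗ Z)).hom ≫ A ◁ swapFront A' B Z ≫
      swapFront A B (A' ⊗ Z) ≫ B ◁ (α_ A A' Z).inv := by
  simp only [swapFront, BraidedCategory.braiding_tensor_left_hom]
  monoidal

/-- Naturality slides the braiding of `B` and `C` past `A`; the hexagon identity then splits the
passage of `A` across a product into two swaps. -/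
theorem swapFront_yangBaxter (A B C Z : M) :
    swapFront A B (C ⊗ Z) ≫ B ◁ swapFront A C Z ≫ swapFront B C (A ⊗ Z) =
      A ◁ swapFront B C Z ≫ swapFront A C (B ⊗ Z) ≫ C ◁ swapFront A B Z := by
  have h' : A ◁ (β_ B C).hom ▷ Z ≫ swapFront A (C ⊗ B) Z =
      swapFront A (B ⊗ C) Z ≫ (β_ B C).hom ▷ (A ⊗ Z) := by
    simpa using swapFront_naturality (𝟙 A) (β_ B C).hom (𝟙 Z)
  rw [swapFront_tensor_right, swapFront_tensor_right] at h'
  simp only [swapFront] at h' ⊢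
  simp only [MonoidalCategory.whiskerLeft_comp, Category.assoc] at h' ⊢
  rw [← cancel_epi (A ◁ (α_ B C Z).hom)]
  rw [← cancel_mono (α_ C B (A ⊗ Z)).hom] at h'
  simp at h' ⊢
  exact h'.symm

variable {ι : Type} (X : ι → M)

/-- Transpositions of two adjacent factors of `tensorList X σ`. -/
inductive IsSwap : ∀ {σ τ : List ι}, (tensorList X σ ⟶ tensorList X τ) → Prop
  | head (i j : ι) (y : List ι) :
      IsSwap (σ := i :: j :: y) (τ := j :: i :: y) (swapFront (X i) (X j) (tensorList X y))
  | cons (k : ι) {σ τ : List ι} {s : tensorList X σ ⟶ tensorList X τ} :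
      IsSwap s → IsSwap (σ := k :: σ) (τ := k :: τ) (X k ◁ s)

/-- Morphisms which move one factor `X i` of `tensorList X σ` to the front. -/
inductive IsExtract (i : ι) : ∀ {σ ρ : List ι}, (tensorList X σ ⟶ X i ⊗ tensorList X ρ) → Prop
  | head (y : List ι) : IsExtract i (σ := i :: y) (ρ := y) (𝟙 (X i ⊗ tensorList X y))
  | cons (k : ι) {σ ρ : List ι} {e : tensorList X σ ⟶ X i ⊗ tensorList X ρ} :
      IsExtract i e → IsExtract i (σ := k :: σ) (ρ := k :: ρ)
        (X k ◁ e ≫ swapFront (X k) (X i) (tensorList X ρ))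

/-- Rearrangements of tensor factors obtained by successively extracting factors. -/
inductive IsSortHom : ∀ {σ τ : List ι}, (tensorList X σ ⟶ tensorList X τ) → Prop
  | nil : IsSortHom (σ := []) (τ := []) (𝟙 (𝟙_ M))
  | cons (i : ι) {σ ρ τ : List ι} {e : tensorList X σ ⟶ X i ⊗ tensorList X ρ}
      {f : tensorList X ρ ⟶ tensorList X τ} :
      IsExtract X i e → IsSortHom f → IsSortHom (σ := σ) (τ := i :: τ) (e ≫ X i ◁ f)

/-- Rearrangements of tensor factors obtained as composites of adjacent transpositions. -/
inductive IsPermHom : ∀ {σ τ : List ι}, (tensorList X σ ⟶ tensorList X τ) → Prop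
  | id (σ : List ι) : IsPermHom (𝟙 (tensorList X σ))
  | swap_comp {σ τ ρ : List ι} {s : tensorList X σ ⟶ tensorList X τ}
      {f : tensorList X τ ⟶ tensorList X ρ} : IsSwap X s → IsPermHom f → IsPermHom (s ≫ f)

variable {X}

theorem isSwap_tensorListSwap (i j : ι) (y x : List ι) : IsSwap X (tensorListSwap X i j y x) := by
  induction x with
  | nil => exact .head i j y
  | cons k x ih => exact .cons k ih

/-- If the swap involves the factor `i` that is extracted next, it only changes the position from
which `i` is pulled and is absorbed. Otherwise it slides past the extraction and becomes a swap of
the remaining factors. -/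
theorem IsExtract.swap_comp {i : ι} {σ τ ρ : List ι} {s : tensorList X σ ⟶ tensorList X τ}
    {e : tensorList X τ ⟶ X i ⊗ tensorList X ρ} (hs : IsSwap X s) (he : IsExtract X i e) :
    IsExtract X i (s ≫ e) ∨ ∃ (ρ' : List ι) (e' : tensorList X σ ⟶ X i ⊗ tensorList X ρ')
      (s' : tensorList X ρ' ⟶ tensorList X ρ),
      IsExtract X i e' ∧ IsSwap X s' ∧ s ≫ e = e' ≫ X i ◁ s' := by
  induction hs generalizing ρ with
  | head a b y =>
    cases he with
    | head =>
      left
      have := IsExtract.cons (X := X) a (IsExtract.head (i := i) y)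
      simpa using this
    | cons _ he =>
      cases he with
      | head =>
        left
        have := IsExtract.head (X := X) (i := i) (b :: y)
        simpa using this
      | cons _ he =>
        right
        refine ⟨_, _, _, .cons a (.cons b he), .head a b _, ?_⟩
        simp only [MonoidalCategory.whiskerLeft_comp, Category.assoc]
        -- Both swapped factors stand in front of the extracted one: this is the only case that
        -- needs the braid relation.
        rw [← reassoc_of% @swapFront_naturality_right, swapFront_yangBaxter]
  | cons k hs ih =>
    cases he with
    | head =>
      right
      refine ⟨_, _, _, .head _, hs, ?_⟩
      exact (Category.comp_id _).trans (Category.id_comp _).symm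
    | cons _ he =>
      rcases ih he with h | ⟨ρ', e', s', he', hs', h⟩
      · left
        have := h.cons k
        simpa using this
      · right
        refine ⟨_, _, _, he'.cons k, hs'.cons k, ?_⟩
        rw [← Category.assoc]
        erw [← MonoidalCategory.whiskerLeft_comp]
        rw [h, MonoidalCategory.whiskerLeft_comp, Category.assoc, Category.assoc]
        rw [swapFront_naturality_right]

/-- Selection-sort normal forms absorb a transposition on the left, so by induction every composite
of transpositions is one of them. -/
theorem IsSortHom.swap_comp {σ τ ρ : List ι} {s : tensorList X σ ⟶ tensorList X τ}
    {f : tensorList X τ ⟶ tensorList X ρ} (hs : IsSwap X s) (hf : IsSortHom X f) :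
    IsSortHom X (s ≫ f) := by
  induction hf generalizing σ with
  | nil => cases hs
  | cons i he hf ih =>
    rcases he.swap_comp hs with h | ⟨ρ', e', s', he', hs', h⟩
    · rw [← Category.assoc]
      exact .cons i h hf
    · rw [← Category.assoc, h, Category.assoc]
      erw [← MonoidalCategory.whiskerLeft_comp]
      exact .cons i he' (ih hs')

theorem IsSortHom.id (σ : List ι) : IsSortHom X (𝟙 (tensorList X σ)) := by
  induction σ with
  | nil => exact .nil
  | cons i σ ih =>
    have := IsSortHom.cons i (.head σ) ih
    simpa using this

theorem IsPermHom.isSortHom {σ τ : List ι} {f : tensorList X σ ⟶ tensorList X τ}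
    (hf : IsPermHom X f) : IsSortHom X f := by
  induction hf with
  | id σ => exact .id σ
  | swap_comp hs _ ih => exact ih.swap_comp hs

theorem IsExtract.mem {i : ι} {σ ρ : List ι} {e : tensorList X σ ⟶ X i ⊗ tensorList X ρ}
    (he : IsExtract X i e) : i ∈ σ := by
  induction he with
  | head => simp
  | cons _ _ ih => simp [ih]

theorem IsExtract.subset {i : ι} {σ ρ : List ι} {e : tensorList X σ ⟶ X i ⊗ tensorList X ρ}
    (he : IsExtract X i e) : ρ.Sublist σ := by
  induction he with
  | head => simp
  | cons _ _ ih => exact ih.cons_cons _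

/-- Without repetitions the position of `i` in `σ` is determined, so each step of the extraction is
forced. The equality is heterogeneous because the remaining lists are only shown to agree along the
way. -/
theorem IsExtract.unique {i : ι} {σ ρ ρ' : List ι} {e : tensorList X σ ⟶ X i ⊗ tensorList X ρ}
    {e' : tensorList X σ ⟶ X i ⊗ tensorList X ρ'} (hσ : σ.Nodup) (he : IsExtract X i e)
    (he' : IsExtract X i e') : ρ = ρ' ∧ e ≍ e' := by
  induction he generalizing ρ' with
  | head y =>
    cases he' with
    | head => exact ⟨rfl, HEq.rfl⟩
    | cons _ h => exact absurd h.mem (List.nodup_cons.1 hσ).1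
  | cons k h ih =>
    cases he' with
    | head => exact absurd h.mem (List.nodup_cons.1 hσ).1
    | cons _ h' =>
      obtain ⟨rfl, h2⟩ := ih (List.nodup_cons.1 hσ).2 h'
      obtain rfl := eq_of_heq h2
      exact ⟨rfl, HEq.rfl⟩

/-- The target list dictates which factor is extracted at each stage. -/
theorem IsSortHom.unique {σ τ : List ι} {f g : tensorList X σ ⟶ tensorList X τ} (hσ : σ.Nodup)
    (hf : IsSortHom X f) (hg : IsSortHom X g) : f = g := by
  induction hf with
  | nil => cases hg; rfl
  | cons i he hf ih =>
    cases hg with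
    | cons _ he' hg =>
      obtain ⟨rfl, h⟩ := he.unique hσ he'
      obtain rfl := eq_of_heq h
      rw [ih (hσ.sublist he.subset) hg]

/-- Symmetric coherence for labelled factors. Distinctness of the labels matters: the symmetry of `X
i ⊗ X i` need not be the identity. -/
theorem IsPermHom.unique {σ τ : List ι} {f g : tensorList X σ ⟶ tensorList X τ} (hσ : σ.Nodup)
    (hf : IsPermHom X f) (hg : IsPermHom X g) : f = g :=
  hf.isSortHom.unique hσ hg.isSortHom

theorem IsPermHom.comp {σ τ ρ : List ι} {f : tensorList X σ ⟶ tensorList X τ}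
    {g : tensorList X τ ⟶ tensorList X ρ} (hf : IsPermHom X f) (hg : IsPermHom X g) :
    IsPermHom X (f ≫ g) := by
  induction hf with
  | id => simpa using hg
  | swap_comp hs _ ih =>
    rw [Category.assoc]
    exact .swap_comp hs (ih hg)

theorem IsSwap.isPermHom {σ τ : List ι} {s : tensorList X σ ⟶ tensorList X τ} (hs : IsSwap X s) :
    IsPermHom X s := by
  simpa using IsPermHom.swap_comp hs (.id τ)

theorem IsPermHom.cons (k : ι) {σ τ : List ι} {f : tensorList X σ ⟶ tensorList X τ}
    (hf : IsPermHom X f) : IsPermHom X (σ := k :: σ) (τ := k :: τ) (X k ◁ f) := by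
  induction hf with
  | id σ =>
    rw [MonoidalCategory.whiskerLeft_id]
    exact .id (k :: σ)
  | swap_comp hs _ ih =>
    rw [MonoidalCategory.whiskerLeft_comp]
    exact .swap_comp (hs.cons k) ih

theorem exists_isPermHom (X : ι → M) {σ τ : List ι} (h : σ.Perm τ) :
    ∃ f : tensorList X σ ⟶ tensorList X τ, IsPermHom X f := by
  induction h with
  | nil => exact ⟨_, .id _⟩
  | cons k _ ih =>
    obtain ⟨f, hf⟩ := ih
    exact ⟨_, hf.cons k⟩
  | swap i j l => exact ⟨_, (IsSwap.head j i l).isPermHom⟩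
  | trans _ _ ih ih' =>
    obtain ⟨f, hf⟩ := ih
    obtain ⟨g, hg⟩ := ih'
    exact ⟨_, hf.comp hg⟩

/-- The canonical rearrangement of tensor factors. -/
noncomputable def permHom (X : ι → M) {σ τ : List ι} (h : σ.Perm τ) :
    tensorList X σ ⟶ tensorList X τ :=
  (exists_isPermHom X h).choose

theorem isPermHom_permHom (X : ι → M) {σ τ : List ι} (h : σ.Perm τ) :
    IsPermHom X (permHom X h) :=
  (exists_isPermHom X h).choose_spec

theorem IsPermHom.eq_permHom {σ τ : List ι} {f : tensorList X σ ⟶ tensorList X τ} (hσ : σ.Nodup)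
    (hf : IsPermHom X f) (h : σ.Perm τ) : f = permHom X h :=
  hf.unique hσ (isPermHom_permHom X h)

/-- It is enough to treat one transposition. Here and in the analogous lemmas below the
rearrangement on the other side is merely asserted to exist, which makes the induction immediate;
uniqueness identifies it with `permHom` afterwards. -/
theorem IsPermHom.naturality {Y : ι → M} (g : ∀ i, X i ⟶ Y i) {σ τ : List ι}
    {f : tensorList X σ ⟶ tensorList X τ} (hf : IsPermHom X f) :
    ∃ f' : tensorList Y σ ⟶ tensorList Y τ, IsPermHom Y f' ∧
      tensorListMap g σ ≫ f' = f ≫ tensorListMap g τ := by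
  have hswap : ∀ {σ τ : List ι} {s : tensorList X σ ⟶ tensorList X τ}, IsSwap X s →
      ∃ s' : tensorList Y σ ⟶ tensorList Y τ, IsSwap Y s' ∧
        tensorListMap g σ ≫ s' = s ≫ tensorListMap g τ := by
    intro σ τ s hs
    induction hs with
    | head i j y => exact ⟨_, .head i j y, swapFront_naturality _ _ _⟩
    | @cons k σ τ s hs ih =>
      obtain ⟨s', hs', h⟩ := ih
      refine ⟨_, hs'.cons k, ?_⟩
      change (g k ⊗ₘ tensorListMap g σ) ≫ _ = _ ≫ (g k ⊗ₘ tensorListMap g τ)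
      rw [← id_tensorHom, ← id_tensorHom]
      erw [tensorHom_comp_tensorHom, tensorHom_comp_tensorHom]
      rw [h, Category.comp_id, Category.id_comp]
  induction hf with
  | id => exact ⟨_, .id _, by simp⟩
  | swap_comp hs _ ih =>
    obtain ⟨s', hs', h⟩ := hswap hs
    obtain ⟨f', hf', h'⟩ := ih
    exact ⟨_, .swap_comp hs' hf', by rw [← Category.assoc, h, Category.assoc, h', Category.assoc]⟩

theorem permHom_naturality {Y : ι → M} (g : ∀ i, X i ⟶ Y i) {σ τ : List ι} (hσ : σ.Nodup)
    (h : σ.Perm τ) :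
    tensorListMap g σ ≫ permHom Y h = permHom X h ≫ tensorListMap g τ := by
  obtain ⟨f', hf', h'⟩ := (isPermHom_permHom X h).naturality g
  rw [← h', hf'.eq_permHom hσ h]

theorem IsPermHom.relabel {κ : Type} (e : κ → ι) {σ τ : List κ}
    {f : tensorList (fun k => X (e k)) σ ⟶ tensorList (fun k => X (e k)) τ}
    (hf : IsPermHom (fun k => X (e k)) f) :
    ∃ f' : tensorList X (σ.map e) ⟶ tensorList X (τ.map e), IsPermHom X f' ∧
      tensorListRelabel X e σ ≫ f = f' ≫ tensorListRelabel X e τ := by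
  have hswap : ∀ {σ τ : List κ}
      {s : tensorList (fun k => X (e k)) σ ⟶ tensorList (fun k => X (e k)) τ},
      IsSwap (fun k => X (e k)) s →
      ∃ s' : tensorList X (σ.map e) ⟶ tensorList X (τ.map e), IsSwap X s' ∧
        tensorListRelabel X e σ ≫ s = s' ≫ tensorListRelabel X e τ := by
    intro σ τ s hs
    induction hs with
    | head i j y => exact ⟨_, .head (e i) (e j) (y.map e), swapFront_naturality_right _⟩
    | @cons k σ τ s hs ih =>
      obtain ⟨s', hs', h⟩ := ih
      refine ⟨_, hs'.cons (e k), ?_⟩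
      change X (e k) ◁ tensorListRelabel X e σ ≫ X (e k) ◁ s =
        X (e k) ◁ s' ≫ X (e k) ◁ tensorListRelabel X e τ
      rw [← MonoidalCategory.whiskerLeft_comp, h, MonoidalCategory.whiskerLeft_comp]
  induction hf with
  | id => exact ⟨_, .id _, by simp⟩
  | swap_comp hs _ ih =>
    obtain ⟨s', hs', h⟩ := hswap hs
    obtain ⟨f', hf', h'⟩ := ih
    exact ⟨_, .swap_comp hs' hf', by rw [← Category.assoc, h, Category.assoc, h', Category.assoc]⟩

end Permutations

end AQFT

namespace AQFT

/-! ### Rearrangements of blocks of tensor factors -/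

section Blocks

variable {M : Type u} [Category.{v} M] [MonoidalCategory M]

variable [SymmetricCategory M] {ι : Type} {X : ι → M}

theorem IsPermHom.split_whiskerRight {σ τ : List ι} (ρ : List ι)
    {f : tensorList X σ ⟶ tensorList X τ} (hf : IsPermHom X f) :
    ∃ f' : tensorList X (σ ++ ρ) ⟶ tensorList X (τ ++ ρ), IsPermHom X f' ∧
      tensorListSplit X σ ρ ≫ f ▷ tensorList X ρ = f' ≫ tensorListSplit X τ ρ := by
  have hswap : ∀ {σ τ : List ι} {s : tensorList X σ ⟶ tensorList X τ}, IsSwap X s →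
      ∃ s' : tensorList X (σ ++ ρ) ⟶ tensorList X (τ ++ ρ), IsSwap X s' ∧
        tensorListSplit X σ ρ ≫ s ▷ tensorList X ρ = s' ≫ tensorListSplit X τ ρ := by
    intro σ τ s hs
    induction hs with
    | head i j y =>
      refine ⟨_, .head i j (y ++ ρ), ?_⟩
      simp only [List.cons_append, tensorListSplit, MonoidalCategory.whiskerLeft_comp,
        Category.assoc]
      rw [← reassoc_of% @swapFront_naturality_right]
      simp only [swapFront, comp_whiskerRight, Category.assoc]
      monoidal
    | @cons k σ τ s hs ih =>
      obtain ⟨s', hs', h⟩ := ih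
      refine ⟨_, hs'.cons k, ?_⟩
      simp only [List.cons_append, tensorListSplit, Category.assoc]
      rw [← MonoidalCategory.whiskerLeft_comp_assoc, ← h]
      simp
  induction hf with
  | id => exact ⟨_, .id _, by simp⟩
  | swap_comp hs _ ih =>
    obtain ⟨s', hs', h⟩ := hswap hs
    obtain ⟨f', hf', h'⟩ := ih
    exact ⟨_, .swap_comp hs' hf', by
      rw [comp_whiskerRight, ← Category.assoc, h, Category.assoc, h', Category.assoc]⟩

theorem IsPermHom.split_whiskerLeft {σ τ : List ι} (ρ : List ι)
    {f : tensorList X σ ⟶ tensorList X τ} (hf : IsPermHom X f) :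
    ∃ f' : tensorList X (ρ ++ σ) ⟶ tensorList X (ρ ++ τ), IsPermHom X f' ∧
      tensorListSplit X ρ σ ≫ tensorList X ρ ◁ f = f' ≫ tensorListSplit X ρ τ := by
  induction ρ with
  | nil => exact ⟨f, hf, by simp [tensorListSplit]⟩
  | cons i ρ ih =>
    obtain ⟨f', hf', h⟩ := ih
    exact ⟨_, hf'.cons i, by
      simp only [List.cons_append, tensorListSplit, Category.assoc]
      rw [← MonoidalCategory.whiskerLeft_comp_assoc, ← h]
      simp⟩

theorem exists_isPermHom_split_swapFront (X : ι → M) (k : ι) (σ ρ : List ι) :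
    ∃ f : tensorList X (k :: (σ ++ ρ)) ⟶ tensorList X (σ ++ k :: ρ), IsPermHom X f ∧
      X k ◁ tensorListSplit X σ ρ ≫ swapFront (X k) (tensorList X σ) (tensorList X ρ) =
        f ≫ tensorListSplit X σ (k :: ρ) := by
  induction σ with
  | nil =>
    refine ⟨_, .id _, ?_⟩
    simp only [tensorListSplit, swapFront, tensorList, braiding_tensorUnit_right]
    monoidal
  | cons j σ ih =>
    obtain ⟨f, hf, h⟩ := ih
    refine ⟨_, .swap_comp (.head k j (σ ++ ρ)) (hf.cons j), ?_⟩
    simp only [tensorListSplit, Category.assoc, ← MonoidalCategory.whiskerLeft_comp_assoc, ← h]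
    simp [swapFront_tensor_right, reassoc_of% @swapFront_naturality_right]

/-- The factors of the block `σ` are carried across the block `τ` one at a time; the hexagon
identity assembles these moves into the symmetry of the two blocks. -/
theorem exists_isPermHom_split_split_swapFront (X : ι → M) (σ τ ρ : List ι) :
    ∃ f : tensorList X (σ ++ (τ ++ ρ)) ⟶ tensorList X (τ ++ (σ ++ ρ)), IsPermHom X f ∧
      tensorListSplit X σ (τ ++ ρ) ≫ tensorList X σ ◁ tensorListSplit X τ ρ ≫
          swapFront (tensorList X σ) (tensorList X τ) (tensorList X ρ) =
        f ≫ tensorListSplit X τ (σ ++ ρ) ≫ tensorList X τ ◁ tensorListSplit X σ ρ := by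
  induction σ with
  | nil =>
    refine ⟨_, .id _, ?_⟩
    simp only [tensorListSplit, swapFront, tensorList, braiding_tensorUnit_left]
    simp only [List.nil_append]
    monoidal
  | cons k σ ih =>
    obtain ⟨f, hf, h⟩ := ih
    obtain ⟨g, hg, h'⟩ := exists_isPermHom_split_swapFront X k τ (σ ++ ρ)
    refine ⟨_, (hf.cons k).comp hg, ?_⟩
    have h1 : X k ◁ f ≫ g ≫ tensorListSplit X τ (k :: (σ ++ ρ)) ≫
        tensorList X τ ◁ X k ◁ tensorListSplit X σ ρ =
        X k ◁ (tensorListSplit X σ (τ ++ ρ) ≫ tensorList X σ ◁ tensorListSplit X τ ρ ≫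
          swapFront (tensorList X σ) (tensorList X τ) (tensorList X ρ)) ≫
          swapFront (X k) (tensorList X τ) (tensorList X σ ⊗ tensorList X ρ) := by
      rw [← reassoc_of% h', ← swapFront_naturality_right, h]
      simp
    simp only [List.cons_append, tensorListSplit, MonoidalCategory.whiskerLeft_comp,
      Category.assoc] at h1 ⊢
    rw [reassoc_of% h1, swapFront_tensor_left]
    simp

section

variable {κ : ι → Type} {Y : ∀ i, κ i → M} {Z : ι → M}

/-- Rearrangements inside the blocks can be carried out before the factors are grouped. With
`tensorListBlocks_comp_permHom`, which does the same for the order of the blocks, this reduces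
operadic composition for arbitrary orderings to the orderings of chosen representatives. -/
theorem tensorListBlocks_permHom {ls ls' : ∀ i, List (κ i)}
    {p : ∀ i, tensorList (Y i) (ls i) ⟶ tensorList (Y i) (ls' i)}
    (hp : ∀ i, IsPermHom (Y i) (p i)) (φ : ∀ i, tensorList (Y i) (ls' i) ⟶ Z i) (l : List ι) :
    ∃ q, IsPermHom (fun x : Σ i, κ i => Y x.1 x.2) q ∧
      tensorListBlocks Y Z ls (fun i => p i ≫ φ i) l = q ≫ tensorListBlocks Y Z ls' φ l := by
  induction l with
  | nil => exact ⟨𝟙 _, .id _, by simp [tensorListBlocks]⟩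
  | cons i l ih =>
    obtain ⟨q, hq, h⟩ := ih
    obtain ⟨r, hr, h'⟩ := IsPermHom.relabel (X := fun x : Σ i, κ i => Y x.1 x.2) (Sigma.mk i) (hp i)
    obtain ⟨q', hq', h₁⟩ := hq.split_whiskerLeft ((ls i).map (Sigma.mk i))
    obtain ⟨r', hr', h₂⟩ := hr.split_whiskerRight (l.flatMap fun i => (ls' i).map (Sigma.mk i))
    refine ⟨_, hq'.comp hr', ?_⟩
    simp only [tensorListBlocks, h, Category.assoc]
    rw [← reassoc_of% h₂, ← reassoc_of% h₁, ← Category.assoc (tensorListRelabel _ _ _), h',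
      Category.assoc, ← tensorHom_comp_tensorHom, tensorHom_def', Category.assoc]

theorem tensorListBlocks_swap (ls : ∀ i, List (κ i)) (φ : ∀ i, tensorList (Y i) (ls i) ⟶ Z i)
    {l l' : List ι} {s : tensorList Z l ⟶ tensorList Z l'} (hs : IsSwap Z s) :
    ∃ q, IsPermHom (fun x : Σ i, κ i => Y x.1 x.2) q ∧
      tensorListBlocks Y Z ls φ l ≫ s = q ≫ tensorListBlocks Y Z ls φ l' := by
  induction hs with
  | head i j y =>
    obtain ⟨q, hq, h⟩ := exists_isPermHom_split_split_swapFront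
      (fun x : Σ i, κ i => Y x.1 x.2) ((ls i).map (Sigma.mk i)) ((ls j).map (Sigma.mk j))
      (y.flatMap fun i => (ls i).map (Sigma.mk i))
    refine ⟨q, hq, ?_⟩
    have key : ∀ {A A' B B' C C' S : M} (f : A ⟶ A') (g : B ⟶ B') (h : C ⟶ C') (t : S ⟶ B ⊗ C),
        (f ⊗ₘ (t ≫ (g ⊗ₘ h))) ≫ swapFront A' B' C' =
          A ◁ t ≫ swapFront A B C ≫ (g ⊗ₘ (f ⊗ₘ h)) := by
      intro A A' B B' C C' S f g h t
      rw [← swapFront_naturality, ← id_tensorHom, tensorHom_comp_tensorHom_assoc,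
        Category.id_comp]
    have key' : ∀ {A A' B B' C C' S : M} (f : A ⟶ A') (g : B ⟶ B') (h : C ⟶ C') (t : S ⟶ A ⊗ C),
        (g ⊗ₘ (t ≫ (f ⊗ₘ h))) = B ◁ t ≫ (g ⊗ₘ (f ⊗ₘ h)) := by
      intro A A' B B' C C' S f g h t
      rw [← id_tensorHom, tensorHom_comp_tensorHom, Category.id_comp]
    simp only [tensorListBlocks, Category.assoc]
    rw [key, key']
    exact (reassoc_of% h) _
  | @cons k l l' s hs ih =>
    obtain ⟨q, hq, h⟩ := ih
    obtain ⟨q', hq', h'⟩ := hq.split_whiskerLeft ((ls k).map (Sigma.mk k))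
    refine ⟨q', hq', ?_⟩
    simp only [tensorListBlocks, Category.assoc]
    rw [← reassoc_of% h', ← id_tensorHom, ← id_tensorHom, tensorHom_comp_tensorHom,
      tensorHom_comp_tensorHom, h]
    simp

theorem tensorListBlocks_comp_permHom (ls : ∀ i, List (κ i))
    (φ : ∀ i, tensorList (Y i) (ls i) ⟶ Z i)
    {l l' : List ι} {f : tensorList Z l ⟶ tensorList Z l'} (hf : IsPermHom Z f) :
    ∃ q, IsPermHom (fun x : Σ i, κ i => Y x.1 x.2) q ∧
      tensorListBlocks Y Z ls φ l ≫ f = q ≫ tensorListBlocks Y Z ls φ l' := by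
  induction hf with
  | id => exact ⟨_, .id _, by simp⟩
  | swap_comp hs _ ih =>
    obtain ⟨q, hq, h⟩ := tensorListBlocks_swap ls φ hs
    obtain ⟨q', hq', h'⟩ := ih
    exact ⟨_, hq.comp hq', by rw [← Category.assoc, h, Category.assoc, h', Category.assoc]⟩

end

end Blocks

/-! ### Ordered products in monoid objects and commuting morphisms -/

section Products

open MonObj

variable {M : Type u} [Category.{v} M] [MonoidalCategory M]

/-- The ordered product of morphisms `x i` to a monoid object. -/
def prodList {I : Type} {X : I → M} {N : M} [MonObj N] (x : ∀ i, X i ⟶ N) :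
    ∀ l : List I, tensorList X l ⟶ N
  | [] => η
  | i :: l => (x i ⊗ₘ prodList x l) ≫ μ

variable {N : M} [MonObj N]

/-- Associativity `(ab)c = a(bc)` for generalized elements of a monoid object. -/
theorem associator_inv_tensorHom_mul {A B C : M} (a : A ⟶ N) (b : B ⟶ N) (c : C ⟶ N) :
    (α_ A B C).inv ≫ ((a ⊗ₘ b) ≫ μ ⊗ₘ c) ≫ μ = (a ⊗ₘ ((b ⊗ₘ c) ≫ μ)) ≫ μ := by
  have h : (a ⊗ₘ ((b ⊗ₘ c) ≫ μ)) ≫ μ = (a ⊗ₘ (b ⊗ₘ c)) ≫ N ◁ μ ≫ μ := by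
    rw [← id_tensorHom, tensorHom_comp_tensorHom_assoc]
    simp
  rw [h, MonObj.mul_assoc_flip, associator_inv_naturality_assoc, ← tensorHom_id,
    tensorHom_comp_tensorHom_assoc]
  simp

theorem tensorListMap_prodList {I : Type} {X Y : I → M} (g : ∀ i, X i ⟶ Y i) (x : ∀ i, Y i ⟶ N)
    (l : List I) : tensorListMap g l ≫ prodList x l = prodList (fun i => g i ≫ x i) l := by
  induction l with
  | nil => exact Category.id_comp _
  | cons i l ih => simp [tensorListMap, prodList, ← ih]

theorem prodList_comp {N' : M} [MonObj N'] (h : N ⟶ N') [IsMonHom h] {I : Type} {X : I → M}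
    (x : ∀ i, X i ⟶ N) (l : List I) : prodList x l ≫ h = prodList (fun i => x i ≫ h) l := by
  induction l with
  | nil => exact IsMonHom.one_hom h
  | cons i l ih => simp [prodList, ← ih]

theorem tensorListRelabel_prodList {I κ : Type} {X : I → M} (e : κ → I) (x : ∀ i, X i ⟶ N)
    (l : List κ) :
    tensorListRelabel X e l ≫ prodList (fun k => x (e k)) l = prodList x (l.map e) := by
  induction l with
  | nil => exact Category.id_comp _
  | cons i l ih =>
    change _ = (x (e i) ⊗ₘ prodList x (l.map e)) ≫ μ
    simp only [tensorListRelabel, prodList, ← ih]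
    rw [← id_tensorHom, tensorHom_comp_tensorHom_assoc, Category.id_comp]

theorem tensorListSplit_prodList {I : Type} {X : I → M} (x : ∀ i, X i ⟶ N) (s t : List I) :
    tensorListSplit X s t ≫ (prodList x s ⊗ₘ prodList x t) ≫ μ = prodList x (s ++ t) := by
  induction s with
  | nil => simp [tensorListSplit, prodList]
  | cons i s ih =>
    change _ = (x i ⊗ₘ prodList x (s ++ t)) ≫ μ
    simp only [tensorListSplit, prodList, Category.assoc, ← ih]
    rw [associator_inv_tensorHom_mul, ← id_tensorHom, tensorHom_comp_tensorHom_assoc]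
    simp

/-- General associativity: the product of the block products is the product along the concatenation.
By `hφ`, each `φ i` becomes the product of its block once it is mapped to `N`. -/
theorem tensorListBlocks_prodList {I : Type} {κ : I → Type} {Y : ∀ i, κ i → M}
    {Z : I → M} (z : ∀ i, Z i ⟶ N) (y : ∀ i j, Y i j ⟶ N) (ls : ∀ i, List (κ i))
    (φ : ∀ i, tensorList (Y i) (ls i) ⟶ Z i) (hφ : ∀ i, φ i ≫ z i = prodList (y i) (ls i))
    (l : List I) :
    tensorListBlocks Y Z ls φ l ≫ prodList z l =
      prodList (fun x : Σ i, κ i => y x.1 x.2)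
        (l.flatMap fun i => (ls i).map (Sigma.mk i)) := by
  induction l with
  | nil => exact Category.id_comp _
  | cons i l ih =>
    refine Eq.trans ?_ (tensorListSplit_prodList _ ((ls i).map (Sigma.mk i))
      (l.flatMap fun i => (ls i).map (Sigma.mk i)))
    rw [← ih, ← tensorListRelabel_prodList (X := fun x : Σ i, κ i => Y x.1 x.2), ← hφ]
    simp [tensorListBlocks, prodList]

/-- Two morphisms to a monoid object commute if their products in both orders agree. -/
def CommuteIn [BraidedCategory M] {X Y : M} (x : X ⟶ N) (y : Y ⟶ N) : Prop :=
  (x ⊗ₘ y) ≫ μ = (β_ X Y).hom ≫ (y ⊗ₘ x) ≫ μ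

theorem CommuteIn.symm [SymmetricCategory M] {X Y : M} {x : X ⟶ N} {y : Y ⟶ N}
    (h : CommuteIn x y) : CommuteIn y x := by
  unfold CommuteIn at h ⊢
  simp [h]

theorem CommuteIn.precomp [BraidedCategory M] {X X' Y Y' : M} {x : X ⟶ N} {y : Y ⟶ N}
    (h : CommuteIn x y) (f : X' ⟶ X) (g : Y' ⟶ Y) : CommuteIn (f ≫ x) (g ≫ y) := by
  unfold CommuteIn at h ⊢
  rw [← tensorHom_comp_tensorHom, ← tensorHom_comp_tensorHom, Category.assoc, h,
    BraidedCategory.braiding_naturality_assoc, Category.assoc]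

theorem CommuteIn.tensorListSwap_prodList [SymmetricCategory M] {I : Type} {X : I → M}
    {x : ∀ i, X i ⟶ N} {i j : I} (h : CommuteIn (x i) (x j)) (b a : List I) :
    tensorListSwap X i j b a ≫ prodList x (a ++ j :: i :: b) =
      prodList x (a ++ i :: j :: b) := by
  induction a with
  | nil =>
    simp only [List.nil_append, tensorListSwap, prodList, Category.assoc]
    rw [← associator_inv_tensorHom_mul, ← associator_inv_tensorHom_mul, h]
    simp only [Iso.hom_inv_id_assoc]
    rw [← tensorHom_id, tensorHom_comp_tensorHom_assoc, Category.id_comp]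
  | cons k a ih =>
    simp only [List.cons_append, tensorListSwap, prodList, ← ih]
    rw [← id_tensorHom, tensorHom_comp_tensorHom_assoc, Category.id_comp]

end Products

end AQFT

/-! ### From functors to monoid objects to algebras -/

namespace AQFT

theorem Arrangement.perm {ι : Type} (l l' : Arrangement ι) : l.list.Perm l'.list :=
  (List.perm_ext_iff_of_nodup l.nodup l'.nodup).2 fun i => by simp [l.complete, l'.complete]

theorem tensorListSwap_permHom {M : Type u} [Category.{v} M] [MonoidalCategory M]
    [SymmetricCategory M] {ι : Type} (X : ι → M) (i j : ι) (y x : List ι) {l : List ι}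
    (hx : (x ++ i :: j :: y).Nodup) (h : (x ++ j :: i :: y).Perm l)
    (h' : (x ++ i :: j :: y).Perm l) :
    tensorListSwap X i j y x ≫ permHom X h = permHom X h' :=
  ((isSwap_tensorListSwap i j y x).isPermHom.comp (isPermHom_permHom X h)).eq_permHom hx h'

theorem permHom_tensorListSwap {M : Type u} [Category.{v} M] [MonoidalCategory M]
    [SymmetricCategory M] {ι : Type} (X : ι → M) (i j : ι) (y x : List ι) {l : List ι}
    (hl : l.Nodup) (h : l.Perm (x ++ i :: j :: y)) (h' : l.Perm (x ++ j :: i :: y)) :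
    permHom X h ≫ tensorListSwap X i j y x = permHom X h' :=
  ((isPermHom_permHom X h).comp (isSwap_tensorListSwap i j y x).isPermHom).eq_permHom hl h'

@[simp]
theorem permHom_refl {M : Type u} [Category.{v} M] [MonoidalCategory M]
    [SymmetricCategory M] {ι : Type} (X : ι → M) {l : List ι}
    (hl : l.Nodup) (h : l.Perm l) : permHom X h = 𝟙 _ :=
  ((IsPermHom.id l).eq_permHom hl h).symm

section

variable {M : Type u} [Category.{v} M] [MonoidalCategory M] [SymmetricCategory M]
  {D : Type v} [SmallCategory D] {Q : OrthogonalityRelation D}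

/-- The structure morphisms of the algebra associated with a functor to monoid objects. -/
noncomputable def monAct (F : D ⥤ Mon M)
    (hF : ∀ ⦃c₁ c₂ c : D⦄ (f₁ : c₁ ⟶ c) (f₂ : c₂ ⟶ c), Q.perp f₁ f₂ →
      CommuteIn (F.map f₁).hom (F.map f₂).hom)
    {ι : Type} {c : ι → D} {t : D} (o : QOp Q c t) (l : Arrangement ι) :
    tensorList (fun i => (F.obj (c i)).X) l.list ⟶ (F.obj t).X :=
  Quotient.lift (s := perpSetoid Q c t) (fun p : PreOp c t =>
    permHom (fun i => (F.obj (c i)).X) (l.perm p.1) ≫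
      prodList (fun i => (F.map (p.2 i)).hom) p.1.list) (by
    rintro ⟨l₁, f⟩ ⟨l₂, f'⟩ ⟨h, h'⟩
    obtain rfl : f = f' := h
    -- The value does not depend on the representative: orthogonal morphisms have commuting images,
    -- so each swap in the chain leaves the product unchanged. The end of the chain is a variable
    -- list, to allow induction along the chain.
    have key : ∀ b : List ι, Swaps Q f l₁.list b → ∀ hb : l.list.Perm b,
        permHom (fun i => (F.obj (c i)).X) (l.perm l₁) ≫
            prodList (fun i => (F.map (f i)).hom) l₁.list =
          permHom (fun i => (F.obj (c i)).X) hb ≫ prodList (fun i => (F.map (f i)).hom) b := by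
      intro b hb
      induction hb with
      | refl => exact fun _ => rfl
      | tail _ hs ih =>
        obtain ⟨x, y, i, j, rfl, rfl, hij⟩ := hs
        intro hb
        have hb' : l.list.Perm (x ++ i :: j :: y) :=
          hb.trans (List.Perm.append_left x (List.Perm.swap i j y))
        rw [ih hb', ← permHom_tensorListSwap _ i j y x l.nodup hb', Category.assoc,
          (hF _ _ hij).tensorListSwap_prodList]
    exact key _ h' (l.perm l₂)) o

theorem monAct_mk (F : D ⥤ Mon M)
    (hF : ∀ ⦃c₁ c₂ c : D⦄ (f₁ : c₁ ⟶ c) (f₂ : c₂ ⟶ c), Q.perp f₁ f₂ →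
      CommuteIn (F.map f₁).hom (F.map f₂).hom) {ι : Type} {c : ι → D} {t : D}
    (o : PreOp c t) (l : Arrangement ι) :
    monAct F hF (QOp.mk Q o) l = permHom (fun i => (F.obj (c i)).X) (l.perm o.1) ≫
      prodList (fun i => (F.map (o.2 i)).hom) o.1.list :=
  rfl

theorem monAct_mk_self (F : D ⥤ Mon M)
    (hF : ∀ ⦃c₁ c₂ c : D⦄ (f₁ : c₁ ⟶ c) (f₂ : c₂ ⟶ c), Q.perp f₁ f₂ →
      CommuteIn (F.map f₁).hom (F.map f₂).hom) {ι : Type} {c : ι → D} {t : D}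
    (l : Arrangement ι) (f : ∀ i, c i ⟶ t) :
    monAct F hF (QOp.mk Q (l, f)) l = prodList (fun i => (F.map (f i)).hom) l.list := by
  rw [monAct_mk, permHom_refl _ l.nodup, Category.id_comp]

/-- A functor to monoid objects which sends orthogonal pairs to commuting pairs defines an algebra
over the operad of the orthogonal category. -/
noncomputable def algebraOfMon (F : D ⥤ Mon M)
    (hF : ∀ ⦃c₁ c₂ c : D⦄ (f₁ : c₁ ⟶ c) (f₂ : c₂ ⟶ c), Q.perp f₁ f₂ →
      CommuteIn (F.map f₁).hom (F.map f₂).hom) :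
    OperadAlgebra M (qftOperad Q) where
  obj d := (F.obj d).X
  act o l := monAct F hF o l
  act_swap := by
    intro ι _ c t o x y i j h h' k k'
    obtain ⟨⟨l, f⟩, rfl⟩ := QOp.exists_rep o
    change tensorListSwap _ i j y x ≫ permHom _ _ ≫ _ = permHom _ _ ≫ _
    rw [← Category.assoc, tensorListSwap_permHom _ _ _ _ _ h]
  act_map := by
    intro ι κ _ _ e c t o l
    obtain ⟨⟨l₀, f⟩, rfl⟩ := QOp.exists_rep o
    -- With the ordering written as a transport along `e`, the operad action merely cancels this
    -- transport.
    obtain ⟨l₁, rfl⟩ : ∃ l₁ : Arrangement κ, l₀ = l₁.map e :=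
      ⟨l₀.map e.symm, by ext1; simp [Arrangement.map]⟩
    have h₁ : (l₁.map e).map e.symm = l₁ := by ext1; simp [Arrangement.map]
    have h : (qftOperad Q).map e (QOp.mk Q (l₁.map e, f)) =
        QOp.mk Q (c := fun k => c (e k)) (l₁, fun k => f (e k)) := by
      change QOp.mk Q ((l₁.map e).map e.symm, fun k => f (e k)) = _
      rw [h₁]
    rw [h]
    change tensorListRelabel _ e l.list ≫ permHom _ _ ≫ prodList _ _ = permHom _ _ ≫ prodList _ _
    obtain ⟨g, hg, hg'⟩ := IsPermHom.relabel (X := fun i => (F.obj (c i)).X) e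
      (isPermHom_permHom (fun k => (F.obj (c (e k))).X) (l.perm l₁))
    rw [reassoc_of% hg', hg.eq_permHom (l.map e).nodup ((l.map e).perm (l₁.map e)),
      tensorListRelabel_prodList e (fun i => (F.map (f i)).hom)]
    rfl
  act_unit t := by
    refine (monAct_mk_self F hF Arrangement.unit fun _ => 𝟙 t).trans ?_
    simp [Arrangement.unit, prodList]
  act_comp := by
    intro ι _ κ _ c t b o p l ls
    obtain ⟨o, rfl⟩ := QOp.exists_rep o
    obtain ⟨p, rfl⟩ := QOp.exists_reps p
    have h : (qftOperad Q).comp (QOp.mk Q o) (fun i => QOp.mk Q (p i)) = QOp.mk Q (o.comp p) :=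
      QOp.comp_mk o p
    rw [h]
    simp only [monAct_mk]
    -- The rearrangements inside the blocks and of the blocks are moved to the front, where
    -- coherence identifies their composite. The remaining product of block products is handled by
    -- associativity, using that each `F.map (o.2 i)` is multiplicative.
    obtain ⟨q, hq, h₁⟩ := tensorListBlocks_permHom (Z := fun i => (F.obj (c i)).X)
      (fun i => isPermHom_permHom (fun j => (F.obj (b i j)).X) ((ls i).perm (p i).1))
      (fun i => prodList (fun j => (F.map ((p i).2 j)).hom) (p i).1.list) l.list
    obtain ⟨q', hq', h₂⟩ := tensorListBlocks_comp_permHom (fun i => (p i).1.list)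
      (fun i => prodList (fun j => (F.map ((p i).2 j)).hom) (p i).1.list)
      (isPermHom_permHom (fun i => (F.obj (c i)).X) (l.perm o.1))
    have h₃ := tensorListBlocks_prodList (fun i => (F.map (o.2 i)).hom)
      (fun i j => (F.map ((p i).2 j ≫ o.2 i)).hom) (fun i => (p i).1.list)
      (fun i => prodList (fun j => (F.map ((p i).2 j)).hom) (p i).1.list)
      (fun i => by rw [prodList_comp]; simp) o.1.list
    rw [h₁, Category.assoc, reassoc_of% h₂, h₃, ← Category.assoc,
      (hq.comp hq').eq_permHom (l.sigma ls).nodup ((l.sigma ls).perm (o.comp p).1)]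
    rfl

end

end AQFT

namespace AQFT

/-! ### The monoid objects underlying an algebra -/

/-- The ordering `true, false` of the booleans. -/
def Arrangement.bool : Arrangement Bool where
  list := [true, false]
  nodup := by simp
  complete i := by cases i <;> simp

/-- The ordering of the empty set. -/
def Arrangement.empty : Arrangement Empty where
  list := []
  nodup := List.nodup_nil
  complete i := i.elim

/-- A family of two types. -/
abbrev BoolFam (α β : Type) (b : Bool) : Type :=
  cond b α β

instance finite_boolFam (α β : Type) [Finite α] [Finite β] (b : Bool) : Finite (BoolFam α β b) := by
  cases b <;> assumption

section

variable {C : Type u} [Category.{v} C]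

/-- The binary multiplication as an operation of the auxiliary operad. -/
def PreOp.mul (t : C) : PreOp (fun _ : Bool => t) t :=
  (Arrangement.bool, fun _ => 𝟙 t)

/-- The nullary multiplication as an operation of the auxiliary operad. -/
def PreOp.one (t : C) : PreOp (fun _ : Empty => t) t :=
  (Arrangement.empty, fun _ => 𝟙 t)

/-- A family of two operations. -/
def PreOp.pair {α β : Type} {t : C} (p : PreOp (fun _ : α => t) t) (q : PreOp (fun _ : β => t) t)
    (b : Bool) : PreOp (fun _ : BoolFam α β b => t) t :=
  match b with
  | true => p
  | false => q

end

theorem prodList_singleton {M : Type u} [Category.{v} M] [MonoidalCategory M] {N : M} [MonObj N]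
    {ι : Type} {X : ι → M} (x : ∀ i, X i ⟶ N) (i : ι) :
    prodList x [i] = (ρ_ (X i)).hom ≫ x i := by
  simp [prodList]

theorem prodList_pair {M : Type u} [Category.{v} M] [MonoidalCategory M] {N : M} [MonObj N]
    {ι : Type} {X : ι → M} (x : ∀ i, X i ⟶ N) (i j : ι) :
    prodList x [i, j] = X i ◁ (ρ_ (X j)).hom ≫ (x i ⊗ₘ x j) ≫ MonObj.mul := by
  simp only [prodList]
  rw [← id_tensorHom, tensorHom_comp_tensorHom_assoc]
  simp

/-- Translates the inductive description of transpositions into the positional form in which the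
equivariance axiom `act_swap` is stated. -/
theorem IsSwap.exists_eq {M : Type u} [Category.{v} M] [MonoidalCategory M] [SymmetricCategory M]
    {ι : Type} {X : ι → M} {σ τ : List ι} {s : tensorList X σ ⟶ tensorList X τ}
    (hs : IsSwap X s) : ∃ (x y : List ι) (i j : ι), σ = x ++ i :: j :: y ∧
      τ = x ++ j :: i :: y ∧ s ≍ tensorListSwap X i j y x := by
  induction hs with
  | head i j y => exact ⟨[], y, i, j, rfl, rfl, HEq.rfl⟩
  | cons k _ ih =>
    obtain ⟨x, y, i, j, rfl, rfl, h⟩ := ih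
    obtain rfl := eq_of_heq h
    exact ⟨k :: x, y, i, j, rfl, rfl, HEq.rfl⟩

/-! Unitality and associativity of a binary operation, from equations between its composites. -/

section

variable {M : Type u} [Category.{v} M] [MonoidalCategory M] {X : M}

/-- Here and in the next two lemmas, `h` is an identity between operadic composites with the block
morphisms computed on explicit lists. The extra unitors come from the unit object that ends every
`tensorList`; removing them is pure coherence. -/
theorem one_mul_of_preAct (e : 𝟙_ M ⟶ X) (m : X ⊗ X ⟶ X) {a a' : X ⊗ 𝟙_ M ⟶ X}
    (ha : a = (ρ_ X).hom) (ha' : a' = (ρ_ X).hom)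
    (h : (λ_ (X ⊗ 𝟙_ M)).inv ≫ ((𝟙 _ ≫ e) ⊗ₘ
      ((X ◁ (λ_ (𝟙_ M)).inv ≫ (α_ _ _ _).inv) ≫ ((X ◁ 𝟙 (𝟙_ M) ≫ a) ▷ (𝟙_ M)) ≫ (ρ_ _).hom)) ≫
        m = X ◁ 𝟙 (𝟙_ M) ≫ a') : e ▷ X ≫ m = (λ_ X).hom := by
  subst ha ha'
  have h' : (ρ_ X).inv ≫ (λ_ (X ⊗ 𝟙_ M)).inv ≫ ((𝟙 _ ≫ e) ⊗ₘ
      ((X ◁ (λ_ (𝟙_ M)).inv ≫ (α_ _ _ _).inv) ≫ ((X ◁ 𝟙 (𝟙_ M) ≫ (ρ_ X).hom) ▷ (𝟙_ M)) ≫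
        (ρ_ _).hom)) ≫ m = (λ_ X).inv ≫ e ▷ X ≫ m := by
    rw [MonoidalCategory.tensorHom_def']
    monoidal
  rw [← cancel_epi (λ_ X).inv, ← h', h]
  simp

theorem mul_one_of_preAct (e : 𝟙_ M ⟶ X) (m : X ⊗ X ⟶ X) {a a' : X ⊗ 𝟙_ M ⟶ X}
    (ha : a = (ρ_ X).hom) (ha' : a' = (ρ_ X).hom)
    (h : (X ◁ (λ_ (𝟙_ M)).inv ≫ (α_ _ _ _).inv) ≫ ((X ◁ 𝟙 (𝟙_ M) ≫ a) ⊗ₘ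
      ((λ_ (𝟙_ M)).inv ≫ ((𝟙 _ ≫ e) ▷ (𝟙_ M)) ≫ (ρ_ _).hom)) ≫ m = X ◁ 𝟙 (𝟙_ M) ≫ a') :
    X ◁ e ≫ m = (ρ_ X).hom := by
  subst ha ha'
  have h' : (X ◁ (λ_ (𝟙_ M)).inv ≫ (α_ _ _ _).inv) ≫ ((X ◁ 𝟙 (𝟙_ M) ≫ (ρ_ X).hom) ⊗ₘ
      ((λ_ (𝟙_ M)).inv ≫ ((𝟙 _ ≫ e) ▷ (𝟙_ M)) ≫ (ρ_ _).hom)) ≫ m = X ◁ e ≫ m := by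
    rw [MonoidalCategory.tensorHom_def]
    monoidal
  rw [← h', h]
  simp

theorem mul_assoc_of_preAct (m : X ⊗ X ⟶ X) {a : X ⊗ 𝟙_ M ⟶ X} {b : X ⊗ X ⊗ 𝟙_ M ⟶ X}
    (ha : a = (ρ_ X).hom) (hb : b = X ◁ (ρ_ X).hom ≫ m)
    (h : (X ◁ (X ◁ (λ_ (X ⊗ 𝟙_ M)).inv ≫ (α_ _ _ _).inv) ≫ (α_ _ _ _).inv) ≫
        ((X ◁ X ◁ 𝟙 (𝟙_ M) ≫ b) ⊗ₘ ((X ◁ (λ_ (𝟙_ M)).inv ≫ (α_ _ _ _).inv) ≫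
          ((X ◁ 𝟙 (𝟙_ M) ≫ a) ▷ (𝟙_ M)) ≫ (ρ_ _).hom)) ≫ m =
      X ◁ X ◁ X ◁ 𝟙 (𝟙_ M) ≫ (X ◁ (λ_ (X ⊗ X ⊗ 𝟙_ M)).inv ≫ (α_ _ _ _).inv) ≫
        ((X ◁ 𝟙 (𝟙_ M) ≫ a) ⊗ₘ
          ((X ◁ (X ◁ (λ_ (𝟙_ M)).inv ≫ (α_ _ _ _).inv) ≫ (α_ _ _ _).inv) ≫
            ((X ◁ X ◁ 𝟙 (𝟙_ M) ≫ b) ▷ (𝟙_ M)) ≫ (ρ_ _).hom)) ≫ m) :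
    m ▷ X ≫ m = (α_ _ _ _).hom ≫ X ◁ m ≫ m := by
  subst ha hb
  have h₁ : (X ◁ (X ◁ (λ_ (X ⊗ 𝟙_ M)).inv ≫ (α_ _ _ _).inv) ≫ (α_ _ _ _).inv) ≫
      ((X ◁ X ◁ 𝟙 (𝟙_ M) ≫ X ◁ (ρ_ X).hom ≫ m) ⊗ₘ ((X ◁ (λ_ (𝟙_ M)).inv ≫ (α_ _ _ _).inv) ≫
        ((X ◁ 𝟙 (𝟙_ M) ≫ (ρ_ X).hom) ▷ (𝟙_ M)) ≫ (ρ_ _).hom)) ≫ m =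
      X ◁ X ◁ (ρ_ X).hom ≫ (α_ _ _ _).inv ≫ m ▷ X ≫ m := by
    rw [MonoidalCategory.tensorHom_def']
    monoidal
  have h₂ : X ◁ X ◁ X ◁ 𝟙 (𝟙_ M) ≫ (X ◁ (λ_ (X ⊗ X ⊗ 𝟙_ M)).inv ≫ (α_ _ _ _).inv) ≫
      ((X ◁ 𝟙 (𝟙_ M) ≫ (ρ_ X).hom) ⊗ₘ
        ((X ◁ (X ◁ (λ_ (𝟙_ M)).inv ≫ (α_ _ _ _).inv) ≫ (α_ _ _ _).inv) ≫
          ((X ◁ X ◁ 𝟙 (𝟙_ M) ≫ X ◁ (ρ_ X).hom ≫ m) ▷ (𝟙_ M)) ≫ (ρ_ _).hom)) ≫ m =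
      X ◁ X ◁ (ρ_ X).hom ≫ X ◁ m ≫ m := by
    rw [MonoidalCategory.tensorHom_def]
    monoidal
  rw [h₁, h₂, cancel_epi] at h
  rw [← h, Iso.hom_inv_id_assoc]

end

namespace OperadAlgebra

variable {M : Type u} [Category.{v} M] [MonoidalCategory M] [SymmetricCategory M]

/-- Iterates the equivariance axiom along a chain of adjacent transpositions. -/
theorem permHom_act {𝔠 : Type v} {O : ColoredOperad.{v, v} 𝔠} (A : OperadAlgebra M O)
    {ι : Type} [Finite ι] {c : ι → 𝔠} {t : 𝔠} (o : O.Op c t) (l l' : Arrangement ι) :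
    permHom (fun i => A.obj (c i)) (l.perm l') ≫ A.act o l' = A.act o l := by
  have key : ∀ {σ τ : List ι} {f : tensorList (fun i => A.obj (c i)) σ ⟶
      tensorList (fun i => A.obj (c i)) τ}, IsPermHom _ f → ∀ (h : σ.Nodup) (h' : ∀ i, i ∈ σ)
      (k : τ.Nodup) (k' : ∀ i, i ∈ τ), f ≫ A.act o ⟨τ, k, k'⟩ = A.act o ⟨σ, h, h'⟩ := by
    intro σ τ f hf
    induction hf with
    | id => exact fun _ _ _ _ => Category.id_comp _
    | swap_comp hs _ ih =>
      intro h h' k k'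
      obtain ⟨x, y, i, j, rfl, rfl, hs⟩ := hs.exists_eq
      obtain rfl := eq_of_heq hs
      have hp : (x ++ i :: j :: y).Perm (x ++ j :: i :: y) :=
        List.Perm.append_left x (List.Perm.swap j i y)
      have h₁ : (x ++ j :: i :: y).Nodup := hp.nodup_iff.1 h
      have h₂ : ∀ k, k ∈ x ++ j :: i :: y := fun k => hp.mem_iff.1 (h' k)
      rw [Category.assoc, ih h₁ h₂ k k', A.act_swap o x y i j h h' h₁ h₂]
  exact key (isPermHom_permHom _ _) l.nodup l.complete l'.nodup l'.complete

variable {C : Type v} [SmallCategory C] {P : OrthogonalityRelation C}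
  (A : OperadAlgebra M (qftOperad P))

/-- The structure morphism of a represented operation, with its own ordering of the inputs. -/
noncomputable def preAct {ι : Type} [Finite ι] {c : ι → C} {t : C} (o : PreOp c t) :
    tensorList (fun i => A.obj (c i)) o.1.list ⟶ A.obj t :=
  A.act (O := qftOperad P) (QOp.mk P o) o.1

theorem preAct_comp {ι : Type} [Finite ι] {κ : ι → Type} [∀ i, Finite (κ i)] {c : ι → C} {t : C}
    {b : ∀ i, κ i → C} (o : PreOp c t) (p : ∀ i, PreOp (b i) (c i)) :
    A.preAct (o.comp p) = tensorListBlocks (fun i j => A.obj (b i j)) (fun i => A.obj (c i))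
      (fun i => (p i).1.list) (fun i => A.preAct (p i)) o.1.list ≫ A.preAct o := by
  refine Eq.trans ?_ (A.act_comp (QOp.mk P o) (fun i => QOp.mk P (p i)) o.1 fun i => (p i).1)
  exact congrArg (fun x => A.act (O := qftOperad P) x (o.comp p).1) (QOp.comp_mk o p).symm

theorem preAct_map {ι κ : Type} [Finite ι] [Finite κ] (e : κ ≃ ι) {c : ι → C} {t : C}
    (l : Arrangement κ) (f : ∀ i, c i ⟶ t) :
    A.preAct (l.map e, f) = tensorListRelabel (fun i => A.obj (c i)) e l.list ≫
      A.preAct (c := fun k => c (e k)) (l, fun k => f (e k)) := by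
  refine (A.act_map e (QOp.mk P (l.map e, f)) l).symm.trans ?_
  have h : (l.map e).map e.symm = l := by ext1; simp [Arrangement.map]
  have h' : (qftOperad P).map e (QOp.mk P (l.map e, f)) =
      QOp.mk P (c := fun k => c (e k)) (l, fun k => f (e k)) := by
    change QOp.mk P ((l.map e).map e.symm, fun k => f (e k)) = _
    rw [h]
  rw [h']
  rfl

theorem preAct_unit (t : C) :
    A.preAct (Arrangement.unit, fun _ : Unit => 𝟙 t) = (ρ_ (A.obj t)).hom :=
  A.act_unit t

theorem preAct_unit_of_eq {t : C} {f : t ⟶ t} (hf : f = 𝟙 t) :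
    A.preAct (Arrangement.unit, fun _ : Unit => f) = (ρ_ (A.obj t)).hom := by
  subst hf
  exact A.preAct_unit t

/-- The multiplication on the values of an algebra. -/
noncomputable def mul (t : C) : A.obj t ⊗ A.obj t ⟶ A.obj t :=
  A.obj t ◁ (ρ_ _).inv ≫ A.preAct (PreOp.mul t)

/-- The unit of the values of an algebra. -/
noncomputable def one (t : C) : 𝟙_ M ⟶ A.obj t :=
  A.preAct (PreOp.one t)

/-- The functoriality of the values of an algebra. -/
noncomputable def mapHom {c t : C} (f : c ⟶ t) : A.obj c ⟶ A.obj t :=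
  (ρ_ _).inv ≫ A.preAct (c := fun _ : Unit => c) (Arrangement.unit, fun _ => f)

theorem preAct_mul (t : C) : A.preAct (PreOp.mul t) = A.obj t ◁ (ρ_ _).hom ≫ A.mul t := by
  have h : ∀ {X Y : M} (a : X ⊗ X ⊗ 𝟙_ M ⟶ Y),
      a = X ◁ (ρ_ X).hom ≫ X ◁ (ρ_ X).inv ≫ a := by
    intro X Y a
    simp
  exact h _

/-- The two-block case of `preAct_comp`, unfolded so far that for concrete operations it computes by
definition to the explicit composites in `one_mul_of_preAct` and its companions. -/
theorem preAct_mul_comp {κ : Bool → Type} [∀ i, Finite (κ i)] {t : C} {b : ∀ i, κ i → C}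
    (p : ∀ i, PreOp (b i) t) :
    A.preAct ((PreOp.mul t).comp p) =
      tensorListSplit (fun x : Σ i, κ i => A.obj (b x.1 x.2)) ((p true).1.list.map (Sigma.mk true))
        ((p false).1.list.map (Sigma.mk false) ++ []) ≫
      ((tensorListRelabel (fun x : Σ i, κ i => A.obj (b x.1 x.2)) (Sigma.mk true) (p true).1.list ≫
          A.preAct (p true)) ⊗ₘ
        (tensorListSplit (fun x : Σ i, κ i => A.obj (b x.1 x.2))
          ((p false).1.list.map (Sigma.mk false)) [] ≫
        ((tensorListRelabel (fun x : Σ i, κ i => A.obj (b x.1 x.2)) (Sigma.mk false)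
            (p false).1.list ≫ A.preAct (p false)) ▷ _) ≫ (ρ_ _).hom)) ≫ A.mul t := by
  rw [preAct_comp, A.preAct_mul]
  change tensorListBlocks _ _ _ _ [true, false] ≫ _ = _
  simp only [tensorListBlocks, Category.assoc]
  rw [← id_tensorHom, tensorHom_comp_tensorHom_assoc]
  rw [Category.comp_id]
  erw [tensorHom_id]
  rw [Category.assoc]
  rfl

/-- In the operad, inserting the nullary operation in the first slot of the binary one gives the
identity operation, up to the bijection `e` of inputs. Both sides are evaluated in `A`. -/
theorem one_mul (t : C) : A.one t ▷ A.obj t ≫ A.mul t = (λ_ (A.obj t)).hom := by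
  have h₁ : _ = (λ_ (A.obj t ⊗ 𝟙_ M)).inv ≫ ((𝟙 _ ≫ A.one t) ⊗ₘ
      ((A.obj t ◁ (λ_ (𝟙_ M)).inv ≫ (α_ _ _ _).inv) ≫
        ((A.obj t ◁ 𝟙 (𝟙_ M) ≫ A.preAct (PreOp.unit t)) ▷ (𝟙_ M)) ≫ (ρ_ _).hom)) ≫ A.mul t :=
    A.preAct_mul_comp (PreOp.pair (PreOp.one t) (PreOp.unit t))
  let e : Unit ≃ Σ b, BoolFam Empty Unit b :=
    { toFun := fun _ => ⟨false, ()⟩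
      invFun := fun _ => ()
      left_inv := fun _ => rfl
      right_inv := by rintro ⟨_ | _, ⟨⟩⟩; rfl }
  have h₂ : A.preAct ((PreOp.mul t).comp (PreOp.pair (PreOp.one t) (PreOp.unit t))) =
      A.obj t ◁ 𝟙 (𝟙_ M) ≫
        A.preAct (c := fun _ : Unit => t) (Arrangement.unit, fun _ => 𝟙 t ≫ 𝟙 t) :=
    A.preAct_map e Arrangement.unit (c := fun _ => t)
      fun x => (PreOp.pair (PreOp.one t) (PreOp.unit t) x.1).2 x.2 ≫ 𝟙 t
  have h₃ := A.preAct_unit_of_eq (Category.comp_id (𝟙 t))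
  exact one_mul_of_preAct _ _ (A.preAct_unit t) h₃ (h₁.symm.trans h₂)

theorem mul_one (t : C) : A.obj t ◁ A.one t ≫ A.mul t = (ρ_ (A.obj t)).hom := by
  have h₁ : _ = (A.obj t ◁ (λ_ (𝟙_ M)).inv ≫ (α_ _ _ _).inv) ≫
      ((A.obj t ◁ 𝟙 (𝟙_ M) ≫ A.preAct (PreOp.unit t)) ⊗ₘ
        ((λ_ (𝟙_ M)).inv ≫ ((𝟙 _ ≫ A.one t) ▷ (𝟙_ M)) ≫ (ρ_ _).hom)) ≫ A.mul t :=
    A.preAct_mul_comp (PreOp.pair (PreOp.unit t) (PreOp.one t))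
  let e : Unit ≃ Σ b, BoolFam Unit Empty b :=
    { toFun := fun _ => ⟨true, ()⟩
      invFun := fun _ => ()
      left_inv := fun _ => rfl
      right_inv := by rintro ⟨_ | _, ⟨⟩⟩; rfl }
  have h₂ : A.preAct ((PreOp.mul t).comp (PreOp.pair (PreOp.unit t) (PreOp.one t))) =
      A.obj t ◁ 𝟙 (𝟙_ M) ≫
        A.preAct (c := fun _ : Unit => t) (Arrangement.unit, fun _ => 𝟙 t ≫ 𝟙 t) :=
    A.preAct_map e Arrangement.unit (c := fun _ => t)
      fun x => (PreOp.pair (PreOp.unit t) (PreOp.one t) x.1).2 x.2 ≫ 𝟙 t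
  have h₃ := A.preAct_unit_of_eq (Category.comp_id (𝟙 t))
  exact mul_one_of_preAct _ _ (A.preAct_unit t) h₃ (h₁.symm.trans h₂)

/-- The two bracketings of the ternary product are the same operation up to relabelling of the three
inputs. -/
theorem mul_assoc (t : C) : A.mul t ▷ A.obj t ≫ A.mul t =
    (α_ _ _ _).hom ≫ A.obj t ◁ A.mul t ≫ A.mul t := by
  have h₁ : _ = (A.obj t ◁ (λ_ (A.obj t ⊗ A.obj t ⊗ 𝟙_ M)).inv ≫ (α_ _ _ _).inv) ≫
      ((A.obj t ◁ 𝟙 (𝟙_ M) ≫ A.preAct (PreOp.unit t)) ⊗ₘ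
        ((A.obj t ◁ (A.obj t ◁ (λ_ (𝟙_ M)).inv ≫ (α_ _ _ _).inv) ≫ (α_ _ _ _).inv) ≫
          ((A.obj t ◁ A.obj t ◁ 𝟙 (𝟙_ M) ≫ A.preAct (PreOp.mul t)) ▷ (𝟙_ M)) ≫ (ρ_ _).hom)) ≫
        A.mul t :=
    A.preAct_mul_comp (PreOp.pair (PreOp.unit t) (PreOp.mul t))
  have h₂ : _ = (A.obj t ◁ (A.obj t ◁ (λ_ (A.obj t ⊗ 𝟙_ M)).inv ≫ (α_ _ _ _).inv) ≫
      (α_ _ _ _).inv) ≫ ((A.obj t ◁ A.obj t ◁ 𝟙 (𝟙_ M) ≫ A.preAct (PreOp.mul t)) ⊗ₘ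
        ((A.obj t ◁ (λ_ (𝟙_ M)).inv ≫ (α_ _ _ _).inv) ≫
          ((A.obj t ◁ 𝟙 (𝟙_ M) ≫ A.preAct (PreOp.unit t)) ▷ (𝟙_ M)) ≫ (ρ_ _).hom)) ≫ A.mul t :=
    A.preAct_mul_comp (PreOp.pair (PreOp.mul t) (PreOp.unit t))
  -- The order-preserving bijection from the inputs bracketed as `1 + 2` to those bracketed as `2 +
  -- 1`.
  let e : (Σ b, BoolFam Unit Bool b) ≃ Σ b, BoolFam Bool Unit b :=
    { toFun := fun x => match x with
        | ⟨true, ()⟩ => ⟨true, true⟩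
        | ⟨false, true⟩ => ⟨true, false⟩
        | ⟨false, false⟩ => ⟨false, ()⟩
      invFun := fun x => match x with
        | ⟨true, true⟩ => ⟨true, ()⟩
        | ⟨true, false⟩ => ⟨false, true⟩
        | ⟨false, ()⟩ => ⟨false, false⟩
      left_inv := by rintro ⟨_ | _, _ | _⟩ <;> rfl
      right_inv := by rintro ⟨_ | _, _ | _⟩ <;> rfl }
  have h₄ : A.preAct ((PreOp.mul t).comp (PreOp.pair (PreOp.mul t) (PreOp.unit t))) =
      A.obj t ◁ A.obj t ◁ A.obj t ◁ 𝟙 (𝟙_ M) ≫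
        A.preAct ((PreOp.mul t).comp (PreOp.pair (PreOp.unit t) (PreOp.mul t))) := by
    refine (A.preAct_map e ((PreOp.mul t).comp (PreOp.pair (PreOp.unit t) (PreOp.mul t))).1
      (c := fun _ => t) fun x =>
        (PreOp.pair (PreOp.mul t) (PreOp.unit t) x.1).2 x.2 ≫ 𝟙 t).trans ?_
    congr 3
    funext x
    obtain ⟨_ | _, _ | _⟩ := x <;> rfl
  exact mul_assoc_of_preAct _ (A.preAct_unit t) (A.preAct_mul t)
    (h₂.symm.trans (h₄.trans (congrArg _ h₁)))

end OperadAlgebra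

end AQFT

/-! ### Algebras as functors to monoid objects -/

namespace AQFT

/-- An ordering of a finite set with first element `i` is obtained from an ordering of the
complement of `i`. -/
theorem Arrangement.exists_cons {ι : Type} (l : Arrangement ι) (i : ι) (l₀ : List ι)
    (h : l.list = i :: l₀) : ∃ (κ : Type) (_ : Finite κ) (l' : Arrangement κ)
      (e : (Σ b, BoolFam Unit κ b) ≃ ι), l'.list.length = l₀.length ∧
      l = (Arrangement.bool.sigma (κ := BoolFam Unit κ) fun b =>
        match b with | true => Arrangement.unit | false => l').map e := by
  have hn : i ∉ l₀ ∧ l₀.Nodup := by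
    have := l.nodup
    rwa [h, List.nodup_cons] at this
  have hc : ∀ j, j = i ∨ j ∈ l₀ := fun j => by
    have := l.complete j
    rwa [h, List.mem_cons] at this
  let l' : Arrangement {k // k ∈ l₀} := ⟨l₀.attach, List.nodup_attach.2 hn.2, List.mem_attach l₀⟩
  let g : (Σ b, BoolFam Unit {k // k ∈ l₀} b) → ι := fun x =>
    match x with
    | ⟨true, _⟩ => i
    | ⟨false, k⟩ => k.1
  have hg : Function.Bijective g := by
    constructor
    · rintro ⟨_ | _, x⟩ ⟨_ | _, y⟩ hxy
      · obtain rfl : x = y := Subtype.ext hxy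
        rfl
      · obtain rfl : x.1 = i := hxy
        exact absurd x.2 hn.1
      · obtain rfl : i = y.1 := hxy
        exact absurd y.2 hn.1
      · rfl
    · intro j
      rcases hc j with rfl | hj
      · exact ⟨⟨true, ()⟩, rfl⟩
      · exact ⟨⟨false, ⟨j, hj⟩⟩, rfl⟩
  refine ⟨{k // k ∈ l₀}, (List.finite_toSet l₀).to_subtype, l', Equiv.ofBijective g hg,
    by simp [l'], ?_⟩
  ext1
  rw [h]
  simp only [Arrangement.map, Arrangement.sigma, Arrangement.bool, Arrangement.unit, l',
    List.flatMap_cons, List.flatMap_nil, List.append_nil, List.map_cons, List.map_nil,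
    List.map_append, List.map_map]
  change i :: l₀ = i :: List.map Subtype.val l₀.attach
  simp

namespace OperadAlgebra

variable {M : Type u} [Category.{v} M] [MonoidalCategory M] [SymmetricCategory M]
  {C : Type v} [SmallCategory C] {P : OrthogonalityRelation C}
  (A : OperadAlgebra M (qftOperad P))

noncomputable instance monObj (t : C) : MonObj (A.obj t) where
  one := A.one t
  mul := A.mul t
  one_mul := A.one_mul t
  mul_one := A.mul_one t
  mul_assoc := A.mul_assoc t

theorem preAct_unit_eq {c t : C} (f : c ⟶ t) :
    A.preAct (c := fun _ : Unit => c) (Arrangement.unit, fun _ => f) =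
      (ρ_ (A.obj c)).hom ≫ A.mapHom f := by
  have h : ∀ {X Y : M} (a : X ⊗ 𝟙_ M ⟶ Y), a = (ρ_ X).hom ≫ (ρ_ X).inv ≫ a := by
    intro X Y a
    simp
  exact h _

/-- The structure morphisms are given by the functoriality and the multiplications. -/
theorem preAct_eq_prodList {ι : Type} [Finite ι] {c : ι → C} {t : C} (l : Arrangement ι)
    (f : ∀ i, c i ⟶ t) : A.preAct (l, f) = prodList (fun i => A.mapHom (f i)) l.list := by
  -- Induction on the number of inputs; the input set varies, since removing the first input gives
  -- an operation on a different set.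
  induction hn : l.list.length generalizing ι with
  | zero =>
    obtain ⟨l, hl, hl'⟩ := l
    obtain rfl : l = [] := List.length_eq_zero_iff.1 hn
    let e : Empty ≃ ι :=
      { toFun := fun x => x.elim
        invFun := fun i => absurd (hl' i) (by simp)
        left_inv := fun x => x.elim
        right_inv := fun i => absurd (hl' i) (by simp) }
    have h : A.preAct (Arrangement.empty.map e, f) = _ := A.preAct_map e Arrangement.empty f
    refine h.trans ((Category.id_comp _).trans ?_)
    -- Families over the empty set agree with those of `PreOp.one` only propositionally, so they are
    -- made variables and substituted.
    have h' : ∀ (c' : Empty → C) (f' : ∀ i, c' i ⟶ t),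
        A.preAct (Arrangement.empty, f') = A.one t := by
      intro c' f'
      obtain rfl : c' = fun _ => t := funext fun x => x.elim
      obtain rfl : f' = fun _ => 𝟙 t := funext fun x => x.elim
      rfl
    exact h' _ _
  | succ n ih =>
    obtain ⟨i, l₀, hl⟩ := List.exists_cons_of_length_eq_add_one hn
    obtain ⟨κ, _, l', e, hl', rfl⟩ := l.exists_cons i l₀ hl
    have hl'' : l'.list.length = n := by
      rw [hl']
      simpa [hl] using hn
    -- The operation is the binary product of two operations into `t`: the first input alone, and
    -- all the others in their given order.
    let b : ∀ i, BoolFam Unit κ i → C := fun i k => c (e ⟨i, k⟩)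
    let ls : ∀ i, Arrangement (BoolFam Unit κ i) := fun b =>
      match b with | true => Arrangement.unit | false => l'
    let p : ∀ i, PreOp (b i) t := fun i => (ls i, fun k => f (e ⟨i, k⟩))
    have h₁ : A.preAct ((Arrangement.bool.sigma ls).map e, f) = _ := A.preAct_map e _ f
    have h₂ : A.preAct (c := fun x => c (e x)) (Arrangement.bool.sigma ls, fun x => f (e x)) =
        A.preAct ((PreOp.mul t).comp p) := by
      have : (fun x => f (e x)) = ((PreOp.mul t).comp p).2 :=
        funext fun x => (Category.comp_id (f (e x))).symm
      rw [this]
      rfl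
    have h₃ : ∀ i, A.preAct (p i) ≫ 𝟙 _ =
        prodList (fun k => A.mapHom (f (e ⟨i, k⟩))) (ls i).list := by
      rintro (_ | _)
      · exact (Category.comp_id _).trans (ih l' _ hl'')
      · refine (Category.comp_id _).trans ((A.preAct_unit_eq (f (e ⟨true, ()⟩))).trans ?_)
        exact (prodList_singleton (X := fun k : Unit => A.obj (c (e ⟨true, k⟩)))
          (fun k => A.mapHom (f (e ⟨true, k⟩))) ()).symm
    -- The binary operation is the product of two identities, the outer product in general
    -- associativity.
    have h₄ : A.preAct (PreOp.mul t) = prodList (fun _ => 𝟙 (A.obj t)) [true, false] := by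
      refine (A.preAct_mul t).trans ?_
      rw [prodList_pair, id_tensorHom_id, Category.id_comp]
      rfl
    refine h₁.trans ?_
    rw [h₂, preAct_comp, h₄]
    refine (congrArg _ (tensorListBlocks_prodList (fun _ => 𝟙 (A.obj t))
      (fun i k => A.mapHom (f (e ⟨i, k⟩))) (fun i => (ls i).list) _ h₃ [true, false])).trans ?_
    exact tensorListRelabel_prodList e (fun i => A.mapHom (f i)) _

/-- Consequently an algebra is determined by its multiplications, units and unary operations. -/
theorem act_eq {ι : Type} [Finite ι] {c : ι → C} {t : C} (l l' : Arrangement ι)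
    (f : ∀ i, c i ⟶ t) : A.act (O := qftOperad P) (QOp.mk P (l', f)) l =
      permHom (fun i => A.obj (c i)) (l.perm l') ≫ prodList (fun i => A.mapHom (f i)) l'.list := by
  rw [← A.preAct_eq_prodList]
  exact (A.permHom_act _ l l').symm

theorem mapHom_id (t : C) : A.mapHom (𝟙 t) = 𝟙 _ := by
  have key : ∀ {X : M} (g : X ⟶ X), (ρ_ X).hom ≫ g = (ρ_ X).hom → g = 𝟙 X := by
    intro X g h
    rwa [← cancel_epi (ρ_ X).hom, Category.comp_id]
  exact key _ ((A.preAct_unit_eq (𝟙 t)).symm.trans (A.preAct_unit t))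

theorem mapHom_comp {c c' t : C} (f : c ⟶ c') (g : c' ⟶ t) :
    A.mapHom (f ≫ g) = A.mapHom f ≫ A.mapHom g := by
  let o : PreOp (fun _ : Unit => c') t := (Arrangement.unit, fun _ => g)
  let p : ∀ _ : Unit, PreOp (fun _ : Unit => c) c' := fun _ => (Arrangement.unit, fun _ => f)
  have h₁ : A.preAct (o.comp p) = prodList (fun _ => A.mapHom (f ≫ g)) [⟨(), ()⟩] :=
    A.preAct_eq_prodList (o.comp p).1 (o.comp p).2
  have h₂ : A.preAct o = prodList (fun _ => A.mapHom g) [()] := A.preAct_eq_prodList _ _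
  have h₃ : ∀ i, A.preAct (p i) ≫ A.mapHom g =
      prodList (fun _ => A.mapHom f ≫ A.mapHom g) [()] := by
    intro i
    refine (congrArg (fun x => x ≫ A.mapHom g) (A.preAct_unit_eq f)).trans ?_
    exact (Category.assoc _ _ _).trans (prodList_singleton (X := fun _ : Unit => A.obj c)
      (fun _ => A.mapHom f ≫ A.mapHom g) ()).symm
  have h₄ := A.preAct_comp o p
  rw [h₁, h₂] at h₄
  have h₅ := h₄.trans (tensorListBlocks_prodList (fun _ => A.mapHom g)
    (fun _ _ => A.mapHom f ≫ A.mapHom g) (fun _ => [()]) _ h₃ [()])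
  have h₆ : (ρ_ (A.obj c)).hom ≫ A.mapHom (f ≫ g) =
      (ρ_ (A.obj c)).hom ≫ A.mapHom f ≫ A.mapHom g :=
    (prodList_singleton (X := fun _ : Σ _ : Unit, Unit => A.obj c) (fun _ => A.mapHom (f ≫ g))
      ⟨(), ()⟩).symm.trans (h₅.trans (prodList_singleton (X := fun _ : Σ _ : Unit, Unit => A.obj c)
        (fun _ => A.mapHom f ≫ A.mapHom g) ⟨(), ()⟩))
  rwa [cancel_epi] at h₆

/-- Composing the unary operation of `f` with the nullary or binary operation at `c` gives an
operation into `t`, which `preAct_eq_prodList` evaluates a second time as a product in `A.obj t`. -/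
instance isMonHom_mapHom {c t : C} (f : c ⟶ t) : IsMonHom (A.mapHom f) := by
  let o : PreOp (fun _ : Unit => c) t := (Arrangement.unit, fun _ => f)
  constructor
  · have h₁ : A.preAct (o.comp fun _ => PreOp.one c) = MonObj.one :=
      A.preAct_eq_prodList (o.comp fun _ => PreOp.one c).1 (o.comp fun _ => PreOp.one c).2
    have h₂ : A.preAct (o.comp fun _ => PreOp.one c) = ((λ_ (𝟙_ M)).inv ≫
        ((𝟙 _ ≫ A.one c) ⊗ₘ 𝟙 (𝟙_ M))) ≫ A.preAct o := A.preAct_comp o fun _ => PreOp.one c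
    have h₃ := A.preAct_unit_eq f
    have key : ∀ {X Y : M} (a : X ⊗ 𝟙_ M ⟶ Y) (g : X ⟶ Y) (e : 𝟙_ M ⟶ X),
        a = (ρ_ X).hom ≫ g → ((λ_ (𝟙_ M)).inv ≫ ((𝟙 _ ≫ e) ⊗ₘ 𝟙 (𝟙_ M))) ≫ a = e ≫ g := by
      intro X Y a g e h
      rw [h, tensorHom_id]
      monoidal
    exact (key _ _ _ h₃).symm.trans (h₂.symm.trans h₁)
  · have h₁ : A.preAct (o.comp fun _ => PreOp.mul c) =
        prodList (fun _ => A.mapHom (𝟙 c ≫ f)) [⟨(), true⟩, ⟨(), false⟩] :=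
      A.preAct_eq_prodList (o.comp fun _ => PreOp.mul c).1 (o.comp fun _ => PreOp.mul c).2
    have h₂ : A.preAct (o.comp fun _ => PreOp.mul c) =
      ((A.obj c ◁ (A.obj c ◁ (λ_ (𝟙_ M)).inv ≫ (α_ _ _ _).inv) ≫ (α_ _ _ _).inv) ≫
        ((A.obj c ◁ A.obj c ◁ 𝟙 (𝟙_ M) ≫ A.preAct (PreOp.mul c)) ⊗ₘ 𝟙 (𝟙_ M))) ≫ A.preAct o :=
      A.preAct_comp o fun _ => PreOp.mul c
    have h₃ := A.preAct_unit_eq f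
    have key : ∀ {X Y : M} (a : X ⊗ 𝟙_ M ⟶ Y) (g : X ⟶ Y) (m : X ⊗ X ⟶ X) (b : X ⊗ X ⊗ 𝟙_ M ⟶ X),
        a = (ρ_ X).hom ≫ g → b = X ◁ (ρ_ X).hom ≫ m →
        ((X ◁ (X ◁ (λ_ (𝟙_ M)).inv ≫ (α_ _ _ _).inv) ≫ (α_ _ _ _).inv) ≫
        ((X ◁ X ◁ 𝟙 (𝟙_ M) ≫ b) ⊗ₘ 𝟙 (𝟙_ M))) ≫ a = X ◁ (ρ_ X).hom ≫ m ≫ g := by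
      intro X Y a g m b h h'
      rw [h, h', tensorHom_id]
      monoidal
    have h₄ := (key _ _ _ _ h₃ (A.preAct_mul c)).symm.trans (h₂.symm.trans h₁)
    rw [Category.id_comp] at h₄
    have h₅ := h₄.trans (prodList_pair (X := fun _ : Σ _ : Unit, Bool => A.obj c)
      (fun _ => A.mapHom f) ⟨(), true⟩ ⟨(), false⟩)
    rwa [cancel_epi] at h₅

/-- The functor to monoid objects underlying an algebra. -/
noncomputable def toMon : C ⥤ Mon M where
  obj t := Mon.mk (A.obj t)
  map f := Mon.ofHom (A.mapHom f)
  map_id t := by ext; exact A.mapHom_id t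
  map_comp f g := by ext; exact A.mapHom_comp f g

/-- For orthogonal `f₁`, `f₂` the two orderings of the inputs represent the same operation;
evaluating it with either representative gives the two products, related by the symmetry. -/
theorem commuteIn_mapHom {c₁ c₂ t : C} {f₁ : c₁ ⟶ t} {f₂ : c₂ ⟶ t} (h : P.perp f₁ f₂) :
    CommuteIn (A.mapHom f₁) (A.mapHom f₂) := by
  let c : Bool → C := fun b => match b with | true => c₁ | false => c₂
  let f : ∀ b, c b ⟶ t := fun b => match b with | true => f₁ | false => f₂
  let l : Arrangement Bool := ⟨[false, true], by simp, by intro i; cases i <;> simp⟩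
  have h₁ : QOp.mk P (Arrangement.bool, f) = QOp.mk P (l, f) :=
    Quotient.sound ⟨rfl, .single ⟨[], [], true, false, rfl, rfl, h⟩⟩
  have h₂ := A.preAct_eq_prodList Arrangement.bool f
  have h₃ := A.preAct_eq_prodList l f
  have h₄ := A.act_swap (QOp.mk P (l, f)) [] [] true false Arrangement.bool.nodup
    Arrangement.bool.complete l.nodup l.complete
  have h₅ : prodList (fun i => A.mapHom (f i)) [true, false] =
      swapFront (A.obj c₁) (A.obj c₂) (𝟙_ M) ≫
        prodList (fun i => A.mapHom (f i)) [false, true] := by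
    refine h₂.symm.trans (Eq.trans ?_ (congrArg _ h₃))
    refine Eq.trans ?_ h₄.symm
    exact congrArg (fun x => A.act (O := qftOperad P) x Arrangement.bool) h₁
  have key : ∀ {X Y N : M} [MonObj N] (a : X ⟶ N) (b : Y ⟶ N),
      X ◁ (ρ_ Y).hom ≫ (a ⊗ₘ b) ≫ MonObj.mul =
        swapFront X Y (𝟙_ M) ≫ Y ◁ (ρ_ X).hom ≫ (b ⊗ₘ a) ≫ MonObj.mul → CommuteIn a b := by
    intro X Y N _ a b h
    unfold CommuteIn
    rw [← cancel_epi (X ◁ (ρ_ Y).hom), h, swapFront]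
    simp only [Category.assoc]
    monoidal
  exact key _ _ ((prodList_pair _ _ _).symm.trans (h₅.trans (congrArg _ (prodList_pair _ _ _))))

namespace Hom

variable {A} {B : OperadAlgebra M (qftOperad P)}

theorem preAct_app (h : Hom A B) {ι : Type} [Finite ι] {c : ι → C} {t : C} (o : PreOp c t) :
    A.preAct o ≫ h.app t = tensorListMap (fun i => h.app (c i)) o.1.list ≫ B.preAct o :=
  h.act_app (QOp.mk P o) o.1

instance isMonHom_app (h : Hom A B) (t : C) : IsMonHom (h.app t) := by
  constructor
  · exact (h.preAct_app (PreOp.one t)).trans (Category.id_comp _)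
  · have key : ∀ {X Y : M} {a : X ⊗ X ⊗ 𝟙_ M ⟶ X} {b : Y ⊗ Y ⊗ 𝟙_ M ⟶ Y} {m : X ⊗ X ⟶ X}
        {m' : Y ⊗ Y ⟶ Y} (f : X ⟶ Y), a = X ◁ (ρ_ X).hom ≫ m → b = Y ◁ (ρ_ Y).hom ≫ m' →
        a ≫ f = (f ⊗ₘ (f ⊗ₘ 𝟙 (𝟙_ M))) ≫ b → m ≫ f = (f ⊗ₘ f) ≫ m' := by
      rintro X Y _ _ m m' f rfl rfl h
      rw [← cancel_epi (X ◁ (ρ_ X).hom), ← Category.assoc, h, ← id_tensorHom, ← id_tensorHom,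
        tensorHom_comp_tensorHom_assoc, tensorHom_comp_tensorHom_assoc]
      simp
    exact key _ (A.preAct_mul t) (B.preAct_mul t) (h.preAct_app (PreOp.mul t))

theorem naturality (h : Hom A B) {c t : C} (f : c ⟶ t) :
    A.mapHom f ≫ h.app t = h.app c ≫ B.mapHom f := by
  have key : ∀ {X Y X' Y' : M} {a : X ⊗ 𝟙_ M ⟶ Y} {b : X' ⊗ 𝟙_ M ⟶ Y'} {m : X ⟶ Y}
      {m' : X' ⟶ Y'} (f : X ⟶ X') (g : Y ⟶ Y'), a = (ρ_ X).hom ≫ m → b = (ρ_ X').hom ≫ m' →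
      a ≫ g = (f ⊗ₘ 𝟙 (𝟙_ M)) ≫ b → m ≫ g = f ≫ m' := by
    rintro X Y X' Y' _ _ m m' f g rfl rfl h
    rw [← cancel_epi (ρ_ X).hom, ← Category.assoc, h]
    simp
  exact key _ _ (A.preAct_unit_eq f) (B.preAct_unit_eq f)
    (h.preAct_app (c := fun _ : Unit => c) (Arrangement.unit, fun _ => f))

end Hom

/-- A natural family of morphisms of monoid objects is a morphism of algebras. -/
def homOfNatural {A B : OperadAlgebra M (qftOperad P)} (φ : ∀ t, A.obj t ⟶ B.obj t)
    [∀ t, IsMonHom (φ t)] (hφ : ∀ {c t : C} (f : c ⟶ t), A.mapHom f ≫ φ t = φ c ≫ B.mapHom f) :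
    Hom A B where
  app := φ
  act_app := by
    intro ι _ c t o l
    obtain ⟨⟨l', f⟩, rfl⟩ := QOp.exists_rep o
    rw [act_eq, act_eq, Category.assoc, prodList_comp, ← Category.assoc,
      permHom_naturality _ l.nodup, Category.assoc, tensorListMap_prodList]
    simp only [hφ]

end OperadAlgebra

/-! ### Recovering the functor from its algebra -/

section

variable {M : Type u} [Category.{v} M] [MonoidalCategory M] [SymmetricCategory M]
  {D : Type v} [SmallCategory D] {Q : OrthogonalityRelation D}
  (F : D ⥤ Mon M) (hF : ∀ ⦃c₁ c₂ c : D⦄ (f₁ : c₁ ⟶ c) (f₂ : c₂ ⟶ c), Q.perp f₁ f₂ →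
      CommuteIn (F.map f₁).hom (F.map f₂).hom)

theorem algebraOfMon_mapHom {c t : D} (f : c ⟶ t) :
    (algebraOfMon F hF).mapHom f = (F.map f).hom := by
  have h : (algebraOfMon F hF).preAct (c := fun _ : Unit => c) (Arrangement.unit, fun _ => f) =
      prodList (fun _ => (F.map f).hom) [()] := monAct_mk_self F hF _ _
  have h' := h.trans (prodList_singleton (X := fun _ : Unit => (F.obj c).X) _ ())
  have key : ∀ {X Y : M} (a : X ⊗ 𝟙_ M ⟶ Y) (g : X ⟶ Y), a = (ρ_ X).hom ≫ g →
      (ρ_ X).inv ≫ a = g := by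
    rintro X Y a g rfl
    simp
  exact key _ _ h'

theorem algebraOfMon_mul (t : D) : (algebraOfMon F hF).mul t = MonObj.mul (X := (F.obj t).X) := by
  have h : (algebraOfMon F hF).preAct (PreOp.mul t) =
      prodList (fun _ => (F.map (𝟙 t)).hom) [true, false] := monAct_mk_self F hF _ _
  have h' := h.trans (prodList_pair (X := fun _ : Bool => (F.obj t).X) _ _ _)
  have key : ∀ {X : M} (a : X ⊗ X ⊗ 𝟙_ M ⟶ X) (m : X ⊗ X ⟶ X) (g : X ⟶ X),
      g = 𝟙 _ → a = X ◁ (ρ_ X).hom ≫ (g ⊗ₘ g) ≫ m → X ◁ (ρ_ X).inv ≫ a = m := by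
    rintro X a m g rfl rfl
    simp
  exact key _ _ _ (by rw [F.map_id]; rfl) h'

/-- A unit is determined by the multiplication, so comparing multiplications suffices. The two
structures live on the same object but are only propositionally equal. -/
theorem algebraOfMon_monObj (t : D) :
    (algebraOfMon F hF).monObj t = (inferInstance : MonObj (F.obj t).X) :=
  MonObj.ext _ _ (algebraOfMon_mul F hF t)

end

end AQFT

namespace AQFT

/-! ### Free monoid objects, quotients and presentations -/

section Closed

variable {M : Type u} [Category.{v} M] [MonoidalCategory M] [MonoidalClosed M]

/-- Tensoring with `A` is a left adjoint, hence preserves epimorphisms. -/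
instance epi_whiskerLeft (A : M) {X Y : M} (f : X ⟶ Y) [Epi f] : Epi (A ◁ f) :=
  inferInstanceAs (Epi ((tensorLeft A).map f))

instance epi_whiskerRight [BraidedCategory M] (A : M) {X Y : M} (f : X ⟶ Y) [Epi f] :
    Epi (f ▷ A) := by
  have : f ▷ A = (β_ X A).hom ≫ A ◁ f ≫ (β_ Y A).inv := by
    rw [← BraidedCategory.braiding_naturality_left_assoc, Iso.hom_inv_id, Category.comp_id]
  rw [this]
  infer_instance

instance epi_tensorHom [BraidedCategory M] {X Y X' Y' : M} (f : X ⟶ Y) (g : X' ⟶ Y') [Epi f]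
    [Epi g] : Epi (f ⊗ₘ g) := by
  rw [MonoidalCategory.tensorHom_def]
  infer_instance

section

variable {J : Type w} (F : J → M) [HasCoproduct F] (A : M)

/-- After currying, this is the uniqueness part of the universal property of the coproduct. -/
theorem sigma_whiskerLeft_hom_ext {Y : M} {f g : A ⊗ ∐ F ⟶ Y}
    (h : ∀ j, A ◁ Sigma.ι F j ≫ f = A ◁ Sigma.ι F j ≫ g) : f = g := by
  apply MonoidalClosed.curry_injective
  refine Sigma.hom_ext _ _ fun j => ?_
  rw [← MonoidalClosed.curry_natural_left, ← MonoidalClosed.curry_natural_left, h]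

theorem sigma_whiskerRight_hom_ext [BraidedCategory M] {Y : M} {f g : (∐ F) ⊗ A ⟶ Y}
    (h : ∀ j, Sigma.ι F j ▷ A ≫ f = Sigma.ι F j ▷ A ≫ g) : f = g := by
  rw [← cancel_epi (β_ A (∐ F)).hom]
  refine sigma_whiskerLeft_hom_ext F A fun j => ?_
  rw [BraidedCategory.braiding_naturality_right_assoc,
    BraidedCategory.braiding_naturality_right_assoc, h]

/-- Morphisms out of a tensor product with a coproduct. -/
noncomputable def tensorSigmaDesc {Y : M} (f : ∀ j, A ⊗ F j ⟶ Y) : A ⊗ ∐ F ⟶ Y :=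
  MonoidalClosed.uncurry (Sigma.desc fun j => MonoidalClosed.curry (f j))

@[simp]
theorem whiskerLeft_ι_tensorSigmaDesc {Y : M} (f : ∀ j, A ⊗ F j ⟶ Y) (j : J) :
    A ◁ Sigma.ι F j ≫ tensorSigmaDesc F A f = f j := by
  rw [tensorSigmaDesc, ← MonoidalClosed.uncurry_natural_left, Sigma.ι_desc,
    MonoidalClosed.uncurry_curry]

/-- Morphisms out of a tensor product with a coproduct. -/
noncomputable def sigmaTensorDesc [BraidedCategory M] {Y : M} (f : ∀ j, F j ⊗ A ⟶ Y) :
    (∐ F) ⊗ A ⟶ Y :=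
  (β_ (∐ F) A).hom ≫ tensorSigmaDesc F A fun j => (β_ (F j) A).inv ≫ f j

@[simp]
theorem ι_whiskerRight_sigmaTensorDesc [BraidedCategory M] {Y : M} (f : ∀ j, F j ⊗ A ⟶ Y)
    (j : J) : Sigma.ι F j ▷ A ≫ sigmaTensorDesc F A f = f j := by
  rw [sigmaTensorDesc, BraidedCategory.braiding_naturality_left_assoc,
    whiskerLeft_ι_tensorSigmaDesc, Iso.hom_inv_id_assoc]

end

end Closed

section Free

open MonObj

variable {M : Type u} [Category.{v} M] [MonoidalCategory M]

/-- The tensor powers of an object. -/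
@[reducible]
def tensorPow (X : M) : ℕ → M
  | 0 => 𝟙_ M
  | n + 1 => X ⊗ tensorPow X n

/-- The action of a tensor power obtained by iterating `s`. -/
def tensorPowAct {X Y Z : M} (y : Z ⟶ Y) (s : X ⊗ Y ⟶ Y) : ∀ n, tensorPow X n ⊗ Z ⟶ Y
  | 0 => (λ_ Z).hom ≫ y
  | n + 1 => (α_ X (tensorPow X n) Z).hom ≫ X ◁ tensorPowAct y s n ≫ s

/-- The product of the factors of a tensor power. -/
def tensorPowProd {X N : M} [MonObj N] (x : X ⟶ N) : ∀ n, tensorPow X n ⟶ N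
  | 0 => η
  | n + 1 => (x ⊗ₘ tensorPowProd x n) ≫ μ

variable [HasColimits M] (X : M)

/-- The object underlying the free monoid object on `X`. -/
noncomputable def FreeMon : M :=
  -- The index set is lifted to the universe `v` of the colimits that `M` is assumed to have.
  ∐ fun n : ULift.{v} ℕ => tensorPow X n.down

namespace FreeMon

/-- The inclusion of a tensor power. -/
noncomputable def incl (n : ℕ) : tensorPow X n ⟶ FreeMon X :=
  Sigma.ι (fun n : ULift.{v} ℕ => tensorPow X n.down) ⟨n⟩

variable {X} in
theorem hom_ext {Y : M} {f g : FreeMon X ⟶ Y} (h : ∀ n, incl X n ≫ f = incl X n ≫ g) : f = g :=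
  Sigma.hom_ext _ _ fun n => h n.down

/-- The unit. -/
noncomputable def one : 𝟙_ M ⟶ FreeMon X :=
  incl X 0

variable [MonoidalClosed M]

/-- The multiplication by a generator from the left. -/
noncomputable def cons : X ⊗ FreeMon X ⟶ FreeMon X :=
  tensorSigmaDesc _ X fun n : ULift.{v} ℕ => incl X (n.down + 1)

theorem whiskerLeft_incl_cons (n : ℕ) : X ◁ incl X n ≫ cons X = incl X (n + 1) :=
  whiskerLeft_ι_tensorSigmaDesc _ X (fun n : ULift.{v} ℕ => incl X (n.down + 1)) ⟨n⟩

variable {X} in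
theorem whiskerLeft_hom_ext {A Y : M} {f g : A ⊗ FreeMon X ⟶ Y}
    (h : ∀ n, A ◁ incl X n ≫ f = A ◁ incl X n ≫ g) : f = g :=
  sigma_whiskerLeft_hom_ext _ A fun n => h n.down

variable [BraidedCategory M]

variable {X}

theorem whiskerRight_hom_ext {A Y : M} {f g : FreeMon X ⊗ A ⟶ Y}
    (h : ∀ n, incl X n ▷ A ≫ f = incl X n ▷ A ≫ g) : f = g :=
  sigma_whiskerRight_hom_ext _ A fun n => h n.down

/-- Recursion on the first factor. -/
noncomputable def recTensor {Y Z : M} (y : Z ⟶ Y) (s : X ⊗ Y ⟶ Y) : FreeMon X ⊗ Z ⟶ Y :=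
  sigmaTensorDesc _ Z fun n : ULift.{v} ℕ => tensorPowAct y s n.down

theorem incl_recTensor {Y Z : M} (y : Z ⟶ Y) (s : X ⊗ Y ⟶ Y) (n : ℕ) :
    incl X n ▷ Z ≫ recTensor y s = tensorPowAct y s n :=
  ι_whiskerRight_sigmaTensorDesc _ Z (fun n : ULift.{v} ℕ => tensorPowAct y s n.down) ⟨n⟩

theorem one_recTensor {Y Z : M} (y : Z ⟶ Y) (s : X ⊗ Y ⟶ Y) :
    one X ▷ Z ≫ recTensor y s = (λ_ Z).hom ≫ y :=
  incl_recTensor y s 0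

theorem cons_recTensor {Y Z : M} (y : Z ⟶ Y) (s : X ⊗ Y ⟶ Y) :
    cons X ▷ Z ≫ recTensor y s = (α_ _ _ _).hom ≫ X ◁ recTensor y s ≫ s := by
  -- The free monoid stands between `X` and `Z`; it is moved to the last position, where equality
  -- can be tested on tensor powers.
  rw [← cancel_epi (α_ _ _ _).inv, ← cancel_epi (X ◁ (β_ _ _).hom)]
  rw [← cancel_epi (α_ _ _ _).hom]
  refine whiskerLeft_hom_ext fun n => ?_
  have h : (X ⊗ Z) ◁ incl X n ≫ (α_ X Z (FreeMon X)).hom ≫ X ◁ (β_ Z (FreeMon X)).hom =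
      (α_ X Z (tensorPow X n)).hom ≫ X ◁ (β_ Z (tensorPow X n)).hom ≫ X ◁ incl X n ▷ Z := by
    rw [tensor_whiskerLeft, Category.assoc, Category.assoc, Iso.inv_hom_id_assoc,
      ← MonoidalCategory.whiskerLeft_comp, BraidedCategory.braiding_naturality_right,
      MonoidalCategory.whiskerLeft_comp]
  rw [reassoc_of% h, reassoc_of% h]
  congr 2
  rw [Iso.inv_hom_id_assoc, ← MonoidalCategory.whiskerLeft_comp_assoc, incl_recTensor,
    associator_inv_naturality_middle_assoc, ← comp_whiskerRight_assoc, whiskerLeft_incl_cons,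
    incl_recTensor]
  simp [tensorPowAct]

/-- List induction with a parameter `Z`: a morphism is determined by its value `y` on the empty word
and the rule `s` for prepending a letter. Right unitality, associativity and multiplicativity of
`lift` all follow by showing that both sides obey the same recursion. -/
theorem tensor_hom_ext {Y Z : M} {y : Z ⟶ Y} {s : X ⊗ Y ⟶ Y} {f g : FreeMon X ⊗ Z ⟶ Y}
    (hf : one X ▷ Z ≫ f = (λ_ Z).hom ≫ y) (hf' : cons X ▷ Z ≫ f = (α_ _ _ _).hom ≫ X ◁ f ≫ s)
    (hg : one X ▷ Z ≫ g = (λ_ Z).hom ≫ y) (hg' : cons X ▷ Z ≫ g = (α_ _ _ _).hom ≫ X ◁ g ≫ s) :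
    f = g := by
  refine whiskerRight_hom_ext fun n => ?_
  induction n with
  | zero => exact hf.trans hg.symm
  | succ n ih =>
    rw [← whiskerLeft_incl_cons, comp_whiskerRight, Category.assoc, Category.assoc, hf', hg',
      associator_naturality_middle_assoc, associator_naturality_middle_assoc,
      ← MonoidalCategory.whiskerLeft_comp_assoc, ← MonoidalCategory.whiskerLeft_comp_assoc, ih]

/-- The multiplication. -/
noncomputable def mul : FreeMon X ⊗ FreeMon X ⟶ FreeMon X :=
  recTensor (𝟙 _) (cons X)

theorem one_mul : one X ▷ FreeMon X ≫ mul = (λ_ (FreeMon X)).hom :=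
  (one_recTensor _ _).trans (Category.comp_id _)

theorem cons_mul : cons X ▷ FreeMon X ≫ mul = (α_ _ _ _).hom ≫ X ◁ mul ≫ cons X :=
  cons_recTensor _ _

noncomputable instance : MonObj (FreeMon X) where
  one := one X
  mul := mul
  one_mul := one_mul
  mul_one := by
    refine tensor_hom_ext (y := one X) (s := cons X) ?_ ?_ ?_ ?_
    · rw [← whisker_exchange_assoc, one_mul, leftUnitor_naturality]
    · rw [← whisker_exchange_assoc, cons_mul]
      simp
    · rw [rightUnitor_naturality, unitors_equal]
    · simp
  mul_assoc := by
    rw [← cancel_epi (α_ _ _ _).inv, Iso.inv_hom_id_assoc]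
    -- Recursion on the first of three words, with the product of the other two as initial value.
    refine tensor_hom_ext (y := mul) (s := cons X) ?_ ?_ ?_ ?_
    · rw [associator_inv_naturality_left_assoc, ← comp_whiskerRight_assoc, one_mul]
      simp
    · rw [associator_inv_naturality_left_assoc, ← comp_whiskerRight_assoc, cons_mul]
      simp [cons_mul]
    · rw [← whisker_exchange_assoc, one_mul, leftUnitor_naturality]
    · rw [← whisker_exchange_assoc, cons_mul]
      simp

variable (X) in
/-- The inclusion of the generators. -/
noncomputable def gen : X ⟶ FreeMon X :=
  (ρ_ X).inv ≫ X ◁ one X ≫ cons X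

theorem gen_mul : gen X ▷ FreeMon X ≫ μ = cons X := by
  change gen X ▷ FreeMon X ≫ mul = cons X
  rw [gen, comp_whiskerRight, comp_whiskerRight, Category.assoc, Category.assoc, cons_mul,
    associator_naturality_middle_assoc, ← MonoidalCategory.whiskerLeft_comp_assoc, one_mul]
  simp

theorem incl_succ (n : ℕ) : incl X (n + 1) = (gen X ⊗ₘ incl X n) ≫ μ := by
  rw [MonoidalCategory.tensorHom_def', Category.assoc, gen_mul, whiskerLeft_incl_cons]

section

variable {N : M} [MonObj N] (x : X ⟶ N)

/-- The universal property of the free monoid object. -/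
noncomputable def lift : FreeMon X ⟶ N :=
  Sigma.desc fun n : ULift.{v} ℕ => tensorPowProd x n.down

omit [MonoidalClosed M] [BraidedCategory M] in
theorem incl_lift (n : ℕ) : incl X n ≫ lift x = tensorPowProd x n :=
  Sigma.ι_desc (fun n : ULift.{v} ℕ => tensorPowProd x n.down) _

omit [BraidedCategory M] in
theorem cons_lift : cons X ≫ lift x = (x ⊗ₘ lift x) ≫ μ := by
  refine whiskerLeft_hom_ext fun n => ?_
  rw [reassoc_of% @whiskerLeft_incl_cons, incl_lift, ← id_tensorHom,
    tensorHom_comp_tensorHom_assoc, incl_lift, Category.id_comp]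
  rfl

instance : IsMonHom (lift x) where
  one_hom := incl_lift x 0
  mul_hom := by
    -- Both sides start from the image of the second word and multiply by `x` on the left for each
    -- letter of the first.
    refine tensor_hom_ext (y := lift x) (s := x ▷ N ≫ μ) ?_ ?_ ?_ ?_
    · exact (Category.assoc _ _ _).symm.trans (by erw [one_mul])
    · refine ((reassoc_of% (cons_mul (X := X))) _).trans ?_
      rw [cons_lift, MonoidalCategory.tensorHom_def']
      simp
      rfl
    · have h : one X ≫ lift x = η := incl_lift x 0
      rw [← tensorHom_id, tensorHom_comp_tensorHom_assoc, h]
      simp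
    · rw [← tensorHom_id, tensorHom_comp_tensorHom_assoc, cons_lift, Category.id_comp,
        ← cancel_epi (α_ _ _ _).inv, associator_inv_tensorHom_mul, MonoidalCategory.tensorHom_def']
      simp

omit [BraidedCategory M] in
theorem gen_lift : gen X ≫ lift x = x := by
  have h : one X ≫ lift x = η := incl_lift x 0
  rw [gen, Category.assoc, Category.assoc, cons_lift, ← id_tensorHom,
    tensorHom_comp_tensorHom_assoc, h]
  simp

variable {x} in
theorem monHom_ext {f g : FreeMon X ⟶ N} [IsMonHom f] [IsMonHom g]
    (h : gen X ≫ f = gen X ≫ g) : f = g := by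
  refine hom_ext fun n => ?_
  induction n with
  | zero => exact (IsMonHom.one_hom f).trans (IsMonHom.one_hom g).symm
  | succ n ih =>
    rw [incl_succ, Category.assoc, Category.assoc, IsMonHom.mul_hom, IsMonHom.mul_hom,
      tensorHom_comp_tensorHom_assoc, tensorHom_comp_tensorHom_assoc, h, ih]

end

end FreeMon

end Free

/-! ### Commutation with units and products -/

section

open MonObj

variable {M : Type u} [Category.{v} M] [MonoidalCategory M] [SymmetricCategory M]

theorem CommuteIn.one_left {Z N : M} [MonObj N] (z : Z ⟶ N) : CommuteIn (η : 𝟙_ M ⟶ N) z := by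
  simp [CommuteIn]

/-- `(xy)z = x(yz) = x(zy) = (xz)y = (zx)y = z(xy)`, with the hexagon identity matching the
symmetries. -/
theorem CommuteIn.mul_left {X Y Z N : M} [MonObj N] {x : X ⟶ N} {y : Y ⟶ N} {z : Z ⟶ N}
    (hx : CommuteIn x z) (hy : CommuteIn y z) : CommuteIn ((x ⊗ₘ y) ≫ μ) z := by
  unfold CommuteIn at hx hy ⊢
  have h₁ : (x ⊗ₘ ((y ⊗ₘ z) ≫ μ)) ≫ μ = X ◁ (β_ Y Z).hom ≫ (x ⊗ₘ ((z ⊗ₘ y) ≫ μ)) ≫ μ := by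
    rw [hy, ← id_tensorHom, tensorHom_comp_tensorHom_assoc, Category.id_comp]
  have h₂ : ((x ⊗ₘ z) ≫ μ ⊗ₘ y) ≫ μ = (β_ X Z).hom ▷ Y ≫ ((z ⊗ₘ x) ≫ μ ⊗ₘ y) ≫ μ := by
    rw [hx, ← tensorHom_id, tensorHom_comp_tensorHom_assoc, Category.id_comp]
  rw [← cancel_epi (α_ _ _ _).inv, associator_inv_tensorHom_mul, h₁,
    ← associator_inv_tensorHom_mul, h₂, ← associator_inv_tensorHom_mul,
    BraidedCategory.braiding_tensor_left_hom]
  simp only [Category.assoc, Iso.inv_hom_id_assoc, Iso.hom_inv_id_assoc]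

end

end AQFT

namespace AQFT

/-! ### Quotients of monoid objects -/

section Quotient

open MonObj

variable {M : Type u} [Category.{v} M] [MonoidalCategory M] [SymmetricCategory M]
  [MonoidalClosed M]

/-- Commutation with `z` is inherited by units and products, hence by every tensor power of the
generators, and these jointly determine morphisms out of the free monoid. -/
theorem FreeMon.commuteIn [HasColimits M] {X N Z : M} [MonObj N] {h : FreeMon X ⟶ N} [IsMonHom h]
    {z : Z ⟶ N} (hz : CommuteIn (gen X ≫ h) z) : CommuteIn h z := by
  have h' : ∀ n, CommuteIn (incl X n ≫ h) z := by
    intro n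
    induction n with
    | zero =>
      have : incl X 0 ≫ h = η := IsMonHom.one_hom h
      rw [this]
      exact .one_left z
    | succ n ih =>
      rw [incl_succ, Category.assoc, IsMonHom.mul_hom, tensorHom_comp_tensorHom_assoc]
      exact hz.mul_left ih
  refine whiskerRight_hom_ext fun n => ?_
  have := h' n
  unfold CommuteIn at this
  rw [← tensorHom_id, tensorHom_comp_tensorHom_assoc, Category.id_comp, this, tensorHom_id,
    BraidedCategory.braiding_naturality_left_assoc, ← id_tensorHom,
    tensorHom_comp_tensorHom_assoc, Category.id_comp]

variable [HasColimits M] {T G : M} [MonObj T] (u v : G ⟶ T)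

/-- The two-sided ideal multiple of a morphism to a monoid object. -/
def idealMul : T ⊗ G ⊗ T ⟶ T :=
  (𝟙 T ⊗ₘ ((u ⊗ₘ 𝟙 T) ≫ μ)) ≫ μ

omit [HasColimits M] [MonoidalClosed M] [SymmetricCategory M] in
theorem idealMul_comp {N : M} [MonObj N] (h : T ⟶ N) [IsMonHom h] :
    idealMul u ≫ h = (h ⊗ₘ (((u ≫ h) ⊗ₘ h) ≫ μ)) ≫ μ := by
  rw [idealMul, Category.assoc, IsMonHom.mul_hom, tensorHom_comp_tensorHom_assoc, Category.assoc,
    IsMonHom.mul_hom, tensorHom_comp_tensorHom_assoc, Category.id_comp]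

/-- The object underlying the quotient of a monoid object by a pair of morphisms. -/
noncomputable def QuotMon : M :=
  coequalizer (idealMul u) (idealMul v)

namespace QuotMon

/-- The projection. -/
noncomputable def π : T ⟶ QuotMon u v :=
  coequalizer.π _ _

instance : Epi (π u v) :=
  inferInstanceAs (Epi (coequalizer.π _ _))

omit [SymmetricCategory M] [MonoidalClosed M] in
theorem condition : idealMul u ≫ π u v = idealMul v ≫ π u v :=
  coequalizer.condition _ _

variable {u v} in
omit [SymmetricCategory M] [MonoidalClosed M] in
theorem exists_desc {Y : M} (f : T ⟶ Y) (h : idealMul u ≫ f = idealMul v ≫ f) :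
    ∃ g : QuotMon u v ⟶ Y, π u v ≫ g = f :=
  ⟨coequalizer.desc f h, coequalizer.π_desc f h⟩

variable {u v} in
omit [SymmetricCategory M] in
theorem exists_desc_left {A Y : M} (f : A ⊗ T ⟶ Y)
    (h : A ◁ idealMul u ≫ f = A ◁ idealMul v ≫ f) :
    ∃ g : A ⊗ QuotMon u v ⟶ Y, A ◁ π u v ≫ g = f := by
  obtain ⟨g, hg⟩ := exists_desc (u := u) (v := v) (MonoidalClosed.curry f) (by
    rw [← MonoidalClosed.curry_natural_left, ← MonoidalClosed.curry_natural_left, h])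
  refine ⟨MonoidalClosed.uncurry g, ?_⟩
  rw [← MonoidalClosed.uncurry_natural_left, hg, MonoidalClosed.uncurry_curry]

variable {u v} in
theorem exists_desc_right {A Y : M} (f : T ⊗ A ⟶ Y)
    (h : idealMul u ▷ A ≫ f = idealMul v ▷ A ≫ f) :
    ∃ g : QuotMon u v ⊗ A ⟶ Y, π u v ▷ A ≫ g = f := by
  obtain ⟨g, hg⟩ := exists_desc_left (u := u) (v := v) ((β_ A T).hom ≫ f) (by
    rw [BraidedCategory.braiding_naturality_right_assoc, h,
      BraidedCategory.braiding_naturality_right_assoc])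
  refine ⟨(β_ _ _).hom ≫ g, ?_⟩
  rw [BraidedCategory.braiding_naturality_left_assoc, hg]
  simp

/-- Left and right multiples of an ideal multiple are again ideal multiples (`h₁`, `h₂`). Hence `μ ≫
π` is compatible with the relation in each variable and descends to the quotient one variable at a
time. -/
theorem exists_mul : ∃ m : QuotMon u v ⊗ QuotMon u v ⟶ QuotMon u v,
    (π u v ⊗ₘ π u v) ≫ m = μ ≫ π u v := by
  have h₁ : ∀ w : G ⟶ T, T ◁ idealMul w ≫ μ = (α_ T T (G ⊗ T)).inv ≫ μ ▷ _ ≫ idealMul w := by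
    intro w
    rw [idealMul, ← id_tensorHom, ← associator_inv_tensorHom_mul, id_tensorHom_id,
      Category.id_comp, ← tensorHom_id, tensorHom_comp_tensorHom_assoc, Category.comp_id,
      Category.id_comp]
  have h₂ : ∀ w : G ⟶ T, idealMul w ▷ T ≫ μ =
      (α_ T (G ⊗ T) T).hom ≫ T ◁ (α_ G T T).hom ≫ T ◁ G ◁ μ ≫ idealMul w := by
    intro w
    have h : (α_ G T T).inv ≫ ((w ⊗ₘ 𝟙 T) ≫ μ ⊗ₘ 𝟙 T) ≫ μ = G ◁ μ ≫ (w ⊗ₘ 𝟙 T) ≫ μ := by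
      rw [associator_inv_tensorHom_mul, id_tensorHom_id, Category.id_comp, ← id_tensorHom,
        tensorHom_comp_tensorHom_assoc, Category.id_comp, Category.comp_id]
    rw [idealMul, ← tensorHom_id, ← cancel_epi (α_ _ _ _).inv, associator_inv_tensorHom_mul,
      Iso.inv_hom_id_assoc, ← MonoidalCategory.whiskerLeft_comp_assoc, ← id_tensorHom,
      tensorHom_comp_tensorHom_assoc, Category.id_comp, Category.assoc, ← h,
      Iso.hom_inv_id_assoc]
  obtain ⟨a, ha⟩ := exists_desc_left (u := u) (v := v) (A := T) (μ ≫ π u v) (by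
    rw [reassoc_of% (h₁ u), reassoc_of% (h₁ v), condition])
  obtain ⟨m, hm⟩ := exists_desc_right (u := u) (v := v) a (by
    -- The second variable already lies in the quotient; composing with the epimorphism from `T`
    -- brings the question back to `μ`.
    rw [← cancel_epi ((T ⊗ G ⊗ T) ◁ π u v), whisker_exchange_assoc, whisker_exchange_assoc, ha,
      reassoc_of% (h₂ u), reassoc_of% (h₂ v), condition])
  refine ⟨m, ?_⟩
  rw [MonoidalCategory.tensorHom_def', Category.assoc, hm, ha]

/-- The multiplication. -/
noncomputable def mul : QuotMon u v ⊗ QuotMon u v ⟶ QuotMon u v :=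
  (exists_mul u v).choose

theorem π_mul : (π u v ⊗ₘ π u v) ≫ mul u v = μ ≫ π u v :=
  (exists_mul u v).choose_spec

theorem comp_π_mul {X Y : M} (x : X ⟶ T) (y : Y ⟶ T) :
    (x ≫ π u v ⊗ₘ y ≫ π u v) ≫ mul u v = (x ⊗ₘ y) ≫ μ ≫ π u v := by
  rw [← π_mul, tensorHom_comp_tensorHom_assoc]

noncomputable instance : MonObj (QuotMon u v) where
  one := η ≫ π u v
  mul := mul u v
  one_mul := by
    have h := comp_π_mul u v η (𝟙 T)
    rw [Category.id_comp, MonoidalCategory.tensorHom_def', Category.assoc] at h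
    rw [← cancel_epi (𝟙_ M ◁ π u v), h, tensorHom_id, MonObj.one_mul_assoc, leftUnitor_naturality]
  mul_one := by
    have h := comp_π_mul u v (𝟙 T) η
    rw [Category.id_comp, MonoidalCategory.tensorHom_def, Category.assoc] at h
    rw [← cancel_epi (π u v ▷ 𝟙_ M), h, id_tensorHom, MonObj.mul_one_assoc, rightUnitor_naturality]
  mul_assoc := by
    have h := comp_π_mul u v μ (𝟙 T)
    have h' := comp_π_mul u v (𝟙 T) μ
    rw [Category.id_comp] at h h'
    rw [← cancel_epi ((π u v ⊗ₘ π u v) ⊗ₘ π u v), associator_naturality_assoc, ← tensorHom_id,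
      ← id_tensorHom, tensorHom_comp_tensorHom_assoc, tensorHom_comp_tensorHom_assoc, π_mul]
    erw [Category.comp_id]
    rw [h, h', tensorHom_id, id_tensorHom, MonObj.mul_assoc_assoc]

instance : IsMonHom (π u v) where
  one_hom := rfl
  mul_hom := (π_mul u v).symm

omit [SymmetricCategory M] [MonoidalClosed M] in
-- The relation itself is the ideal multiple with unit coefficients on both sides.
theorem relation : u ≫ π u v = v ≫ π u v := by
  have h : ∀ w : G ⟶ T, (ρ_ G).inv ≫ (λ_ _).inv ≫ (η ⊗ₘ (𝟙 G ⊗ₘ η)) ≫ idealMul w = w := by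
    intro w
    simp only [idealMul]
    rw [tensorHom_comp_tensorHom_assoc, tensorHom_comp_tensorHom_assoc]
    simp
  have h' := (ρ_ G).inv ≫= (λ_ _).inv ≫= (η ⊗ₘ (𝟙 G ⊗ₘ η)) ≫= condition u v
  simpa only [← Category.assoc] using
    (congrArg (· ≫ π u v) (h u)).symm.trans
      (Eq.trans (by simpa using h') (congrArg (· ≫ π u v) (h v)))

variable {u v}

theorem exists_lift {N : M} [MonObj N] (h : T ⟶ N) [IsMonHom h] (hh : u ≫ h = v ≫ h) :
    ∃ (g : QuotMon u v ⟶ N) (_ : IsMonHom g), π u v ≫ g = h := by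
  let g : QuotMon u v ⟶ N := coequalizer.desc h (by rw [idealMul_comp, idealMul_comp, hh])
  have hg : π u v ≫ g = h := coequalizer.π_desc _ _
  refine ⟨g, ⟨?_, ?_⟩, hg⟩
  · refine (Category.assoc _ _ _).trans ?_
    rw [hg, IsMonHom.one_hom]
  · rw [← cancel_epi (π u v ⊗ₘ π u v), ← Category.assoc]
    change (_ ≫ mul u v) ≫ _ = _
    rw [π_mul, Category.assoc, hg, IsMonHom.mul_hom, tensorHom_comp_tensorHom_assoc, hg]

theorem commuteIn {N Z : M} [MonObj N] {h : QuotMon u v ⟶ N} {z : Z ⟶ N}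
    (hz : CommuteIn (π u v ≫ h) z) : CommuteIn h z := by
  unfold CommuteIn at hz ⊢
  rw [← cancel_epi (π u v ▷ Z), ← tensorHom_id, tensorHom_comp_tensorHom_assoc, Category.id_comp,
    hz, tensorHom_id, BraidedCategory.braiding_naturality_left_assoc, ← id_tensorHom,
    tensorHom_comp_tensorHom_assoc, Category.id_comp]

end QuotMon

end Quotient

/-! ### Monoid objects given by generators and relations -/

section Presentation

open MonObj

variable {M : Type u} [Category.{v} M] [MonoidalCategory M] [SymmetricCategory M]
  [MonoidalClosed M] [HasColimits M]

/-- Monoid objects with a given presentation exist. The relations are given by pairs of operations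
which are natural in the monoid object. -/
theorem exists_presentation {J R : Type v} (X : J → M) (G : R → M)
    (u v : ∀ (r : R) (N : Mon M), (∀ j, X j ⟶ N.X) → (G r ⟶ N.X))
    (hu : ∀ (r : R) {N N' : Mon M} (h : N ⟶ N') (x : ∀ j, X j ⟶ N.X),
      u r N x ≫ h.hom = u r N' fun j => x j ≫ h.hom)
    (hv : ∀ (r : R) {N N' : Mon M} (h : N ⟶ N') (x : ∀ j, X j ⟶ N.X),
      v r N x ≫ h.hom = v r N' fun j => x j ≫ h.hom) :
    ∃ (B : Mon M) (x : ∀ j, X j ⟶ B.X), (∀ r, u r B x = v r B x) ∧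
      (∀ (N : Mon M) (y : ∀ j, X j ⟶ N.X), (∀ r, u r N y = v r N y) →
        ∃ h : B ⟶ N, ∀ j, x j ≫ h.hom = y j) ∧
      (∀ (N : Mon M) (h h' : B ⟶ N), (∀ j, x j ≫ h.hom = x j ≫ h'.hom) → h = h') ∧
      ∀ (N : Mon M) (h : B ⟶ N) (Z : M) (z : Z ⟶ N.X),
        (∀ j, CommuteIn (x j ≫ h.hom) z) → CommuteIn h.hom z := by
  -- The relations are imposed on the universal tuple `g` of generators of the free monoid;
  -- naturality (`hu`, `hv`) transports them to any tuple in any monoid object.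
  let T : Mon M := Mon.mk (FreeMon (∐ X))
  let g : ∀ j, X j ⟶ T.X := fun j => Sigma.ι X j ≫ FreeMon.gen (∐ X)
  let u' : ∐ G ⟶ T.X := Sigma.desc fun r => u r T g
  let v' : ∐ G ⟶ T.X := Sigma.desc fun r => v r T g
  let B : Mon M := Mon.mk (QuotMon u' v')
  let p : T ⟶ B := Mon.ofHom (QuotMon.π u' v')
  have hp : Epi p.hom := inferInstanceAs (Epi (QuotMon.π u' v'))
  have huv : ∀ {N : Mon M} (h : T ⟶ N), (∀ r, u r T g ≫ h.hom = v r T g ≫ h.hom) ↔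
      u' ≫ h.hom = v' ≫ h.hom := by
    intro N h
    constructor
    · intro hr
      refine Sigma.hom_ext _ _ fun r => ?_
      simp only [u', v', Sigma.ι_desc_assoc, hr]
    · intro h' r
      simpa [u', v'] using Sigma.ι G r ≫= h'
  refine ⟨B, fun j => g j ≫ p.hom, ?_, ?_, ?_, ?_⟩
  · intro r
    rw [← hu, ← hv]
    exact (huv p).2 (QuotMon.relation u' v') r
  · intro N y hy
    let k : T ⟶ N := Mon.ofHom (FreeMon.lift (Sigma.desc y))
    have hk : ∀ j, g j ≫ k.hom = y j := by
      intro j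
      simp only [g, Category.assoc]
      refine (Sigma.ι X j ≫= FreeMon.gen_lift (Sigma.desc y)).trans ?_
      simp
    obtain ⟨l, hl, hl'⟩ := QuotMon.exists_lift (u := u') (v := v') k.hom ((huv k).1 fun r => by
      rw [hu, hv]
      simp only [hk, hy])
    refine ⟨Mon.ofHom (A := QuotMon u' v') l, fun j => ?_⟩
    rw [Category.assoc]
    exact (g j ≫= hl').trans (hk j)
  · intro N h h' hh
    have : p ≫ h = p ≫ h' := by
      ext1
      refine FreeMon.monHom_ext (f := (p ≫ h).hom) (g := (p ≫ h').hom) ?_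
      refine Sigma.hom_ext _ _ fun j => ?_
      simpa [g] using hh j
    ext1
    rw [← cancel_epi p.hom]
    exact congrArg Mon.Hom.hom this
  · intro N h Z z hz
    refine QuotMon.commuteIn (FreeMon.commuteIn (h := (p ≫ h).hom) ?_)
    refine sigma_whiskerRight_hom_ext X Z fun j => ?_
    have := hz j
    unfold CommuteIn at this
    simp only [g, Category.assoc] at this
    rw [← tensorHom_id, tensorHom_comp_tensorHom_assoc, Category.id_comp, tensorHom_id,
      BraidedCategory.braiding_naturality_left_assoc, ← id_tensorHom,
      tensorHom_comp_tensorHom_assoc, Category.id_comp]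
    exact this

end Presentation

end AQFT

namespace AQFT

variable {M : Type u} [Category.{v} M] [MonoidalCategory M] [SymmetricCategory M]
  {C : Type v} [SmallCategory C] {D : Type v} [SmallCategory D]
  {P : OrthogonalityRelation C} {Q : OrthogonalityRelation D}

/-! ### Pullback of underlying functors and monoid structures -/

section Pullback

variable (L : C ⥤ D) (hL : IsOrthogonal P Q L) (E : OperadAlgebra M (qftOperad Q))

theorem qftPullback_mapHom {c c' : C} (f : c ⟶ c') :
    ((qftPullback L hL).obj E).mapHom f = E.mapHom (L.map f) :=
  rfl

theorem qftPullback_mul (c : C) :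
    ((qftPullback L hL).obj E).mul c = E.mul (L.obj c) := by
  have h : (Arrangement.bool, fun _ => L.map (𝟙 c)) = PreOp.mul (L.obj c) :=
    Prod.ext rfl (funext fun _ => L.map_id c)
  exact congrArg (fun o : PreOp (fun _ : Bool => L.obj c) (L.obj c) =>
    E.obj (L.obj c) ◁ (ρ_ _).inv ≫ E.act (O := qftOperad Q) (QOp.mk Q o) Arrangement.bool) h

/-- The pulled back multiplication is the operation labelled by `L.map (𝟙 c)` instead of `𝟙 (L.obj
c)`, so the structures agree only propositionally. The lemmas below transport `IsMonHom` along such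
equalities. -/
theorem qftPullback_monObj (c : C) :
    ((qftPullback L hL).obj E).monObj c = E.monObj (L.obj c) :=
  MonObj.ext _ _ (qftPullback_mul L hL E c)

variable {L hL E}

theorem isMonHom_qftPullback_iff {X : M} [MonObj X] {c : C} (f : X ⟶ E.obj (L.obj c)) :
    IsMonHom (N := ((qftPullback L hL).obj E).obj c) f ↔ IsMonHom (N := E.obj (L.obj c)) f :=
  iff_of_eq (congrArg (fun m => @IsMonHom _ _ _ _ _ _ m f) (qftPullback_monObj L hL E c))

theorem isMonHom_algebraOfMon_iff {F : D ⥤ Mon M} {hF : ∀ ⦃c₁ c₂ c : D⦄ (f₁ : c₁ ⟶ c)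
    (f₂ : c₂ ⟶ c), Q.perp f₁ f₂ → CommuteIn (F.map f₁).hom (F.map f₂).hom} {X : M} [MonObj X]
    {d : D} (f : X ⟶ (F.obj d).X) :
    IsMonHom (N := (algebraOfMon F hF).obj d) f ↔ IsMonHom (N := (F.obj d).X) f :=
  iff_of_eq (congrArg (fun m => @IsMonHom _ _ _ _ _ _ m f) (algebraOfMon_monObj F hF d))

theorem isMonHom_algebraOfMon_iff' {F : D ⥤ Mon M} {hF : ∀ ⦃c₁ c₂ c : D⦄ (f₁ : c₁ ⟶ c)
    (f₂ : c₂ ⟶ c), Q.perp f₁ f₂ → CommuteIn (F.map f₁).hom (F.map f₂).hom} {X : M} [MonObj X]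
    {d : D} (f : (F.obj d).X ⟶ X) :
    IsMonHom (M := (algebraOfMon F hF).obj d) f ↔ IsMonHom (M := (F.obj d).X) f :=
  iff_of_eq (congrArg (fun m => @IsMonHom _ _ _ _ _ m _ f) (algebraOfMon_monObj F hF d))

end Pullback

/-! ### Extension along `L` by generators and relations -/

section Extension

open MonObj

omit [SymmetricCategory M] in
theorem tensorHom_mul_comp {X Y N N' : M} [MonObj N] [MonObj N'] (x : X ⟶ N) (y : Y ⟶ N)
    (h : N ⟶ N') [IsMonHom h] : ((x ⊗ₘ y) ≫ μ) ≫ h = (x ≫ h ⊗ₘ y ≫ h) ≫ μ := by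
  rw [Category.assoc, IsMonHom.mul_hom, tensorHom_comp_tensorHom_assoc]

variable (Q) (L : C ⥤ D) (A : OperadAlgebra M (qftOperad P))

/-- The condition for morphisms from the values of `A` to a monoid object to define a morphism from
the value at `d` of the extension of `A` along `L`. -/
structure IsCompatible {d : D} {N : M} [MonObj N] (x : ∀ c, (L.obj c ⟶ d) → (A.obj c ⟶ N)) :
    Prop where
  isMonHom : ∀ c g, IsMonHom (x c g)
  naturality : ∀ {c c'} (f : c ⟶ c') (g : L.obj c' ⟶ d), A.mapHom f ≫ x c' g = x c (L.map f ≫ g)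
  commuteIn : ∀ {c₁ c₂} (g₁ : L.obj c₁ ⟶ d) (g₂ : L.obj c₂ ⟶ d), Q.perp g₁ g₂ →
    CommuteIn (x c₁ g₁) (x c₂ g₂)

/-- The index type of the relations in the extension of an algebra along `L` at `d`. -/
inductive ExtensionRel (d : D) : Type v
  | one (c : C) (g : L.obj c ⟶ d)
  | mul (c : C) (g : L.obj c ⟶ d)
  | nat {c c' : C} (f : c ⟶ c') (g : L.obj c' ⟶ d)
  | comm {c₁ c₂ : C} (g₁ : L.obj c₁ ⟶ d) (g₂ : L.obj c₂ ⟶ d) (h : Q.perp g₁ g₂)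

namespace ExtensionRel

variable {Q L} {d : D}

/-- The source of a relation. -/
def source : ExtensionRel Q L d → M
  | one _ _ => 𝟙_ M
  | mul c _ => A.obj c ⊗ A.obj c
  | nat (c := c) _ _ => A.obj c
  | comm (c₁ := c₁) (c₂ := c₂) _ _ _ => A.obj c₁ ⊗ A.obj c₂

variable {N : M} [MonObj N] (x : ∀ j : Σ c, (L.obj c ⟶ d), A.obj j.1 ⟶ N)

/-- The left hand side of a relation. -/
noncomputable def lhs : ∀ r : ExtensionRel Q L d, r.source A ⟶ N
  | one c g => A.one c ≫ x ⟨c, g⟩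
  | mul c g => A.mul c ≫ x ⟨c, g⟩
  | nat (c' := c') f g => A.mapHom f ≫ x ⟨c', g⟩
  | comm g₁ g₂ _ => (x ⟨_, g₁⟩ ⊗ₘ x ⟨_, g₂⟩) ≫ μ

/-- The right hand side of a relation. -/
noncomputable def rhs : ∀ r : ExtensionRel Q L d, r.source A ⟶ N
  | one _ _ => η
  | mul c g => (x ⟨c, g⟩ ⊗ₘ x ⟨c, g⟩) ≫ μ
  | nat (c := c) f g => x ⟨c, L.map f ≫ g⟩
  | comm g₁ g₂ _ => (β_ _ _).hom ≫ (x ⟨_, g₂⟩ ⊗ₘ x ⟨_, g₁⟩) ≫ μ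

theorem lhs_comp {N' : M} [MonObj N'] (h : N ⟶ N') [IsMonHom h] (r : ExtensionRel Q L d) :
    r.lhs A x ≫ h = r.lhs A fun j => x j ≫ h := by
  cases r with
  | one => exact Category.assoc _ _ _
  | mul => exact Category.assoc _ _ _
  | nat => exact Category.assoc _ _ _
  | comm => exact tensorHom_mul_comp _ _ h

theorem rhs_comp {N' : M} [MonObj N'] (h : N ⟶ N') [IsMonHom h] (r : ExtensionRel Q L d) :
    r.rhs A x ≫ h = r.rhs A fun j => x j ≫ h := by
  cases r with
  | one => exact IsMonHom.one_hom h
  | mul => exact tensorHom_mul_comp _ _ h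
  | nat => rfl
  | comm => exact (Category.assoc _ _ _).trans (congrArg _ (tensorHom_mul_comp _ _ h))

theorem lhs_eq_rhs_iff : (∀ r : ExtensionRel Q L d, r.lhs A x = r.rhs A x) ↔
    IsCompatible Q L A fun c g => x ⟨c, g⟩ := by
  constructor
  · intro h
    exact ⟨fun c g => ⟨h (one c g), h (mul c g)⟩, fun f g => h (nat f g),
      fun g₁ g₂ hg => h (comm g₁ g₂ hg)⟩
  · rintro h (⟨c, g⟩ | ⟨c, g⟩ | ⟨f, g⟩ | ⟨g₁, g₂, hg⟩)
    · exact (h.isMonHom c g).one_hom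
    · exact (h.isMonHom c g).mul_hom
    · exact h.naturality f g
    · exact h.commuteIn g₁ g₂ hg

end ExtensionRel

variable {Q L A} in
theorem IsCompatible.reindex {d d' : D} {N : M} [MonObj N]
    {x : ∀ c, (L.obj c ⟶ d') → (A.obj c ⟶ N)} (hx : IsCompatible Q L A x) (k : d ⟶ d') :
    IsCompatible Q L A fun c g => x c (g ≫ k) where
  isMonHom c g := hx.isMonHom c _
  naturality f g := by rw [hx.naturality, Category.assoc]
  commuteIn g₁ g₂ hg := hx.commuteIn _ _ (Q.postcomp k hg)

variable [MonoidalClosed M] [HasColimits M]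

/-- The value at `d` is presented by a generator object `A.obj c` for each `g : L.obj c ⟶ d` and the
relations `ExtensionRel`, which together say exactly that a tuple is compatible. -/
theorem exists_extension_obj (d : D) :
    ∃ (B : Mon M) (x : ∀ c, (L.obj c ⟶ d) → (A.obj c ⟶ B.X)), IsCompatible Q L A x ∧
      (∀ (N : Mon M) (y : ∀ c, (L.obj c ⟶ d) → (A.obj c ⟶ N.X)), IsCompatible Q L A y →
        ∃ h : B ⟶ N, ∀ c g, x c g ≫ h.hom = y c g) ∧
      (∀ (N : Mon M) (h h' : B ⟶ N), (∀ c g, x c g ≫ h.hom = x c g ≫ h'.hom) → h = h') ∧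
      ∀ (N : Mon M) (h : B ⟶ N) (Z : M) (z : Z ⟶ N.X),
        (∀ c g, CommuteIn (x c g ≫ h.hom) z) → CommuteIn h.hom z := by
  obtain ⟨B, x, h₁, h₂, h₃, h₄⟩ := exists_presentation
    (fun j : Σ c, (L.obj c ⟶ d) => A.obj j.1) (fun r : ExtensionRel Q L d => r.source A)
    (fun r N x => r.lhs A x) (fun r N x => r.rhs A x)
    (fun r _ _ h x => r.lhs_comp A x h.hom) (fun r _ _ h x => r.rhs_comp A x h.hom)
  refine ⟨B, fun c g => x ⟨c, g⟩, (ExtensionRel.lhs_eq_rhs_iff A x).1 h₁, ?_, ?_, ?_⟩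
  · intro N y hy
    obtain ⟨h, hh⟩ := h₂ N (fun j => y j.1 j.2)
      ((ExtensionRel.lhs_eq_rhs_iff A fun j => y j.1 j.2).2 hy)
    exact ⟨h, fun c g => hh ⟨c, g⟩⟩
  · exact fun N h h' hh => h₃ N h h' fun j => hh j.1 j.2
  · exact fun N h Z z hz => h₄ N h Z z fun j => hz j.1 j.2

/-- A morphism `k : d ⟶ d'` reindexes the compatible family at `d'` to one at `d`, so the universal
property at `d` supplies the functoriality. -/
theorem exists_extension :
    ∃ (B : D ⥤ Mon M) (x : ∀ d c, (L.obj c ⟶ d) → (A.obj c ⟶ (B.obj d).X)),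
      (∀ d, IsCompatible Q L A (x d)) ∧
      (∀ (c) (d d' : D) (g : L.obj c ⟶ d) (k : d ⟶ d'), x d c g ≫ (B.map k).hom = x d' c (g ≫ k)) ∧
      (∀ (d) (N : Mon M) (y : ∀ c, (L.obj c ⟶ d) → (A.obj c ⟶ N.X)), IsCompatible Q L A y →
        ∃ h : B.obj d ⟶ N, ∀ c g, x d c g ≫ h.hom = y c g) ∧
      (∀ (d) (N : Mon M) (h h' : B.obj d ⟶ N),
        (∀ c g, x d c g ≫ h.hom = x d c g ≫ h'.hom) → h = h') ∧
      ∀ ⦃d₁ d₂ d : D⦄ (k₁ : d₁ ⟶ d) (k₂ : d₂ ⟶ d), Q.perp k₁ k₂ →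
        CommuteIn (B.map k₁).hom (B.map k₂).hom := by
  choose B x hx h₁ h₂ h₃ using exists_extension_obj Q L A
  choose m hm using fun (d d' : D) (k : d ⟶ d') => h₁ d (B d') _ ((hx d').reindex k)
  let F : D ⥤ Mon M :=
    { obj := B
      map := fun {d d'} k => m d d' k
      map_id := fun d => h₂ d _ _ _ fun c g => by simp [hm]
      map_comp := fun {d d' d''} k k' => h₂ d _ _ _ fun c g => by simp [hm, reassoc_of% hm] }
  refine ⟨F, x, hx, fun c d d' g k => hm d d' k c g, h₁, h₂, fun d₁ d₂ d k₁ k₂ hk => ?_⟩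
  -- Commutation is reduced to generators in each variable in turn. The generators are then indexed
  -- by `g₁ ≫ k₁` and `g₂ ≫ k₂`, which are orthogonal by stability under precomposition.
  refine h₃ _ _ _ _ _ fun c₁ g₁ => (h₃ _ _ _ _ _ fun c₂ g₂ => ?_).symm
  change CommuteIn (x d₂ c₂ g₂ ≫ (m d₂ d k₂).hom) (x d₁ c₁ g₁ ≫ (m d₁ d k₁).hom)
  rw [hm, hm]
  exact (hx d).commuteIn _ _ (Q.precomp _ _ (Q.symm hk))

end Extension

/-! ### Existence of the left adjoint -/

section LeftAdjoint

variable {L : C ⥤ D} {hL : IsOrthogonal P Q L}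

/-- The components of a morphism to a pullback. -/
def pullbackApp {A : OperadAlgebra M (qftOperad P)} {E : OperadAlgebra M (qftOperad Q)}
    (f : A ⟶ (qftPullback L hL).obj E) (c : C) : A.obj c ⟶ E.obj (L.obj c) :=
  OperadAlgebra.Hom.app f c

theorem pullbackApp_naturality {A : OperadAlgebra M (qftOperad P)}
    {E : OperadAlgebra M (qftOperad Q)} (f : A ⟶ (qftPullback L hL).obj E) {c c' : C}
    (k : c ⟶ c') : A.mapHom k ≫ pullbackApp f c' = pullbackApp f c ≫ E.mapHom (L.map k) :=
  OperadAlgebra.Hom.naturality f k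

instance isMonHom_pullbackApp {A : OperadAlgebra M (qftOperad P)}
    {E : OperadAlgebra M (qftOperad Q)} (f : A ⟶ (qftPullback L hL).obj E) (c : C) :
    IsMonHom (pullbackApp f c) :=
  (isMonHom_qftPullback_iff _).1 (OperadAlgebra.Hom.isMonHom_app f c)

theorem isCompatible_pullbackApp {A : OperadAlgebra M (qftOperad P)}
    {E : OperadAlgebra M (qftOperad Q)} (f : A ⟶ (qftPullback L hL).obj E) (d : D) :
    IsCompatible Q L A fun c (g : L.obj c ⟶ d) => pullbackApp f c ≫ E.mapHom g where
  isMonHom c g := inferInstance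
  naturality k g := by
    rw [E.mapHom_comp, ← Category.assoc, pullbackApp_naturality, Category.assoc]
  commuteIn g₁ g₂ hg := (E.commuteIn_mapHom hg).precomp _ _

variable [MonoidalClosed M] [HasColimits M] (L hL)

/-- It suffices to find a universal arrow from each `A`; the algebra of the extension of `A` along
`L` provides one. -/
theorem isRightAdjoint_qftPullback : (qftPullback (M := M) L hL).IsRightAdjoint := by
  rw [isRightAdjoint_iff_hasInitial_structuredArrow]
  intro A
  obtain ⟨F, x, hx, hF, h₁, h₂, h₃⟩ := exists_extension Q L A
  let B : OperadAlgebra M (qftOperad Q) := algebraOfMon F h₃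
  have hB : ∀ {c : C} {d d' : D} (g : L.obj c ⟶ d) (k : d ⟶ d'),
      x d c g ≫ B.mapHom k = x d' c (g ≫ k) := by
    intro c d d' g k
    rw [← hF]
    exact congrArg _ (algebraOfMon_mapHom F h₃ k)
  -- The universal arrow at `c` includes the generator indexed by the identity of `L.obj c`.
  let i : ∀ c, A.obj c ⟶ ((qftPullback L hL).obj B).obj c := fun c => x (L.obj c) c (𝟙 _)
  have hi : ∀ c, IsMonHom (i c) := fun c =>
    (isMonHom_qftPullback_iff (hL := hL) (E := B) (i c)).2
      ((isMonHom_algebraOfMon_iff _).2 ((hx _).isMonHom c _))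
  let η : A ⟶ (qftPullback L hL).obj B := OperadAlgebra.homOfNatural i fun {c c'} f => by
    rw [qftPullback_mapHom]
    refine ((hx _).naturality f _).trans (Eq.trans ?_ (hB _ _).symm)
    simp
  -- The generator indexed by `g` is the one indexed by the identity followed by `B.mapHom g`; hence
  -- `η` followed by the pullback of `k` determines `k` on all generators.
  have hη : ∀ {E : OperadAlgebra M (qftOperad Q)} (k : B ⟶ E) (d : D) (c : C) (g : L.obj c ⟶ d),
      x d c g ≫ OperadAlgebra.Hom.app k d =
        pullbackApp (η ≫ (qftPullback L hL).map k) c ≫ E.mapHom g := by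
    intro E k d c g
    have h := hB (𝟙 (L.obj c)) g
    rw [Category.id_comp] at h
    refine (congrArg (fun z => z ≫ OperadAlgebra.Hom.app k d) h.symm).trans ?_
    refine (Category.assoc _ _ _).trans (Eq.trans ?_ (Category.assoc _ _ _).symm)
    exact congrArg (fun z => x (L.obj c) c (𝟙 _) ≫ z) (OperadAlgebra.Hom.naturality k g)
  have hη' : ∀ s : StructuredArrow A (qftPullback (M := M) L hL),
      ∃ k : B ⟶ s.right, η ≫ (qftPullback L hL).map k = s.hom := by
    intro s
    let E := s.right
    let f : A ⟶ (qftPullback L hL).obj E := s.hom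
    -- The family `f c` followed by the action of `g` on `E` is compatible, so it extends to `B d`.
    -- Naturality in `d` is then checked on generators.
    choose τ hτ using fun d => h₁ d (E.toMon.obj d) _ (isCompatible_pullbackApp f d)
    have hτ' : ∀ d, IsMonHom (M := B.obj d) (N := E.obj d) (τ d).hom := fun d =>
      (isMonHom_algebraOfMon_iff' _).2 (τ d).isMonHom_hom
    let k : B ⟶ E := OperadAlgebra.homOfNatural (B := E) (fun d => (τ d).hom) fun {d d'} k => by
      have h : F.map k ≫ τ d' = τ d ≫ E.toMon.map k := by
        refine h₂ _ _ _ _ fun c g => ?_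
        have e₁ := (reassoc_of% (hF c d d' g k)) (τ d').hom
        refine e₁.trans ((hτ d' c _).trans ?_)
        rw [E.mapHom_comp, ← Category.assoc, ← hτ d c g]
        exact Category.assoc _ _ _
      exact (congrArg (fun z => z ≫ (τ d').hom) (algebraOfMon_mapHom F h₃ k)).trans
        (congrArg Mon.Hom.hom h)
    refine ⟨k, OperadAlgebra.Hom.ext (funext fun c => ?_)⟩
    refine (hτ (L.obj c) c (𝟙 _)).trans ?_
    rw [E.mapHom_id]
    exact Category.comp_id _
  have hη'' : ∀ {E : OperadAlgebra M (qftOperad Q)} (k k' : B ⟶ E),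
      η ≫ (qftPullback L hL).map k = η ≫ (qftPullback L hL).map k' → k = k' := by
    intro E k k' h
    refine OperadAlgebra.Hom.ext (funext fun d => ?_)
    have hk : ∀ k : B ⟶ E, IsMonHom (M := (F.obj d).X) (N := E.obj d)
        (OperadAlgebra.Hom.app k d) := fun k =>
      (isMonHom_algebraOfMon_iff' _).1 (OperadAlgebra.Hom.isMonHom_app k d)
    have := hk k
    have := hk k'
    refine congrArg Mon.Hom.hom (h₂ d (E.toMon.obj d)
      (Mon.ofHom (A := (F.obj d).X) (B := E.obj d) (OperadAlgebra.Hom.app k d))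
      (Mon.ofHom (A := (F.obj d).X) (B := E.obj d) (OperadAlgebra.Hom.app k' d)) fun c g => ?_)
    exact (hη k d c g).trans (Eq.trans (by rw [h]) (hη k' d c g).symm)
  refine IsInitial.hasInitial (X := StructuredArrow.mk η) (IsInitial.ofUniqueHom
    (fun s => StructuredArrow.homMk (hη' s).choose (hη' s).choose_spec) fun s m => ?_)
  ext1
  exact hη'' _ _ ((StructuredArrow.w m).trans (hη' s).choose_spec.symm)

end LeftAdjoint

/-! ### Full faithfulness for localizations -/

section Localization

variable (W : MorphismProperty C) (L : C ⥤ D) [L.IsLocalization W] (hL : IsOrthogonal P Q L)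

/-- The functor underlying an algebra. -/
noncomputable def OperadAlgebra.toFunctor (A : OperadAlgebra M (qftOperad Q)) : D ⥤ M where
  obj d := A.obj d
  map f := A.mapHom f
  map_id d := A.mapHom_id d
  map_comp f g := A.mapHom_comp f g

include W in
-- A morphism of algebras is in particular a natural transformation of functors to `M`, and on a
-- localization such a transformation is determined by its components at the objects `L.obj c`.
theorem faithful_qftPullback : (qftPullback (M := M) L hL).Faithful where
  map_injective {A B f g} h := by
    have : ∀ f : A ⟶ B, ∃ τ : A.toFunctor ⟶ B.toFunctor, τ.app = OperadAlgebra.Hom.app f :=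
      fun f => ⟨⟨OperadAlgebra.Hom.app f, fun _ _ k => OperadAlgebra.Hom.naturality f k⟩, rfl⟩
    obtain ⟨τ, hτ⟩ := this f
    obtain ⟨τ', hτ'⟩ := this g
    have : τ = τ' := Localization.natTrans_ext L W fun c => by
      rw [hτ, hτ']
      exact congrFun (congrArg OperadAlgebra.Hom.app h) c
    refine OperadAlgebra.Hom.ext ?_
    rw [← hτ, ← hτ', this]

include W in
-- The underlying transformation extends along `L` because whiskering with a localization is full;
-- it remains to see that the extension respects the monoid structures.
theorem full_qftPullback : (qftPullback (M := M) L hL).Full where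
  map_surjective {A B} f := by
    have := Localization.full_whiskeringLeft L W M
    have := Localization.essSurj L W
    let f' : L ⋙ A.toFunctor ⟶ L ⋙ B.toFunctor :=
      ⟨OperadAlgebra.Hom.app f, fun _ _ k => OperadAlgebra.Hom.naturality f k⟩
    obtain ⟨τ, hτ⟩ := ((Functor.whiskeringLeft C D M).obj L).map_surjective f'
    have hτ' : ∀ c, τ.app (L.obj c) = OperadAlgebra.Hom.app f c := fun c =>
      congrArg (fun σ => NatTrans.app σ c) hτ
    have h : ∀ c, IsMonHom (M := A.obj (L.obj c)) (N := B.obj (L.obj c)) (τ.app (L.obj c)) := by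
      intro c
      have := OperadAlgebra.Hom.isMonHom_app f c
      rw [qftPullback_monObj, qftPullback_monObj] at this
      rwa [hτ']
    -- Each `d` is isomorphic to some `L.obj c`, and by naturality the component at `d` is the one
    -- at `L.obj c` conjugated by monoid morphisms.
    have h' : ∀ d, IsMonHom (M := A.obj d) (N := B.obj d) (τ.app d) := by
      intro d
      let e := L.objObjPreimageIso d
      have key : ∀ (t : ∀ d, A.obj d ⟶ B.obj d), IsMonHom (t (L.obj (L.objPreimage d))) →
          A.mapHom e.hom ≫ t d = t _ ≫ B.mapHom e.hom → IsMonHom (t d) := by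
        intro t ht h
        have : t d = A.mapHom e.inv ≫ t _ ≫ B.mapHom e.hom := by
          rw [← h, ← Category.assoc, ← A.mapHom_comp, e.inv_hom_id, A.mapHom_id, Category.id_comp]
        rw [this]
        infer_instance
      exact key τ.app (h _) (τ.naturality e.hom)
    exact ⟨OperadAlgebra.homOfNatural (A := A) (B := B) (fun d => τ.app d) fun k => τ.naturality k,
      OperadAlgebra.Hom.ext (funext hτ')⟩

end Localization

end AQFT

/-- For a localization `L : C ⥤ D` of a small orthogonal category `(C, ⊥)` at `W`, the functor
`O_L^*` from algebras over the operad of `(D, L_*(⊥))` to algebras over the operad of `(C, ⊥)` has a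
left adjoint and is fully faithful, and the counit of the adjunction is an isomorphism. -/
theorem proposition5p4 {M : Type u} [Category.{v} M] [MonoidalCategory M] [SymmetricCategory M]
    [MonoidalClosed M] [HasLimits M] [HasColimits M]
    {C : Type v} [SmallCategory C] (P : AQFT.OrthogonalityRelation C) (W : MorphismProperty C)
    {D : Type v} [SmallCategory D] (L : C ⥤ D) [L.IsLocalization W] :
    (AQFT.qftPullback (M := M) L (P.isOrthogonal_pushforward L)).IsRightAdjoint ∧
    (AQFT.qftPullback (M := M) L (P.isOrthogonal_pushforward L)).Full ∧
    (AQFT.qftPullback (M := M) L (P.isOrthogonal_pushforward L)).Faithful ∧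
    ∀ (F : AQFT.OperadAlgebra M (AQFT.qftOperad P) ⥤
        AQFT.OperadAlgebra M (AQFT.qftOperad (P.pushforward L)))
      (adj : F ⊣ AQFT.qftPullback (M := M) L (P.isOrthogonal_pushforward L)),
      IsIso adj.counit := by
  have hF := AQFT.full_qftPullback (M := M) W L (P.isOrthogonal_pushforward L)
  have hF' := AQFT.faithful_qftPullback (M := M) W L (P.isOrthogonal_pushforward L)
  -- The last component is the general fact that a fully faithful right adjoint has invertible
  -- counit.
  exact ⟨AQFT.isRightAdjoint_qftPullback L _, hF, hF', fun _ _ => inferInstance⟩
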